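/- Let $M$ be a smooth manifold (Hausdorff, $\sigma$-compact, without boundary), let $(A,\rho_A,[\cdot,\cdot])$ be a Lie algebroid on $M$, i.e. a smooth real vector bundle $A\to M$ of finite rank with a smooth bundle map $\rho_A:A\to TM$ over $\mathrm{id}_M$ and an $\mathbb{R}$-Lie algebra bracket on the space $\Gamma(A)$ of smooth sections such that $[a,fb]=f[a,b]+(\rho_A\circ a)(f)\,b$ for $a,b\in\Gamma(A)$, $f\in C^\infty(M)$, and let $E\to M$ be a smooth real vector bundle of finite rank. *Forms and cohomology.* $\mathcal{A}lt^k_{\mathbb R}(\Gamma(A);C^\infty(M))$ is the space of alternating $\mathbb{R}$-multilinear (not necessarily $C^\infty(M)$-multilinear) maps $\Gamma(A)^k\to C^\infty(M)$, with the differential $$(d_{A,\mathbb R}\eta)(a_0,\dots,a_k)=\sum_i(-1)^i(\rho_A\circ a_i)\big(\eta(a_0,..\hat a_i..,a_k)\big)+\sum_{i<j}(-1)^{i+j}\eta([a_i,a_j],a_0,..\hat a_i..\hat a_j..,a_k).$$ $H^k_{\rho_A,\mathbb R}(A;M\times\mathbb R)$ is the space of closed $k$-forms modulo exact $k$-forms,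 and $H_{\rho_A,\mathbb R}(A;M\times\mathbb R)=\bigoplus_{k\ge 0}H^k_{\rho_A,\mathbb R}(A;M\times\mathbb R)$. *Connections.* An $\mathbb{R}$-linear $A$-connection $\nabla$ on $E$ is an $\mathbb{R}$-linear map $a\mapsto\nabla_a$ from $\Gamma(A)$ to $\mathrm{End}_{\mathbb R}(\Gamma(E))$ with $\nabla_a(f\nu)=f\nabla_a\nu+(\rho_A\circ a)(f)\nu$. Its curvature $R^\nabla_{a,b}=\nabla_a\nabla_b-\nabla_b\nabla_a-\nabla_{[a,b]}$ is $C^\infty(M)$-linear on $\Gamma(E)$, i.e. $R^\nabla_{a,b}\in\Gamma(\mathrm{End}\,E)$. Put $$(R^\nabla)^p(a_1,\dots,a_{2p})=\frac1{2^p}\sum_{\tau\in S_{2p}}\mathrm{sgn}(\tau)\,R^\nabla_{a_{\tau(1)},a_{\tau(2)}}\circ\cdots\circ R^\nabla_{a_{\tau(2p-1)},a_{\tau(2p)}},$$ and $\mathrm{ch}_p(\nabla)=\mathrm{Tr}\big((R^\nabla)^p\big)\in\mathcal{A}lt^{2p}_{\mathbb R}(\Gamma(A);C^\infty(M))$ with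 the fibrewise trace, for $p\ge1$. *Chern–Simons forms.* Let $\mathrm{pr}_2:\mathbb R\times M\to M$. For $\mathbb R$-linear $A$-connections $\nabla^0,\nabla^1$ on $E$ let $\nabla^{\mathrm{aff}}$ be the connection on $\mathrm{pr}_2^*E$ along the Lie algebra $\mathbb R\,\frac{\partial}{\partial t}\oplus\Gamma(A)$ (with $[\frac{\partial}{\partial t},a]=0$, acting on $C^\infty(\mathbb R\times M)$ by $\frac{\partial}{\partial t}$ and, slicewise in $t$, by $\rho_A\circ a$) given, for $\sigma\in\Gamma(\mathrm{pr}_2^*E)$, by $$\nabla^{\mathrm{aff}}_{\partial/\partial t}\sigma=\frac{\partial\sigma}{\partial t},\qquad(\nabla^{\mathrm{aff}}_a\sigma)(t,\cdot)=(1-t)\,\nabla^0_a(\sigma(t,\cdot))+t\,\nabla^1_a(\sigma(t,\cdot)).$$ With curvature and $\mathrm{ch}_p(\nabla^{\mathrm{aff}})$ defined by the same formulas, put $$\mathrm{cs}_p(\nabla^0,\nabla^1)(a_1,\dots,a_{2p-1})=\int_0^1\mathrm{ch}_p(\nabla^{\mathrm{aff}})\Big(\frac{\partial}{\partial t},a_1,\dots,a_{2p-1}\Big)\Big|_{(t,\cdot)}dt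 .$$ **Corollary (Chern character).** 1. For every $\mathbb R$-linear $A$-connection $\nabla$ on $E$ and every $p\ge1$, $d_{A,\mathbb R}(\mathrm{ch}_p(\nabla))=0$. 2. For all $\mathbb R$-linear $A$-connections $\nabla^0,\nabla^1$ on $E$ and every $p\ge1$, $d_{A,\mathbb R}\big(\mathrm{cs}_p(\nabla^0,\nabla^1)\big)=\mathrm{ch}_p(\nabla^1)-\mathrm{ch}_p(\nabla^0)$. 3. Consequently the class $\mathrm{ch}_p(A,E)=[\mathrm{ch}_p(\nabla)]\in H^{2p}_{\rho_A,\mathbb R}(A;M\times\mathbb R)$ does not depend on $\nabla$. 4. The Chern character $\mathrm{ch}(A,E)=\sum_{p\ge1}\mathrm{ch}_p(A,E)$ is a well-defined element of $H_{\rho_A,\mathbb R}(A;M\times\mathbb R)$: there is exactly one element of $\bigoplus_kH^k_{\rho_A,\mathbb R}(A;M\times\mathbb R)$ whose component of degree $2p$ is $[\mathrm{ch}_p(\nabla)]$ for every $p\ge1$ and every $\mathbb R$-linear $A$-connection $\nabla$ on $E$, and whose other components vanish. -/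

import Mathlib

open Bundle Manifold ContDiff Topology
set_option linter.unusedSectionVars false

noncomputable section

section Generic

variable {E : Type*} [NormedAddCommGroup E] [NormedSpace ℝ E]
  {H : Type*} [TopologicalSpace H] {I : ModelWithCorners ℝ E H}
  {N : Type*} [TopologicalSpace N] [ChartedSpace H N]
  {F : Type*} [NormedAddCommGroup F] [NormedSpace ℝ F]
  {V : N → Type*} [TopologicalSpace (TotalSpace F V)] [∀ x, AddCommGroup (V x)]
  [∀ x, Module ℝ (V x)] [∀ x, TopologicalSpace (V x)] [FiberBundle F V] [VectorBundle ℝ F V]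

/-- Smooth sections form a module over the ring of smooth functions. -/
instance ContMDiffSection.instModuleSmooth :
    Module C^∞⟮I, N; 𝓘(ℝ, ℝ), ℝ⟯ Cₛ^∞⟮I; F, V⟯ where
  smul f s := ⟨fun x => f x • s x, f.contMDiff.smul_section s.contMDiff⟩
  one_smul s := ContMDiffSection.ext fun x => one_smul ℝ (s x)
  mul_smul f g s := ContMDiffSection.ext fun x => mul_smul (f x) (g x) (s x)
  smul_zero f := ContMDiffSection.ext fun x => smul_zero (f x)
  smul_add f s t := ContMDiffSection.ext fun x => smul_add (f x) (s x) (t x)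
  add_smul f g s := ContMDiffSection.ext fun x => add_smul (f x) (g x) (s x)
  zero_smul s := ContMDiffSection.ext fun x => zero_smul ℝ (s x)

@[simp] theorem ContMDiffSection.smooth_smul_apply (f : C^∞⟮I, N; 𝓘(ℝ, ℝ), ℝ⟯)
    (s : Cₛ^∞⟮I; F, V⟯) (x : N) : (f • s) x = f x • s x := rfl

instance ContMDiffSection.instIsScalarTowerSmooth :
    IsScalarTower ℝ C^∞⟮I, N; 𝓘(ℝ, ℝ), ℝ⟯ Cₛ^∞⟮I; F, V⟯ where
  smul_assoc c f s := ContMDiffSection.ext fun x => mul_smul c (f x) (s x)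

instance ContMDiffSection.instSMulCommSmooth :
    SMulCommClass ℝ C^∞⟮I, N; 𝓘(ℝ, ℝ), ℝ⟯ Cₛ^∞⟮I; F, V⟯ where
  smul_comm c f s := ContMDiffSection.ext fun x => smul_comm c (f x) (s x)

variable [IsManifold I ∞ N]

/-- The derivation `f ↦ X(f)` of the algebra of smooth functions given by a smooth vector
field `X`. -/
def vectorFieldDerivation (X : Cₛ^∞⟮I; E, (TangentSpace I : N → Type _)⟯) :
    Derivation ℝ C^∞⟮I, N; 𝓘(ℝ, ℝ), ℝ⟯ C^∞⟮I, N; 𝓘(ℝ, ℝ), ℝ⟯ :=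
  Derivation.mk'
    { toFun := fun f => ⟨fun x => (mfderiv I 𝓘(ℝ, ℝ) f x (X x) : ℝ), by
        have h1 := f.contMDiff.contMDiff_tangentMap (m := ∞) (by simp)
        have h2 := (contMDiff_snd_tangentBundle_modelSpace (n := ∞) ℝ 𝓘(ℝ, ℝ)).comp
          (h1.comp X.contMDiff)
        exact h2⟩
      map_add' := fun f g => by
        ext x
        have := mfderiv_add (f.mdifferentiableAt (x := x)) (g.mdifferentiableAt (x := x))
        exact congrArg (fun L => L (X x)) this
      map_smul' := fun c f => by
        ext x
        have := const_smul_mfderiv (f.mdifferentiableAt (x := x)) c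
        exact congrArg (fun L => L (X x)) this }
    (fun f g => by
        ext x
        have := ((f.mdifferentiableAt (x := x)).hasMFDerivAt.mul
          (g.mdifferentiableAt (x := x)).hasMFDerivAt).mfderiv
        exact congrArg (fun L => L (X x)) this )

@[simp] theorem vectorFieldDerivation_apply
    (X : Cₛ^∞⟮I; E, (TangentSpace I : N → Type _)⟯) (f : C^∞⟮I, N; 𝓘(ℝ, ℝ), ℝ⟯) (x : N) :
    vectorFieldDerivation X f x = (mfderiv I 𝓘(ℝ, ℝ) f x (X x) : ℝ) := rfl

theorem vectorFieldDerivation_add (X Y : Cₛ^∞⟮I; E, (TangentSpace I : N → Type _)⟯) :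
    vectorFieldDerivation (X + Y) = vectorFieldDerivation X + vectorFieldDerivation Y :=
  Derivation.ext fun f => ContMDiffMap.ext fun x =>
    (mfderiv I 𝓘(ℝ, ℝ) f x).map_add (X x) (Y x)

theorem vectorFieldDerivation_smul (c : ℝ) (X : Cₛ^∞⟮I; E, (TangentSpace I : N → Type _)⟯) :
    vectorFieldDerivation (c • X) = c • vectorFieldDerivation X :=
  Derivation.ext fun f => ContMDiffMap.ext fun x =>
    (mfderiv I 𝓘(ℝ, ℝ) f x).map_smul c (X x)

end Generic

section Generic

variable {E : Type*} [NormedAddCommGroup E] [NormedSpace ℝ E]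
  {H : Type*} [TopologicalSpace H] {I : ModelWithCorners ℝ E H}
  {N : Type*} [TopologicalSpace N] [ChartedSpace H N]
  {F : Type*} [NormedAddCommGroup F] [NormedSpace ℝ F]
  {V : N → Type*} [TopologicalSpace (TotalSpace F V)] [∀ x, AddCommGroup (V x)]
  [∀ x, Module ℝ (V x)] [∀ x, TopologicalSpace (V x)] [FiberBundle F V] [VectorBundle ℝ F V]
  [IsManifold I ∞ N]

theorem ContMDiffSection.sum_apply' {ι : Type*} (t : Finset ι) (f : ι → Cₛ^∞⟮I; F, V⟯) (x : N) :
    (∑ i ∈ t, f i) x = ∑ i ∈ t, f i x := by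
  classical
  induction t using Finset.induction_on with
  | empty => simp
  | insert i t hi ih => simp [Finset.sum_insert hi, ih]

/-- A smooth function, from a function and a proof of smoothness. -/
def smoothFun (f : N → ℝ) (hf : ContMDiff I 𝓘(ℝ, ℝ) ∞ f) : C^∞⟮I, N; 𝓘(ℝ, ℝ), ℝ⟯ := ⟨f, hf⟩

@[simp] theorem smoothFun_apply (f : N → ℝ) (hf : ContMDiff I 𝓘(ℝ, ℝ) ∞ f) (x : N) :
    smoothFun f hf x = f x := rfl

variable [FiniteDimensional ℝ E] [T2Space N] [FiniteDimensional ℝ F]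
  [ContMDiffVectorBundle ∞ F V I]

/-- Near any point, a vector bundle has a cut-off local frame: global sections `s i`, fibrewise
linear smooth functions `c i` on the total space, and a bump function `χ` with
`χ(x) v = ∑ c i (v) s i (x)`. -/
theorem exists_cutoff_frame (I : ModelWithCorners ℝ E H) [IsManifold I ∞ N]
    [ContMDiffVectorBundle ∞ F V I] (x₀ : N) :
    ∃ (r : ℕ) (χ : C^∞⟮I, N; 𝓘(ℝ, ℝ), ℝ⟯) (s : Fin r → Cₛ^∞⟮I; F, V⟯)
      (c : Fin r → ∀ x, V x →ₗ[ℝ] ℝ),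
      (∀ᶠ x in 𝓝 x₀, χ x = 1) ∧
      (∀ i, ContMDiff (I.prod 𝓘(ℝ, F)) 𝓘(ℝ, ℝ) ∞ (fun u : TotalSpace F V => c i u.1 u.2)) ∧
      ∀ x (v : V x), χ x • v = ∑ i, c i x v • s i x := by
  classical
  let e := trivializationAt F V x₀
  let b := Module.finBasis ℝ F
  have hx₀ : x₀ ∈ e.baseSet := FiberBundle.mem_baseSet_trivializationAt' x₀
  obtain ⟨g, -, hg⟩ := (SmoothBumpFunction.nhds_basis_tsupport (I := I) x₀).mem_iff.1
    (e.open_baseSet.mem_nhds hx₀)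
  let gs : C^∞⟮I, N; 𝓘(ℝ, ℝ), ℝ⟯ := ⟨g, g.contMDiff⟩
  have hs : ∀ i, ContMDiff I (I.prod 𝓘(ℝ, F)) ∞
      (fun x => (⟨x, ((g : N → ℝ) • e.localFrame b i) x⟩ : TotalSpace F V)) := fun i =>
    ContMDiffOn.smul_section_of_tsupport g.contMDiff.contMDiffOn e.open_baseSet hg
      (e.contMDiffOn_localFrame_baseSet ∞ b i)
  let c : Fin (Module.finrank ℝ F) → ∀ x, V x →ₗ[ℝ] ℝ := fun i x =>
    g x • (b.coord i ∘ₗ e.linearMapAt ℝ x)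
  have hc : ∀ i x (hx : x ∈ e.baseSet) (v : V x), c i x v = g x * b.coord i (e ⟨x, v⟩).2 := by
    intro i x hx v
    simp [c, hx]
  refine ⟨_, gs * gs, fun i => ⟨_, hs i⟩, c, ?_, ?_, ?_⟩
  · filter_upwards [g.eventuallyEq_one] with x hx
    have : gs x = 1 := hx
    simp [this]
  · intro i
    have hE : ∀ u : TotalSpace F V, u.1 ∈ e.baseSet →
        ContMDiffAt (I.prod 𝓘(ℝ, F)) 𝓘(ℝ, ℝ) ∞ (fun u : TotalSpace F V => c i u.1 u.2) u := by
      intro u hu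
      have h1 : ContMDiffAt (I.prod 𝓘(ℝ, F)) (I.prod 𝓘(ℝ, F)) ∞ e u :=
        (Trivialization.contMDiffOn (IB := I) (n := ∞) e).contMDiffAt (e.open_source.mem_nhds (e.mem_source.2 hu))
      have h2 : ContMDiffAt (I.prod 𝓘(ℝ, F)) 𝓘(ℝ, ℝ) ∞
          (fun u : TotalSpace F V => b.coord i (e u).2) u := by
        have h3 : ContDiff ℝ ∞ (fun y : F => (LinearMap.toContinuousLinearMap (b.coord i)) y) :=
          ContinuousLinearMap.contDiff _
        exact h3.contMDiff.contMDiffAt.comp u (contMDiffAt_snd.comp u h1)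
      have h4 : ContMDiffAt (I.prod 𝓘(ℝ, F)) 𝓘(ℝ, ℝ) ∞ (fun u : TotalSpace F V => g u.1) u :=
        g.contMDiff.contMDiffAt.comp u (contMDiffAt_proj V)
      refine (h4.mul h2).congr_of_eventuallyEq ?_
      have : e.source ∈ 𝓝 u := e.open_source.mem_nhds (e.mem_source.2 hu)
      filter_upwards [this] with w hw
      exact hc i w.1 (e.mem_source.1 hw) w.2
    intro u
    by_cases hu : u.1 ∈ tsupport g
    · exact hE u (hg hu)
    · have : ∀ᶠ w : TotalSpace F V in 𝓝 u, c i w.1 w.2 = 0 := by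
        have h5 : ∀ᶠ x in 𝓝 u.1, g x = 0 := by
          filter_upwards [(isClosed_tsupport g).isOpen_compl.mem_nhds hu] with x hx
          exact image_eq_zero_of_notMem_tsupport hx
        have h6 : Filter.Tendsto (TotalSpace.proj : TotalSpace F V → N) (𝓝 u) (𝓝 u.1) :=
          (FiberBundle.continuous_proj F V).continuousAt
        filter_upwards [h6.eventually h5] with w hw
        change g w.1 = 0 at hw
        simp [c, hw]
      exact (contMDiffAt_const (c := (0 : ℝ))).congr_of_eventuallyEq this
  · intro x v
    by_cases hx : x ∈ e.baseSet
    · have h7 : v = ∑ i, b.coord i (e ⟨x, v⟩).2 • e.localFrame b i x := by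
        apply (e.linearEquivAt ℝ x hx).injective
        simp only [map_sum, map_smul]
        have : ∀ i, e.linearEquivAt ℝ x hx (e.localFrame b i x) = b i := by
          intro i
          simp [Trivialization.localFrame, hx, Trivialization.basisAt]
        simp only [this, Module.Basis.coord_apply]
        rw [b.sum_repr]; rfl
      have h8 : ∑ i, c i x v • (g x • e.localFrame b i x) =
          (g x * g x) • ∑ i, b.coord i (e ⟨x, v⟩).2 • e.localFrame b i x := by
        rw [Finset.smul_sum]
        refine Finset.sum_congr rfl fun i _ => ?_
        rw [hc i x hx, smul_smul, smul_smul]; ring_nf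
      rw [← h7] at h8
      exact h8.symm
    · have h9 : g x = 0 := image_eq_zero_of_notMem_tsupport fun h => hx (hg h)
      change (g x * g x) • v = _
      simp [c, h9]

/-- A linear right inverse of the evaluation of smooth sections at a point. -/
theorem exists_section_extension (I : ModelWithCorners ℝ E H) [IsManifold I ∞ N]
    [ContMDiffVectorBundle ∞ F V I] (x : N) :
    ∃ ε : V x →ₗ[ℝ] Cₛ^∞⟮I; F, V⟯, ∀ v, ε v x = v := by
  obtain ⟨r, χ, s, c, hχ, -, h⟩ := exists_cutoff_frame (F := F) (V := V) I x
  refine ⟨∑ i, (c i x).smulRight (s i), fun v => ?_⟩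
  have h1 := h x v
  rw [hχ.self_of_nhds, one_smul] at h1
  rw [LinearMap.sum_apply]
  refine Eq.trans ?_ h1.symm
  rw [ContMDiffSection.sum_apply']
  rfl

/-- The value at `x` of an endomorphism `φ` of the module of sections: the endomorphism of the
fibre `V x` sending `s(x)` to `(φ s)(x)`. -/
def fibreEnd (φ : Module.End C^∞⟮I, N; 𝓘(ℝ, ℝ), ℝ⟯ Cₛ^∞⟮I; F, V⟯) (x : N) : V x →ₗ[ℝ] V x where
  toFun v := φ ((exists_section_extension (F := F) (V := V) I x).choose v) x
  map_add' v w := by simp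
  map_smul' a v := by
    have := LinearMap.map_smul_of_tower φ a
      ((exists_section_extension (F := F) (V := V) I x).choose v)
    simp [this]

theorem cutoff_frame_sections {r : ℕ} {χ : C^∞⟮I, N; 𝓘(ℝ, ℝ), ℝ⟯} {s : Fin r → Cₛ^∞⟮I; F, V⟯}
    {c : Fin r → ∀ x, V x →ₗ[ℝ] ℝ}
    (hc : ∀ i, ContMDiff (I.prod 𝓘(ℝ, F)) 𝓘(ℝ, ℝ) ∞ (fun u : TotalSpace F V => c i u.1 u.2))
    (h : ∀ x (v : V x), χ x • v = ∑ i, c i x v • s i x) (σ : Cₛ^∞⟮I; F, V⟯) :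
    χ • σ = ∑ i, smoothFun (fun x => c i x (σ x)) ((hc i).comp σ.contMDiff) • s i := by
  ext x
  rw [ContMDiffSection.sum_apply']
  exact h x (σ x)

/-- The defining property of `fibreEnd`. -/
theorem fibreEnd_apply (φ : Module.End C^∞⟮I, N; 𝓘(ℝ, ℝ), ℝ⟯ Cₛ^∞⟮I; F, V⟯) (x : N)
    (σ : Cₛ^∞⟮I; F, V⟯) : fibreEnd φ x (σ x) = φ σ x := by
  obtain ⟨r, χ, s, c, hχ, hc, h⟩ := exists_cutoff_frame (F := F) (V := V) I x
  have key : ∀ τ : Cₛ^∞⟮I; F, V⟯, φ τ x = ∑ i, c i x (τ x) • φ (s i) x := by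
    intro τ
    have h1 := congrArg (fun τ => φ τ x) (cutoff_frame_sections hc h τ)
    simp only [map_smul, map_sum, ContMDiffSection.sum_apply',
      ContMDiffSection.smooth_smul_apply, hχ.self_of_nhds, one_smul] at h1
    simpa using h1
  change φ _ x = φ σ x
  rw [key, key σ, (exists_section_extension (F := F) (V := V) I x).choose_spec]

/-- The fibrewise trace `Tr : Γ(End V) → C^∞(N)`, where sections of `End V` are the endomorphisms of
the `C^∞(N)`-module of sections of `V`. -/
def smoothTrace : Module.End C^∞⟮I, N; 𝓘(ℝ, ℝ), ℝ⟯ Cₛ^∞⟮I; F, V⟯ →ₗ[C^∞⟮I, N; 𝓘(ℝ, ℝ), ℝ⟯]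
    C^∞⟮I, N; 𝓘(ℝ, ℝ), ℝ⟯ where
  toFun φ := ⟨fun x => LinearMap.trace ℝ (V x) (fibreEnd φ x), by
    intro x₀
    obtain ⟨r, χ, s, c, hχ, hc, h⟩ := exists_cutoff_frame (F := F) (V := V) I x₀
    have h1 : ContMDiffAt I 𝓘(ℝ, ℝ) ∞ (fun x => ∑ i, c i x (φ (s i) x)) x₀ :=
      ContMDiffAt.sum fun i _ => ((hc i).comp (φ (s i)).contMDiff).contMDiffAt
    refine h1.congr_of_eventuallyEq (hχ.mono fun x hx => ?_)
    beta_reduce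
    have : FiniteDimensional ℝ (V x) := VectorBundle.finiteDimensional ℝ F V x
    have h2 : fibreEnd φ x = ∑ i, (c i x).smulRight (φ (s i) x) := by
      ext v
      have h3 := h x v
      rw [hx, one_smul] at h3
      conv_lhs => rw [h3]
      simp [fibreEnd_apply]
    rw [h2, map_sum]
    simp [LinearMap.trace_smulRight]⟩
  map_add' φ ψ := by
    ext x
    have : fibreEnd (φ + ψ) x = fibreEnd φ x + fibreEnd ψ x := by
      ext v; simp [fibreEnd]
    change LinearMap.trace ℝ (V x) (fibreEnd (φ + ψ) x) =
      LinearMap.trace ℝ (V x) (fibreEnd φ x) + LinearMap.trace ℝ (V x) (fibreEnd ψ x)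
    rw [this, map_add]
  map_smul' f φ := by
    ext x
    have : fibreEnd (f • φ) x = f x • fibreEnd φ x := by
      ext v; simp [fibreEnd]
    change LinearMap.trace ℝ (V x) (fibreEnd (f • φ) x) = f x * LinearMap.trace ℝ (V x) (fibreEnd φ x)
    rw [this, map_smul, smul_eq_mul]

@[simp] theorem smoothTrace_apply (φ : Module.End C^∞⟮I, N; 𝓘(ℝ, ℝ), ℝ⟯ Cₛ^∞⟮I; F, V⟯) (x : N) :
    smoothTrace φ x = LinearMap.trace ℝ (V x) (fibreEnd φ x) := rfl

end Generic

section Algebraic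

variable {L : Type*} [LieRing L] [LieAlgebra ℝ L]

/-- The second sum of the Koszul formula,
`∑_{i<j} (-1)^{i+j} η([a_i, a_j], a_0, …, â_i, …, â_j, …, a_n)`, as an alternating map; there is
no such term when `η` has degree `0`. -/
def koszulBracketTerm {W : Type*} [AddCommGroup W] [Module ℝ W] :
    ∀ {n : ℕ}, (L [⋀^Fin n]→ₗ[ℝ] W) → (L [⋀^Fin (n + 1)]→ₗ[ℝ] W)
  | 0, _ => 0
  | _ + 1, η => (-(1 / 2) : ℝ) • AlternatingMap.alternatizeUncurryFin
      (AlternatingMap.alternatizeUncurryFinLM ∘ₗ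
        ((LieModule.toEnd ℝ L L : L →ₗ[ℝ] L →ₗ[ℝ] L).compr₂ η.curryLeft))

theorem koszulBracketTerm_apply {W : Type*} [AddCommGroup W] [Module ℝ W] {n : ℕ}
    (η : L [⋀^Fin (n + 1)]→ₗ[ℝ] W) (a : Fin (n + 2) → L) :
    koszulBracketTerm η a = ∑ i : Fin (n + 1), ∑ j ≥ i,
      (-1 : ℝ) ^ ((i.castSucc : ℕ) + (j.succ : ℕ)) •
        η (Matrix.vecCons ⁅a i.castSucc, a j.succ⁆ (j.removeNth (i.castSucc.removeNth a))) := by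
  simp only [koszulBracketTerm, AlternatingMap.smul_apply]
  rw [AlternatingMap.alternatizeUncurryFin_alternatizeUncurryFinLM_comp_apply, Finset.smul_sum]
  refine Finset.sum_congr rfl fun i _ => ?_
  rw [Finset.smul_sum]
  refine Finset.sum_congr rfl fun j _ => ?_
  simp only [LinearMap.compr₂_apply, LieHom.coe_toLinearMap, LieModule.toEnd_apply_apply,
    AlternatingMap.curryLeft_apply_apply]
  rw [← lie_skew (a i.castSucc) (a j.succ)]
  set b := ⁅a j.succ, a i.castSucc⁆
  have h : η (Matrix.vecCons (-b) (j.removeNth (i.castSucc.removeNth a))) =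
      - η (Matrix.vecCons b (j.removeNth (i.castSucc.removeNth a))) := by
    have := (η.curryLeft).map_neg b
    exact congrArg (fun f => f (j.removeNth (i.castSucc.removeNth a))) this
  rw [h]
  rw [Int.cast_smul_eq_zsmul ℝ _ _ |>.symm]
  simp only [Fin.val_castSucc, Fin.val_succ]
  rw [← neg_add', ← two_smul ℝ, smul_neg, smul_neg, smul_neg, smul_smul, smul_smul]
  congr 2
  push_cast
  ring

/-- The map `a ↦ D_a ∘ η`. -/
def koszulAction {W : Type*} [AddCommGroup W] [Module ℝ W] (D : L →ₗ[ℝ] Module.End ℝ W)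
    {n : ℕ} (η : L [⋀^Fin n]→ₗ[ℝ] W) : L →ₗ[ℝ] L [⋀^Fin n]→ₗ[ℝ] W where
  toFun a := (D a).compAlternatingMap η
  map_add' a b := by ext v; simp
  map_smul' c a := by ext v; simp

/-- The Koszul differential
`(d η)(a_0, …, a_n) = ∑_i (-1)^i D_{a_i}(η(a_0, …, â_i, …, a_n))
  + ∑_{i<j} (-1)^{i+j} η([a_i, a_j], a_0, …, â_i, …, â_j, …, a_n)`
of `ℝ`-multilinear alternating forms on a Lie algebra `L` with values in a real vector space `W`
on which `L` acts by linear operators `D_a`. -/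
def koszulDifferential {W : Type*} [AddCommGroup W] [Module ℝ W] (D : L →ₗ[ℝ] Module.End ℝ W)
    (n : ℕ) : (L [⋀^Fin n]→ₗ[ℝ] W) →ₗ[ℝ] (L [⋀^Fin (n + 1)]→ₗ[ℝ] W) where
  toFun η := AlternatingMap.alternatizeUncurryFin (koszulAction D η) + koszulBracketTerm η
  map_add' η θ := by
    ext v
    cases n with
    | zero =>
      simp [AlternatingMap.alternatizeUncurryFin_apply, koszulBracketTerm, koszulAction]
    | succ n =>
      simp only [AlternatingMap.add_apply, koszulBracketTerm_apply, AlternatingMap.alternatizeUncurryFin_apply, koszulAction, LinearMap.coe_mk, AddHom.coe_mk, LinearMap.compAlternatingMap_apply, smul_add, map_add, Finset.sum_add_distrib]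
      abel
  map_smul' c η := by
    ext v
    cases n with
    | zero =>
      simp [AlternatingMap.alternatizeUncurryFin_apply, koszulBracketTerm, koszulAction]
    | succ n =>
      simp only [AlternatingMap.add_apply, AlternatingMap.smul_apply, koszulBracketTerm_apply, AlternatingMap.alternatizeUncurryFin_apply, koszulAction, LinearMap.coe_mk, AddHom.coe_mk, LinearMap.compAlternatingMap_apply, smul_add, map_smul, Finset.smul_sum, RingHom.id_apply, smul_comm c]

theorem koszulDifferential_apply {W : Type*} [AddCommGroup W] [Module ℝ W]
    (D : L →ₗ[ℝ] Module.End ℝ W) (n : ℕ) (η : L [⋀^Fin (n + 1)]→ₗ[ℝ] W) (a : Fin (n + 2) → L) :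
    koszulDifferential D (n + 1) η a =
      ∑ i : Fin (n + 2), (-1 : ℝ) ^ (i : ℕ) • D (a i) (η (i.removeNth a)) +
      ∑ i : Fin (n + 1), ∑ j ≥ i, (-1 : ℝ) ^ ((i.castSucc : ℕ) + (j.succ : ℕ)) •
        η (Matrix.vecCons ⁅a i.castSucc, a j.succ⁆ (j.removeNth (i.castSucc.removeNth a))) := by
  rw [← koszulBracketTerm_apply]
  change AlternatingMap.alternatizeUncurryFin (koszulAction D η) a + _ = _
  rw [AlternatingMap.alternatizeUncurryFin_apply]
  congr 1
  refine Finset.sum_congr rfl fun i _ => ?_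
  rw [← Int.cast_smul_eq_zsmul ℝ]
  push_cast
  rfl

theorem koszulDifferential_zero_apply {W : Type*} [AddCommGroup W] [Module ℝ W]
    (D : L →ₗ[ℝ] Module.End ℝ W) (η : L [⋀^Fin 0]→ₗ[ℝ] W) (a : Fin 1 → L) :
    koszulDifferential D 0 η a = D (a 0) (η ![]) := by
  change AlternatingMap.alternatizeUncurryFin (koszulAction D η) a + _ = _
  rw [AlternatingMap.alternatizeUncurryFin_apply]
  refine (add_zero _).trans ((Fin.sum_univ_one _).trans ?_)
  refine (one_smul ℤ _).trans ?_
  exact congrArg (fun v => D (a 0) (η v)) (Subsingleton.elim _ _)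

/-- The space of alternating `ℝ`-multilinear `k`-forms on `L` with values in `W`. -/
abbrev AltForm (L : Type*) [LieRing L] [LieAlgebra ℝ L] (W : Type*) [AddCommGroup W] [Module ℝ W]
    (k : ℕ) : Type _ := L [⋀^Fin k]→ₗ[ℝ] W

section Cohomology

variable {W : Type*} [AddCommGroup W] [Module ℝ W] (D : L →ₗ[ℝ] Module.End ℝ W)

/-- Closed forms of degree `k`. -/
def koszulCocycles (k : ℕ) : Submodule ℝ (AltForm L W k) := LinearMap.ker (koszulDifferential D k)

/-- Exact forms of degree `k`. -/
def koszulCoboundaries : ∀ k : ℕ, Submodule ℝ (AltForm L W k)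
  | 0 => ⊥
  | k + 1 => LinearMap.range (koszulDifferential D k)

/-- Closed forms of degree `k` modulo exact forms. -/
abbrev KoszulCohomology (k : ℕ) : Type _ :=
  koszulCocycles D k ⧸ (koszulCoboundaries D k).submoduleOf (koszulCocycles D k)

/-- The cohomology class of a closed form. -/
def koszulClass {k : ℕ} (η : AltForm L W k) (hη : koszulDifferential D k η = 0) :
    KoszulCohomology D k :=
  Submodule.Quotient.mk ⟨η, hη⟩

end Cohomology

/-- For a bilinear map `K` with values in an algebra, the multilinear map
`(a_1, …, a_{2p}) ↦ K(a_1, a_2) K(a_3, a_4) ⋯ K(a_{2p-1}, a_{2p})`. -/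
def pairProduct {B : Type*} [Ring B] [Algebra ℝ B] (K : L →ₗ[ℝ] L →ₗ[ℝ] B) (p : ℕ) :
    MultilinearMap ℝ (fun _ : Fin (2 * p) => L) B :=
  have key : ∀ [DecidableEq (Fin (2 * p))] (a : Fin (2 * p) → L) (k : Fin (2 * p)),
      ∃ (j : Fin p) (ℓ : L →ₗ[ℝ] B), ∀ x,
        (fun i : Fin p => K (Function.update a k x ⟨2 * i, by omega⟩)
          (Function.update a k x ⟨2 * i + 1, by omega⟩)) =
        Function.update (fun i : Fin p => K (a ⟨2 * i, by omega⟩) (a ⟨2 * i + 1, by omega⟩))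
          j (ℓ x) := by
    intro _ a k
    have hk := k.2
    by_cases h : (k : ℕ) % 2 = 0
    · refine ⟨⟨k / 2, by omega⟩, K.flip (a ⟨k + 1, by omega⟩), fun x => ?_⟩
      funext i
      by_cases hi : i = ⟨k / 2, by omega⟩
      · subst hi
        have h1 : (⟨2 * (k / 2), by omega⟩ : Fin (2 * p)) = k := Fin.ext (by simp; omega)
        have h2 : (⟨2 * (k / 2) + 1, by omega⟩ : Fin (2 * p)) = ⟨k + 1, by omega⟩ :=
          Fin.ext (by simp; omega)
        have h3 : (⟨k + 1, by omega⟩ : Fin (2 * p)) ≠ k := fun h => by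
          have := congrArg Fin.val h; simp at this
        simp [h1, h2, h3]
      · have hi' : (i : ℕ) ≠ k / 2 := fun h => hi (Fin.ext h)
        have h1 : (⟨2 * i, by omega⟩ : Fin (2 * p)) ≠ k := fun h => by
          have := congrArg Fin.val h; simp at this; omega
        have h2 : (⟨2 * i + 1, by omega⟩ : Fin (2 * p)) ≠ k := fun h => by
          have := congrArg Fin.val h; simp at this; omega
        simp [h1, h2, hi]
    · refine ⟨⟨k / 2, by omega⟩, K (a ⟨k - 1, by omega⟩), fun x => ?_⟩
      funext i
      by_cases hi : i = ⟨k / 2, by omega⟩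
      · subst hi
        have h1 : (⟨2 * (k / 2) + 1, by omega⟩ : Fin (2 * p)) = k := Fin.ext (by simp; omega)
        have h2 : (⟨2 * (k / 2), by omega⟩ : Fin (2 * p)) = ⟨k - 1, by omega⟩ :=
          Fin.ext (by simp; omega)
        have h3 : (⟨k - 1, by omega⟩ : Fin (2 * p)) ≠ k := fun h => by
          have := congrArg Fin.val h; simp at this; omega
        simp [h1, h2, h3]
      · have hi' : (i : ℕ) ≠ k / 2 := fun h => hi (Fin.ext h)
        have h1 : (⟨2 * i, by omega⟩ : Fin (2 * p)) ≠ k := fun h => by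
          have := congrArg Fin.val h; simp at this; omega
        have h2 : (⟨2 * i + 1, by omega⟩ : Fin (2 * p)) ≠ k := fun h => by
          have := congrArg Fin.val h; simp at this; omega
        simp [h1, h2, hi]
  { toFun := fun a =>
      (List.ofFn fun i : Fin p => K (a ⟨2 * i, by omega⟩) (a ⟨2 * i + 1, by omega⟩)).prod
    map_update_add' := fun a k x y => by
      obtain ⟨j, ℓ, h⟩ := key a k
      simp only [h, map_add]
      exact (MultilinearMap.mkPiAlgebraFin ℝ p B).map_update_add _ j (ℓ x) (ℓ y)
    map_update_smul' := fun a k c x => by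
      obtain ⟨j, ℓ, h⟩ := key a k
      simp only [h, map_smul]
      exact (MultilinearMap.mkPiAlgebraFin ℝ p B).map_update_smul _ j c (ℓ x) }

/-- `K^p(a_1, …, a_{2p}) = 2^{-p} ∑_{τ ∈ S_{2p}} sgn τ · K(a_{τ(1)}, a_{τ(2)}) ⋯
K(a_{τ(2p-1)}, a_{τ(2p)})`. -/
def alternatingPower {B : Type*} [Ring B] [Algebra ℝ B] (K : L →ₗ[ℝ] L →ₗ[ℝ] B) (p : ℕ) :
    L [⋀^Fin (2 * p)]→ₗ[ℝ] B :=
  (1 / 2 ^ p : ℝ) • MultilinearMap.alternatization (pairProduct K p)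

theorem alternatingPower_apply {B : Type*} [Ring B] [Algebra ℝ B] (K : L →ₗ[ℝ] L →ₗ[ℝ] B) (p : ℕ)
    (a : Fin (2 * p) → L) :
    alternatingPower K p a = (1 / 2 ^ p : ℝ) • ∑ τ : Equiv.Perm (Fin (2 * p)),
      (Equiv.Perm.sign τ : ℤ) • (List.ofFn fun i : Fin p =>
        K (a (τ ⟨2 * i, by omega⟩)) (a (τ ⟨2 * i + 1, by omega⟩))).prod := by
  simp only [alternatingPower, AlternatingMap.smul_apply, MultilinearMap.alternatization_apply]
  rfl

variable {R : Type*} [CommRing R] [Algebra ℝ R]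

/-- An `ℝ`-linear connection, on a module `W` over an algebra `R`, of a Lie algebra `L` acting on
`R` by derivations through `δ`: an `ℝ`-linear assignment `a ↦ ∇_a` of `ℝ`-linear operators on `W`
with `∇_a (f w) = f ∇_a w + δ_a(f) w`. No `R`-linearity in `a` is required. -/
structure RLinearConnection (δ : L →ₗ⁅ℝ⁆ Derivation ℝ R R) (W : Type*) [AddCommGroup W]
    [Module ℝ W] [Module R W] where
  toLinearMap : L →ₗ[ℝ] Module.End ℝ W
  leibniz : ∀ (a : L) (f : R) (w : W),
    toLinearMap a (f • w) = f • toLinearMap a w + δ a f • w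

namespace RLinearConnection

variable {δ : L →ₗ⁅ℝ⁆ Derivation ℝ R R} {W : Type*} [AddCommGroup W]
  [Module ℝ W] [Module R W] [IsScalarTower ℝ R W]

instance : CoeFun (RLinearConnection δ W) (fun _ => L → Module.End ℝ W) :=
  ⟨fun D => D.toLinearMap⟩

/-- The curvature `R_{a,b} = ∇_a ∘ ∇_b - ∇_b ∘ ∇_a - ∇_{[a,b]}`, an `R`-linear endomorphism. -/
def curvature (D : RLinearConnection δ W) : L →ₗ[ℝ] L →ₗ[ℝ] Module.End R W :=
  LinearMap.mk₂ ℝ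
    (fun a b =>
      { toFun := fun w => D a (D b w) - D b (D a w) - D ⁅a, b⁆ w
        map_add' := fun v w => by simp only [map_add]; abel
        map_smul' := fun f w => by
          simp only [D.leibniz, map_add, LieHom.map_lie, Derivation.commutator_apply, sub_smul, smul_sub, RingHom.id_apply]
          abel })
    (fun a a' b => by ext w; simp; abel)
    (fun c a b => by ext w; simp [smul_sub])
    (fun a b b' => by ext w; simp; abel)
    (fun c a b => by ext w; simp [smul_sub])

@[simp] theorem curvature_apply (D : RLinearConnection δ W) (a b : L) (w : W) :
    D.curvature a b w = D a (D b w) - D b (D a w) - D ⁅a, b⁆ w := rfl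

end RLinearConnection
end Algebraic

section Algebroid

/-- A Lie algebroid structure on a smooth vector bundle `A → M`: an anchor, which is a smooth
homomorphism of vector bundles `A → TM`, and an `ℝ`-Lie algebra structure on the space of smooth
sections of `A`, related by the Leibniz identity. -/
structure LieAlgebroid (n : ℕ) {M : Type*} [TopologicalSpace M]
    [ChartedSpace (EuclideanSpace ℝ (Fin n)) M] [IsManifold (𝓡 n) ∞ M]
    (FA : Type*) [NormedAddCommGroup FA] [NormedSpace ℝ FA]
    (A : M → Type*) [TopologicalSpace (TotalSpace FA A)] [∀ x, AddCommGroup (A x)]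
    [∀ x, Module ℝ (A x)] [∀ x, TopologicalSpace (A x)] [FiberBundle FA A]
    [VectorBundle ℝ FA A] where
  anchor : ∀ x, A x →ₗ[ℝ] TangentSpace (𝓡 n) x
  contMDiff_anchor : ContMDiff ((𝓡 n).prod 𝓘(ℝ, FA)) (𝓡 n).tangent ∞
    (fun v : TotalSpace FA A => (⟨v.1, anchor v.1 v.2⟩ : TangentBundle (𝓡 n) M))
  bracket : Cₛ^∞⟮𝓡 n; FA, A⟯ →ₗ[ℝ] Cₛ^∞⟮𝓡 n; FA, A⟯ →ₗ[ℝ] Cₛ^∞⟮𝓡 n; FA, A⟯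
  bracket_self : ∀ a, bracket a a = 0
  jacobi : ∀ a b c,
    bracket a (bracket b c) + bracket b (bracket c a) + bracket c (bracket a b) = 0
  leibniz : ∀ (a b : Cₛ^∞⟮𝓡 n; FA, A⟯) (f : C^∞⟮𝓡 n, M; 𝓘(ℝ, ℝ), ℝ⟯),
    bracket a (f • b) = f • bracket a b + vectorFieldDerivation
      ⟨fun x => anchor x (a x), contMDiff_anchor.comp a.contMDiff⟩ f • b

variable {n : ℕ} {M : Type*} [TopologicalSpace M]
  [ChartedSpace (EuclideanSpace ℝ (Fin n)) M] [IsManifold (𝓡 n) ∞ M]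
  {FA : Type*} [NormedAddCommGroup FA] [NormedSpace ℝ FA]
  {A : M → Type*} [TopologicalSpace (TotalSpace FA A)] [∀ x, AddCommGroup (A x)]
  [∀ x, Module ℝ (A x)] [∀ x, TopologicalSpace (A x)] [FiberBundle FA A]
  [VectorBundle ℝ FA A]

namespace LieAlgebroid

/-- The Lie algebra `Γ(A)` of smooth sections of a Lie algebroid. -/
def Sec (_ : LieAlgebroid n FA A) : Type _ := Cₛ^∞⟮𝓡 n; FA, A⟯

variable (𝒜 : LieAlgebroid n FA A)

instance : AddCommGroup 𝒜.Sec := inferInstanceAs (AddCommGroup Cₛ^∞⟮𝓡 n; FA, A⟯)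
instance : Module ℝ 𝒜.Sec := inferInstanceAs (Module ℝ Cₛ^∞⟮𝓡 n; FA, A⟯)
instance : Module C^∞⟮𝓡 n, M; 𝓘(ℝ, ℝ), ℝ⟯ 𝒜.Sec :=
  inferInstanceAs (Module C^∞⟮𝓡 n, M; 𝓘(ℝ, ℝ), ℝ⟯ Cₛ^∞⟮𝓡 n; FA, A⟯)

theorem bracket_skew (a b : Cₛ^∞⟮𝓡 n; FA, A⟯) : 𝒜.bracket a b = - 𝒜.bracket b a := by
  have h := 𝒜.bracket_self (a + b)
  simp only [map_add, LinearMap.add_apply, 𝒜.bracket_self, zero_add, add_zero] at h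
  exact eq_neg_of_add_eq_zero_left (by rwa [add_comm] at h)

instance : LieRing 𝒜.Sec where
  bracket a b := 𝒜.bracket a b
  add_lie a b c :=
    (congrArg (fun f => f c) (𝒜.bracket.map_add a b))
  lie_add a b c := (𝒜.bracket a).map_add b c
  lie_self a := 𝒜.bracket_self a
  leibniz_lie a b c := by
    have h := 𝒜.jacobi a b c
    have h1 : 𝒜.bracket b (𝒜.bracket c a) = - 𝒜.bracket b (𝒜.bracket a c) := by
      rw [𝒜.bracket_skew c a, map_neg]
    have h2 : 𝒜.bracket c (𝒜.bracket a b) = - 𝒜.bracket (𝒜.bracket a b) c :=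
      𝒜.bracket_skew _ _
    change 𝒜.bracket a (𝒜.bracket b c) = 𝒜.bracket (𝒜.bracket a b) c +
      𝒜.bracket b (𝒜.bracket a c)
    rw [h1, h2] at h
    rw [← sub_eq_zero, ← h]
    abel

instance : LieAlgebra ℝ 𝒜.Sec where
  lie_smul c a b := (𝒜.bracket a).map_smul c b

/-- The vector field `ρ_A ∘ a`. -/
def anchorField : 𝒜.Sec →ₗ[ℝ] Cₛ^∞⟮𝓡 n; EuclideanSpace ℝ (Fin n),
    (TangentSpace (𝓡 n) : M → Type _)⟯ where
  toFun a := ⟨fun x => 𝒜.anchor x ((show Cₛ^∞⟮𝓡 n; FA, A⟯ from a) x),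
    𝒜.contMDiff_anchor.comp (show Cₛ^∞⟮𝓡 n; FA, A⟯ from a).contMDiff⟩
  map_add' _ _ := ContMDiffSection.ext fun x => (𝒜.anchor x).map_add _ _
  map_smul' c _ := ContMDiffSection.ext fun x => (𝒜.anchor x).map_smul c _

variable [T2Space M] [FiniteDimensional ℝ FA] [ContMDiffVectorBundle ∞ FA A (𝓡 n)]

/-- The action of sections of `A` on smooth functions, `a ↦ (f ↦ (ρ_A ∘ a)(f))`; it is a
homomorphism of Lie algebras. -/
def anchorDerivation : 𝒜.Sec →ₗ⁅ℝ⁆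
    Derivation ℝ C^∞⟮𝓡 n, M; 𝓘(ℝ, ℝ), ℝ⟯ C^∞⟮𝓡 n, M; 𝓘(ℝ, ℝ), ℝ⟯ where
  toFun a := vectorFieldDerivation (𝒜.anchorField a)
  map_add' a b := by rw [map_add, vectorFieldDerivation_add]
  map_smul' c a := by rw [map_smul, vectorFieldDerivation_smul]; rfl
  map_lie' {a b} := by
    ext f x
    let δ : 𝒜.Sec → C^∞⟮𝓡 n, M; 𝓘(ℝ, ℝ), ℝ⟯ → C^∞⟮𝓡 n, M; 𝓘(ℝ, ℝ), ℝ⟯ :=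
      fun a => vectorFieldDerivation (𝒜.anchorField a)
    have leib : ∀ (a b : 𝒜.Sec) (f : C^∞⟮𝓡 n, M; 𝓘(ℝ, ℝ), ℝ⟯), ⁅a, f • b⁆ = f • ⁅a, b⁆ + δ a f • b :=
      𝒜.leibniz
    have key : ∀ c : 𝒜.Sec, δ ⁅a, b⁆ f • c = (δ a (δ b f) - δ b (δ a f)) • c := by
      intro c
      have h1 := leib ⁅a, b⁆ c f
      have h2 : ⁅⁅a, b⁆, f • c⁆ = ⁅a, ⁅b, f • c⁆⁆ - ⁅b, ⁅a, f • c⁆⁆ := lie_lie a b (f • c)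
      have h3 : ⁅⁅a, b⁆, c⁆ = ⁅a, ⁅b, c⁆⁆ - ⁅b, ⁅a, c⁆⁆ := lie_lie a b c
      rw [h2, leib b c, leib a c, lie_add, lie_add, leib, leib, leib, leib, h3] at h1
      rw [sub_smul, eq_comm, ← sub_eq_zero]
      rw [← sub_eq_zero] at h1
      rw [← h1, smul_sub]
      abel
    by_cases hs : Subsingleton (A x)
    · have hz : ∀ (c : 𝒜.Sec) (g : C^∞⟮𝓡 n, M; 𝓘(ℝ, ℝ), ℝ⟯), δ c g x = 0 := by
        intro c g
        have h0 : 𝒜.anchorField c x = 0 := by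
          change 𝒜.anchor x ((show Cₛ^∞⟮𝓡 n; FA, A⟯ from c) x) = 0
          rw [Subsingleton.elim ((show Cₛ^∞⟮𝓡 n; FA, A⟯ from c) x) 0, map_zero]
        change mfderiv (𝓡 n) 𝓘(ℝ, ℝ) g x (𝒜.anchorField c x) = (0 : ℝ)
        rw [h0]
        exact map_zero _
      change δ ⁅a, b⁆ f x = δ a (δ b f) x - δ b (δ a f) x
      rw [hz, hz, hz, sub_zero]
    · rw [not_subsingleton_iff_nontrivial] at hs
      obtain ⟨v, hv⟩ := exists_ne (0 : A x)
      obtain ⟨ε, hε⟩ := exists_section_extension (F := FA) (V := A) (𝓡 n) x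
      have h1 : δ ⁅a, b⁆ f x • v = (δ a (δ b f) x - δ b (δ a f) x) • v := by
        have := congrArg (fun c : Cₛ^∞⟮𝓡 n; FA, A⟯ => c x) (key (ε v))
        change δ ⁅a, b⁆ f x • (ε v) x = (δ a (δ b f) x - δ b (δ a f) x) • (ε v) x at this
        rwa [hε] at this
      exact smul_left_injective ℝ hv h1

@[simp] theorem anchorDerivation_apply (a : 𝒜.Sec) :
    𝒜.anchorDerivation a = vectorFieldDerivation (𝒜.anchorField a) := rfl

/-- The action of `Γ(A)` on `C^∞(M)` by linear operators through the anchor. -/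
def anchorAction : 𝒜.Sec →ₗ[ℝ] Module.End ℝ C^∞⟮𝓡 n, M; 𝓘(ℝ, ℝ), ℝ⟯ where
  toFun a := (𝒜.anchorDerivation a : C^∞⟮𝓡 n, M; 𝓘(ℝ, ℝ), ℝ⟯ →ₗ[ℝ] C^∞⟮𝓡 n, M; 𝓘(ℝ, ℝ), ℝ⟯)
  map_add' a b := by rw [map_add]; rfl
  map_smul' c a := by rw [map_smul]; rfl

/-- The space of `ℝ`-linear `k`-forms on `A` with values in `C^∞(M)`: alternating `ℝ`-multilinear
maps `Γ(A)^k → C^∞(M)`. -/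
abbrev Form (k : ℕ) : Type _ := AltForm 𝒜.Sec C^∞⟮𝓡 n, M; 𝓘(ℝ, ℝ), ℝ⟯ k

/-- The differential `d_{A,ℝ}` of `ℝ`-linear forms on `A`, given by the Koszul formula for the
action of `Γ(A)` on `C^∞(M)` through the anchor. -/
def d (k : ℕ) : 𝒜.Form k →ₗ[ℝ] 𝒜.Form (k + 1) := koszulDifferential 𝒜.anchorAction k

/-- The Lie algebroid `ℝ`-cohomology `H^k_{ρ_A,ℝ}(A; M × ℝ)`: closed forms modulo exact forms. -/
abbrev Cohomology (k : ℕ) : Type _ := KoszulCohomology 𝒜.anchorAction k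

/-- The cohomology class of a closed form. -/
def cohomologyClass {k : ℕ} (η : 𝒜.Form k) (hη : 𝒜.d k η = 0) : 𝒜.Cohomology k :=
  koszulClass 𝒜.anchorAction η hη

end LieAlgebroid
end Algebroid

instance Bundle.Pullback.instAddCommGroup {B B' : Type*} (f : B' → B) (V : B → Type*)
    [∀ x, AddCommGroup (V x)] (q : B') : AddCommGroup ((f *ᵖ V) q) :=
  inferInstanceAs (AddCommGroup (V (f q)))

section Cylinder

variable {n : ℕ} {M : Type*} [TopologicalSpace M]
  [ChartedSpace (EuclideanSpace ℝ (Fin n)) M]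

/-- The model with corners of the manifold `ℝ × M`. -/
abbrev cylModel (n : ℕ) : ModelWithCorners ℝ (ℝ × EuclideanSpace ℝ (Fin n))
    (ModelProd ℝ (EuclideanSpace ℝ (Fin n))) := 𝓘(ℝ, ℝ).prod (𝓡 n)

/-- The projection `pr₂ : ℝ × M → M`. -/
abbrev cylProj (n : ℕ) (M : Type*) [TopologicalSpace M]
    [ChartedSpace (EuclideanSpace ℝ (Fin n)) M] : C^∞⟮cylModel n, ℝ × M; 𝓡 n, M⟯ :=
  ContMDiffMap.snd

/-- The coordinate function `t` on `ℝ × M`. -/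
def cylTime : C^∞⟮cylModel n, ℝ × M; 𝓘(ℝ, ℝ), ℝ⟯ := ⟨Prod.fst, contMDiff_fst⟩

@[simp] theorem cylTime_apply (q : ℝ × M) : cylTime (n := n) q = q.1 := rfl

/-- The restriction of a function on `ℝ × M` to `{t} × M`. -/
def cylSlice (t : ℝ) (f : C^∞⟮cylModel n, ℝ × M; 𝓘(ℝ, ℝ), ℝ⟯) : C^∞⟮𝓡 n, M; 𝓘(ℝ, ℝ), ℝ⟯ :=
  ⟨fun x => f (t, x), f.contMDiff.comp (contMDiff_const.prodMk contMDiff_id)⟩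

@[simp] theorem cylSlice_apply (t : ℝ) (f : C^∞⟮cylModel n, ℝ × M; 𝓘(ℝ, ℝ), ℝ⟯) (x : M) :
    cylSlice t f x = f (t, x) := rfl

variable [IsManifold (𝓡 n) ∞ M]

/-- The vector field `r ∂/∂t + X` on `ℝ × M`. -/
def cylField : ℝ × Cₛ^∞⟮𝓡 n; EuclideanSpace ℝ (Fin n), (TangentSpace (𝓡 n) : M → Type _)⟯ →ₗ[ℝ]
    Cₛ^∞⟮cylModel n; ℝ × EuclideanSpace ℝ (Fin n),
      (TangentSpace (cylModel n) : ℝ × M → Type _)⟯ where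
  toFun u := ⟨fun q => ((u.1, u.2 q.2) : ℝ × EuclideanSpace ℝ (Fin n)), by
    have : IsManifold (𝓡 n) 1 M := IsManifold.of_le (n := ∞) (by simp)
    have h1 : ContMDiff (cylModel n) 𝓘(ℝ, ℝ).tangent ∞
        (fun q : ℝ × M => (⟨q.1, u.1⟩ : TangentBundle 𝓘(ℝ, ℝ) ℝ)) := by
      have : ContMDiff 𝓘(ℝ, ℝ) 𝓘(ℝ, ℝ).tangent ∞
          (fun q : ℝ => (⟨q, u.1⟩ : TangentBundle 𝓘(ℝ, ℝ) ℝ)) := by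
        intro x
        exact contMDiffWithinAt_vectorSpace_iff_contDiffWithinAt.2
          (contDiffWithinAt_const)
      exact this.comp contMDiff_fst
    exact (contMDiff_equivTangentBundleProd_symm (I := 𝓘(ℝ, ℝ)) (M := ℝ) (I' := 𝓡 n)
      (M' := M) (n := ∞)).comp (h1.prodMk (u.2.contMDiff.comp contMDiff_snd))⟩
  map_add' u v := rfl
  map_smul' c u := rfl

theorem cylField_derivation_apply (r : ℝ)
    (X : Cₛ^∞⟮𝓡 n; EuclideanSpace ℝ (Fin n), (TangentSpace (𝓡 n) : M → Type _)⟯)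
    (f : C^∞⟮cylModel n, ℝ × M; 𝓘(ℝ, ℝ), ℝ⟯) (t : ℝ) (x : M) :
    vectorFieldDerivation (cylField (r, X)) f (t, x) =
      r * deriv (fun s => f (s, x)) t + vectorFieldDerivation X (cylSlice t f) x := by
  have hf := (f.mdifferentiableAt (x := (t, x)))
  have h := mfderiv_prod_eq_add_apply (v := ((r, X x) : ℝ × EuclideanSpace ℝ (Fin n))) hf
  refine h.trans ?_
  refine congrArg₂ (fun a b : ℝ => a + b) ?_ rfl
  rw [mfderiv_eq_fderiv]
  change fderiv ℝ (fun s => f (s, x)) t r = _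
  rw [← fderiv_apply_one_eq_deriv, ← smul_eq_mul, ← map_smul, smul_eq_mul, mul_one]

/-- Mixed partial derivatives on `ℝ × M` commute. -/
theorem cyl_mixed_partials
    (X : Cₛ^∞⟮𝓡 n; EuclideanSpace ℝ (Fin n), (TangentSpace (𝓡 n) : M → Type _)⟯)
    (f : C^∞⟮cylModel n, ℝ × M; 𝓘(ℝ, ℝ), ℝ⟯) :
    vectorFieldDerivation (cylField (1, 0)) (vectorFieldDerivation (cylField (0, X)) f) =
      vectorFieldDerivation (cylField (0, X)) (vectorFieldDerivation (cylField (1, 0)) f) := by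
  ext ⟨t, x⟩
  have e1 : ∀ (g : C^∞⟮cylModel n, ℝ × M; 𝓘(ℝ, ℝ), ℝ⟯) (s : ℝ) (y : M),
      vectorFieldDerivation (cylField (1, 0)) g (s, y) = deriv (fun s => g (s, y)) s := by
    intro g s y
    rw [cylField_derivation_apply, one_mul]
    have h0 : vectorFieldDerivation 0 (cylSlice s g) y = 0 :=
      (mfderiv (𝓡 n) 𝓘(ℝ, ℝ) (cylSlice s g) y).map_zero
    rw [h0, add_zero]
  have e2 : ∀ (g : C^∞⟮cylModel n, ℝ × M; 𝓘(ℝ, ℝ), ℝ⟯) (s : ℝ) (y : M),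
      vectorFieldDerivation (cylField (0, X)) g (s, y) =
        vectorFieldDerivation X (cylSlice s g) y := by
    intro g s y
    rw [cylField_derivation_apply, zero_mul, zero_add]
  rw [e1, e2]
  simp only [e2]
  -- pass to the chart at `x`
  let φ := extChartAt (𝓡 n) x
  let y₀ := φ x
  let v : EuclideanSpace ℝ (Fin n) := X x
  let G : ℝ × EuclideanSpace ℝ (Fin n) → ℝ := fun q => f (q.1, φ.symm q.2)
  have htgt : φ.target ∈ 𝓝 y₀ := extChartAt_target_mem_nhds x
  have hG : ∀ s : ℝ, ContDiffAt ℝ ∞ G (s, y₀) := by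
    intro s
    have h1 : ContMDiffOn 𝓘(ℝ, EuclideanSpace ℝ (Fin n)) (𝓡 n) ∞ φ.symm φ.target :=
      contMDiffOn_extChartAt_symm x
    have h2 : ContMDiffAt 𝓘(ℝ, EuclideanSpace ℝ (Fin n)) (𝓡 n) ∞ φ.symm y₀ :=
      h1.contMDiffAt htgt
    have h3 : ContMDiffAt (𝓘(ℝ, ℝ).prod 𝓘(ℝ, EuclideanSpace ℝ (Fin n))) (cylModel n) ∞
        (fun q : ℝ × EuclideanSpace ℝ (Fin n) => (q.1, φ.symm q.2)) (s, y₀) :=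
      contMDiffAt_fst.prodMk (ContMDiffAt.comp (s, y₀) h2 contMDiffAt_snd)
    have h4 : ContMDiffAt (𝓘(ℝ, ℝ).prod 𝓘(ℝ, EuclideanSpace ℝ (Fin n))) 𝓘(ℝ, ℝ) ∞ G (s, y₀) :=
      f.contMDiff.contMDiffAt.comp (s, y₀) h3
    rw [← modelWithCornersSelf_prod, chartedSpaceSelf_prod] at h4
    exact h4.contDiffAt
  have hM : ∀ g : C^∞⟮𝓡 n, M; 𝓘(ℝ, ℝ), ℝ⟯,
      vectorFieldDerivation X g x = fderiv ℝ (fun y => g (φ.symm y)) y₀ v := by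
    intro g
    have h := (g.mdifferentiableAt (x := x)).mfderiv
    refine (congrArg (fun L => L (X x)) h).trans ?_
    change fderivWithin ℝ (fun y => g (φ.symm y)) (Set.range (𝓡 n)) y₀ v = _
    rw [ModelWithCorners.range_eq_univ, fderivWithin_univ]
  have hd : ∀ s : ℝ, DifferentiableAt ℝ G (s, y₀) := fun s => (hG s).differentiableAt (by simp)
  have hG' : ContDiffAt ℝ ∞ (fderiv ℝ G) (t, y₀) := (hG t).fderiv_right (by simp)
  have hd2 : DifferentiableAt ℝ (fderiv ℝ G) (t, y₀) := hG'.differentiableAt (by simp)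
  have hsymm : IsSymmSndFDerivAt ℝ G (t, y₀) :=
    (hG t).isSymmSndFDerivAt (by simpa using (mod_cast (le_top : (2 : ℕ∞) ≤ ⊤) : ((2 : ℕ∞) : WithTop ℕ∞) ≤ ((⊤ : ℕ∞) : WithTop ℕ∞)))
  -- left-hand side
  have L1 : (fun s => vectorFieldDerivation X (cylSlice s f) x) =
      fun s => fderiv ℝ G (s, y₀) (0, v) := by
    funext s
    rw [hM]
    have h5 : HasFDerivAt (fun y : EuclideanSpace ℝ (Fin n) => (s, y))
        (ContinuousLinearMap.inr ℝ ℝ (EuclideanSpace ℝ (Fin n))) y₀ := hasFDerivAt_prodMk_right s y₀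
    have h6 := (hd s).hasFDerivAt.comp y₀ h5
    change fderiv ℝ (G ∘ fun y => (s, y)) y₀ v = _
    rw [h6.fderiv]
    simp
  have L2 : HasDerivAt (fun s : ℝ => fderiv ℝ G (s, y₀) (0, v))
      (fderiv ℝ (fderiv ℝ G) (t, y₀) (1, 0) (0, v)) t := by
    have h7 : HasDerivAt (fun s : ℝ => (s, y₀)) ((1 : ℝ), (0 : EuclideanSpace ℝ (Fin n))) t :=
      (hasDerivAt_id t).prodMk (hasDerivAt_const t y₀)
    have h8 := hd2.hasFDerivAt.comp_hasDerivAt t h7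
    have h9 := h8.clm_apply (hasDerivAt_const t ((0 : ℝ), v))
    simpa using h9
  -- right-hand side
  have R1 : ∀ᶠ y in 𝓝 y₀, cylSlice t (vectorFieldDerivation (cylField (1, 0)) f) (φ.symm y) =
      fderiv ℝ G (t, y) (1, 0) := by
    have h10 : ∀ᶠ q in 𝓝 (t, y₀), DifferentiableAt ℝ G q :=
      (((hG t).of_le (m := 1) (by simp)).eventually (by simp)).mono fun q hq => hq.differentiableAt (by simp)
    have h11 : Filter.Tendsto (fun y : EuclideanSpace ℝ (Fin n) => (t, y)) (𝓝 y₀) (𝓝 (t, y₀)) :=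
      (Continuous.prodMk_right t).continuousAt
    filter_upwards [h11.eventually h10] with y hy
    rw [cylSlice_apply, e1]
    have h7 : HasDerivAt (fun s : ℝ => (s, y)) ((1 : ℝ), (0 : EuclideanSpace ℝ (Fin n))) t :=
      (hasDerivAt_id t).prodMk (hasDerivAt_const t y)
    exact (hy.hasFDerivAt.comp_hasDerivAt t h7).deriv
  have R2 : HasFDerivAt (fun y => fderiv ℝ G (t, y) (1, 0))
      ((ContinuousLinearMap.apply ℝ ℝ ((1 : ℝ), (0 : EuclideanSpace ℝ (Fin n)))).comp
        ((fderiv ℝ (fderiv ℝ G) (t, y₀)).comp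
        (ContinuousLinearMap.inr ℝ ℝ (EuclideanSpace ℝ (Fin n))))) y₀ := by
    have h5 : HasFDerivAt (fun y : EuclideanSpace ℝ (Fin n) => (t, y))
        (ContinuousLinearMap.inr ℝ ℝ (EuclideanSpace ℝ (Fin n))) y₀ := hasFDerivAt_prodMk_right t y₀
    exact (ContinuousLinearMap.apply ℝ ℝ ((1 : ℝ), (0 : EuclideanSpace ℝ (Fin n)))).hasFDerivAt.comp
      y₀ (hd2.hasFDerivAt.comp y₀ h5)
  rw [L1, L2.deriv, hM, Filter.EventuallyEq.fderiv_eq R1, R2.fderiv]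
  simpa using hsymm (1, 0) (0, v)

end Cylinder

section CylinderSections

variable {n : ℕ} {M : Type*} [TopologicalSpace M]
  [ChartedSpace (EuclideanSpace ℝ (Fin n)) M]
  {F : Type*} [NormedAddCommGroup F] [NormedSpace ℝ F]
  {V : M → Type*} [TopologicalSpace (TotalSpace F V)] [∀ x, AddCommGroup (V x)]
  [∀ x, Module ℝ (V x)] [∀ x, TopologicalSpace (V x)] [FiberBundle F V] [VectorBundle ℝ F V]

/-- The space `Γ(pr₂^* V)` of smooth sections of the pullback of `V → M` to `ℝ × M`. -/
abbrev CylSection (n : ℕ) {M : Type*} [TopologicalSpace M]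
    [ChartedSpace (EuclideanSpace ℝ (Fin n)) M]
    (F : Type*) [NormedAddCommGroup F] [NormedSpace ℝ F]
    (V : M → Type*) [TopologicalSpace (TotalSpace F V)] [∀ x, AddCommGroup (V x)]
    [∀ x, Module ℝ (V x)] [∀ x, TopologicalSpace (V x)] [FiberBundle F V] [VectorBundle ℝ F V] :
    Type _ :=
  Cₛ^∞⟮cylModel n; F, (cylProj n M *ᵖ V)⟯

theorem contMDiffAt_cylSection_iff (σ : ∀ q : ℝ × M, V q.2) (q₀ : ℝ × M) :
    ContMDiffAt (cylModel n) ((cylModel n).prod 𝓘(ℝ, F)) ∞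
      (fun q => (⟨q, σ q⟩ : TotalSpace F (cylProj n M *ᵖ V))) q₀ ↔
    ContMDiffAt (cylModel n) ((𝓡 n).prod 𝓘(ℝ, F)) ∞
      (fun q => (⟨q.2, σ q⟩ : TotalSpace F V)) q₀ := by
  rw [contMDiffAt_totalSpace, contMDiffAt_totalSpace]
  constructor
  · rintro ⟨-, h⟩
    exact ⟨contMDiffAt_snd, h⟩
  · rintro ⟨-, h⟩
    exact ⟨contMDiffAt_id, h⟩

/-- The section `ν ∘ pr₂` of `pr₂^* V` defined by a section `ν` of `V`. -/
def cylPull (s : Cₛ^∞⟮𝓡 n; F, V⟯) : CylSection n F V :=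
  ⟨fun q => s q.2, fun q₀ => (contMDiffAt_cylSection_iff _ q₀).2
    (s.contMDiff.comp contMDiff_snd).contMDiffAt⟩

/-- The restriction `σ(t, ·)` of a section of `pr₂^* V` to `{t} × M`. -/
def cylRestrict (t : ℝ) (σ : CylSection n F V) : Cₛ^∞⟮𝓡 n; F, V⟯ :=
  ⟨fun x => σ (t, x), by
    have h : ContMDiff (cylModel n) ((𝓡 n).prod 𝓘(ℝ, F)) ∞
      (fun q : ℝ × M => (⟨q.2, σ q⟩ : TotalSpace F V)) :=
      fun q₀ => (contMDiffAt_cylSection_iff _ q₀).1 σ.contMDiff.contMDiffAt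
    exact h.comp (contMDiff_const.prodMk contMDiff_id)⟩

@[simp] theorem cylPull_apply (s : Cₛ^∞⟮𝓡 n; F, V⟯) (q : ℝ × M) : cylPull s q = s q.2 := rfl

@[simp] theorem cylRestrict_apply (t : ℝ) (σ : CylSection n F V) (x : M) :
    cylRestrict t σ x = σ (t, x) := rfl

theorem CylSection.contMDiff_total (σ : CylSection n F V) :
    ContMDiff (cylModel n) ((𝓡 n).prod 𝓘(ℝ, F)) ∞
      (fun q : ℝ × M => (⟨q.2, σ q⟩ : TotalSpace F V)) :=
  fun q₀ => (contMDiffAt_cylSection_iff _ q₀).1 σ.contMDiff.contMDiffAt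

variable [IsManifold (𝓡 n) ∞ M]

/-- The derivative at time `t` of the curve `s ↦ σ(s, x)` in the fibre `V x`, computed in a local
trivialization. -/
def cylTimeDerivAt (σ : ∀ q : ℝ × M, V q.2) (q : ℝ × M) : V q.2 :=
  ((trivializationAt F V q.2).continuousLinearEquivAt ℝ q.2
      (FiberBundle.mem_baseSet_trivializationAt' q.2)).symm
    (deriv (fun s => (trivializationAt F V q.2).continuousLinearEquivAt ℝ q.2
      (FiberBundle.mem_baseSet_trivializationAt' q.2) (σ (s, q.2))) q.1)

variable [FiniteDimensional ℝ F]

/-- `cylTimeDerivAt` is the derivative of the curve `s ↦ σ(s, x)`, tested against linear forms. -/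
theorem hasDerivAt_cylTimeDerivAt (σ : CylSection n F V) (q : ℝ × M) (ℓ : V q.2 →ₗ[ℝ] ℝ) :
    HasDerivAt (fun s => ℓ (σ (s, q.2)))
      (ℓ (cylTimeDerivAt (F := F) (V := V) (fun q => σ q) q)) q.1 := by
  let e := (trivializationAt F V q.2).continuousLinearEquivAt ℝ q.2
      (FiberBundle.mem_baseSet_trivializationAt' q.2)
  let w : ℝ → F := fun s => e (σ (s, q.2))
  have hw : ContDiff ℝ ∞ w := by
    have h1 : ContMDiff 𝓘(ℝ, ℝ) ((𝓡 n).prod 𝓘(ℝ, F)) ∞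
        (fun s : ℝ => (⟨q.2, σ (s, q.2)⟩ : TotalSpace F V)) :=
      σ.contMDiff_total.comp (contMDiff_id.prodMk contMDiff_const)
    rw [← contMDiff_iff_contDiff]
    intro s
    have h2 := (contMDiffAt_totalSpace.1 (h1 s)).2
    refine h2.congr_of_eventuallyEq (Filter.Eventually.of_forall fun s' => ?_)
    simp [w, e]
  have hd : HasDerivAt w (deriv w q.1) q.1 := (hw.differentiable (by simp)).differentiableAt.hasDerivAt
  let L : F →L[ℝ] ℝ := LinearMap.toContinuousLinearMap (ℓ ∘ₗ e.symm.toLinearEquiv.toLinearMap)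
  have h3 := L.hasFDerivAt.comp_hasDerivAt q.1 hd
  have h4 : (fun s => ℓ (σ (s, q.2))) = L ∘ w := by
    funext s
    change _ = ℓ (e.symm (e (σ (s, q.2))))
    exact congrArg ℓ (e.symm_apply_apply _).symm
  rw [h4]
  exact h3

theorem cylTimeDerivAt_ext {σ : CylSection n F V} {q : ℝ × M} {v : V q.2}
    (h : ∀ ℓ : V q.2 →ₗ[ℝ] ℝ, HasDerivAt (fun s => ℓ (σ (s, q.2))) (ℓ v) q.1) :
    cylTimeDerivAt (F := F) (V := V) (fun q => σ q) q = v := by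
  refine sub_eq_zero.1 ((Module.forall_dual_apply_eq_zero_iff ℝ (_ : V q.2)).1 fun ℓ => ?_)
  rw [map_sub, sub_eq_zero]
  exact (hasDerivAt_cylTimeDerivAt σ q ℓ).unique (h ℓ)

theorem cylField_derivation_time (f : C^∞⟮cylModel n, ℝ × M; 𝓘(ℝ, ℝ), ℝ⟯) (q : ℝ × M) :
    vectorFieldDerivation (cylField (1, 0)) f q = deriv (fun s => f (s, q.2)) q.1 := by
  obtain ⟨t, x⟩ := q
  have h0 : vectorFieldDerivation 0 (cylSlice t f) x = 0 :=
    (mfderiv (𝓡 n) 𝓘(ℝ, ℝ) (cylSlice t f) x).map_zero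
  rw [cylField_derivation_apply, h0, add_zero, one_mul]

variable [T2Space M] [ContMDiffVectorBundle ∞ F V (𝓡 n)]

/-- The operator `∂/∂t` on sections of `pr₂^* V`. -/
def cylTimeDeriv : Module.End ℝ (CylSection n F V) where
  toFun σ := ⟨fun q => cylTimeDerivAt (F := F) (V := V) (fun q => σ q) q, by
    intro q₀
    obtain ⟨r, χ, s, c, hχ, hc, h⟩ := exists_cutoff_frame (F := F) (V := V) (𝓡 n) q₀.2
    let g : Fin r → C^∞⟮cylModel n, ℝ × M; 𝓘(ℝ, ℝ), ℝ⟯ := fun i =>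
      smoothFun (fun q => c i q.2 (σ q)) ((hc i).comp σ.contMDiff_total)
    let τ : CylSection n F V := ∑ i, vectorFieldDerivation (cylField (1, 0)) (g i) • cylPull (s i)
    refine (τ.contMDiff q₀).congr_of_eventuallyEq ?_
    have h1 : ∀ᶠ q : ℝ × M in 𝓝 q₀, χ q.2 = 1 := continuous_snd.continuousAt.eventually hχ
    refine h1.mono fun q hq => ?_
    refine congrArg (TotalSpace.mk q) ?_
    have h2 := h q.2 (cylTimeDerivAt (F := F) (V := V) (fun q => σ q) q)
    rw [hq, one_smul] at h2
    refine h2.trans ?_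
    rw [ContMDiffSection.sum_apply']
    refine Finset.sum_congr rfl fun i _ => ?_
    refine congrArg (fun z : ℝ => z • s i q.2) ?_
    rw [cylField_derivation_time]
    exact (hasDerivAt_cylTimeDerivAt σ q (c i q.2)).deriv.symm⟩
  map_add' σ τ := ContMDiffSection.ext fun q => cylTimeDerivAt_ext fun ℓ => by
    have := (hasDerivAt_cylTimeDerivAt σ q ℓ).add (hasDerivAt_cylTimeDerivAt τ q ℓ)
    refine (this.congr_deriv (map_add ℓ _ _).symm).congr_of_eventuallyEq
      (Filter.Eventually.of_forall fun s => map_add ℓ _ _)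
  map_smul' a σ := ContMDiffSection.ext fun q => cylTimeDerivAt_ext fun ℓ => by
    have := (hasDerivAt_cylTimeDerivAt σ q ℓ).const_smul a
    refine (this.congr_deriv (map_smul ℓ _ _).symm).congr_of_eventuallyEq
      (Filter.Eventually.of_forall fun s => map_smul ℓ _ _)

theorem cylTimeDeriv_apply (σ : CylSection n F V) (q : ℝ × M) :
    cylTimeDeriv σ q = cylTimeDerivAt (F := F) (V := V) (fun q => σ q) q := rfl

theorem cylTimeDeriv_smul (f : C^∞⟮cylModel n, ℝ × M; 𝓘(ℝ, ℝ), ℝ⟯) (σ : CylSection n F V) :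
    cylTimeDeriv (f • σ) = f • cylTimeDeriv σ + vectorFieldDerivation (cylField (1, 0)) f • σ :=
  ContMDiffSection.ext fun q => cylTimeDerivAt_ext fun ℓ => by
    have h1 : HasDerivAt (fun s => f (s, q.2)) (vectorFieldDerivation (cylField (1, 0)) f q) q.1 := by
      rw [cylField_derivation_time]
      have h2 : ContMDiff 𝓘(ℝ, ℝ) 𝓘(ℝ, ℝ) ∞ (fun s : ℝ => f (s, q.2)) :=
        f.contMDiff.comp (contMDiff_id.prodMk contMDiff_const)
      exact (h2.contDiff.differentiable (by simp)).differentiableAt.hasDerivAt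
    have h3 := h1.mul (hasDerivAt_cylTimeDerivAt σ q ℓ)
    refine (h3.congr_deriv ?_).congr_of_eventuallyEq
      (Filter.Eventually.of_forall fun s => map_smul ℓ _ _)
    refine Eq.trans ?_ (map_add ℓ _ _).symm
    have e1 : ℓ ((f • cylTimeDeriv σ) q) = f q * ℓ (cylTimeDeriv σ q) := map_smul ℓ _ _
    have e2 : ℓ ((vectorFieldDerivation (cylField (1, 0)) f • σ) q) =
      vectorFieldDerivation (cylField (1, 0)) f q * ℓ (σ q) := map_smul ℓ _ _
    rw [e1, e2, add_comm]
    rfl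

/-- The lift to `pr₂^* V` of an operator `D` on sections of `V`, acting slicewise:
`(D̃ σ)(t, ·) = D(σ(t, ·))`. Here `D` is a covariant differential operator with symbol `X`. -/
def cylLift (X : Cₛ^∞⟮𝓡 n; EuclideanSpace ℝ (Fin n), (TangentSpace (𝓡 n) : M → Type _)⟯)
    (D : Module.End ℝ Cₛ^∞⟮𝓡 n; F, V⟯)
    (hD : ∀ (f : C^∞⟮𝓡 n, M; 𝓘(ℝ, ℝ), ℝ⟯) (s : Cₛ^∞⟮𝓡 n; F, V⟯),
      D (f • s) = f • D s + vectorFieldDerivation X f • s) :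
    Module.End ℝ (CylSection n F V) where
  toFun σ := ⟨fun q => D (cylRestrict q.1 σ) q.2, by
    intro q₀
    obtain ⟨r, χ, s, c, hχ, hc, h⟩ := exists_cutoff_frame (F := F) (V := V) (𝓡 n) q₀.2
    let g : Fin r → C^∞⟮cylModel n, ℝ × M; 𝓘(ℝ, ℝ), ℝ⟯ := fun i =>
      smoothFun (fun q => c i q.2 (σ q)) ((hc i).comp σ.contMDiff_total)
    let dχ : C^∞⟮cylModel n, ℝ × M; 𝓘(ℝ, ℝ), ℝ⟯ := (vectorFieldDerivation X χ).comp (cylProj n M)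
    let τ : CylSection n F V := ∑ i, (g i • cylPull (D (s i)) +
      vectorFieldDerivation (cylField (0, X)) (g i) • cylPull (s i)) - dχ • σ
    refine (τ.contMDiff q₀).congr_of_eventuallyEq ?_
    have h1 : ∀ᶠ q : ℝ × M in 𝓝 q₀, χ q.2 = 1 := continuous_snd.continuousAt.eventually hχ
    refine h1.mono fun q hq => ?_
    refine congrArg (TotalSpace.mk q) ?_
    have h2 := congrArg (fun τ => D τ q.2) (cutoff_frame_sections hc h (cylRestrict q.1 σ))
    simp only [hD, map_sum] at h2
    rw [ContMDiffSection.sum_apply'] at h2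
    have h3 : (D (cylRestrict q.1 σ) q.2 : V q.2) = (∑ i, (c i q.2 (σ q) • D (s i) q.2 +
        vectorFieldDerivation X (cylSlice q.1 (g i)) q.2 • s i q.2) : V q.2) -
        vectorFieldDerivation X χ q.2 • cylRestrict q.1 σ q.2 := by
      rw [eq_sub_iff_add_eq]
      refine Eq.trans ?_ h2
      change _ = χ q.2 • D (cylRestrict q.1 σ) q.2 + _
      rw [hq, one_smul]
      rfl
    refine h3.trans ?_
    change _ = (∑ i, (g i • cylPull (D (s i)) +
      vectorFieldDerivation (cylField (0, X)) (g i) • cylPull (s i)) : CylSection n F V) q - _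
    rw [ContMDiffSection.sum_apply']
    refine congrArg₂ (fun a b : V q.2 => a - b) ?_ rfl
    refine Finset.sum_congr rfl fun i _ => ?_
    refine congrArg (fun z : ℝ => c i q.2 (σ q) • D (s i) q.2 + z • s i q.2) ?_
    obtain ⟨t, x⟩ := q
    rw [cylField_derivation_apply, zero_mul, zero_add]⟩
  map_add' σ τ := ContMDiffSection.ext fun q =>
    congrArg (fun s : Cₛ^∞⟮𝓡 n; F, V⟯ => s q.2) (D.map_add (cylRestrict q.1 σ) (cylRestrict q.1 τ))
  map_smul' a σ := ContMDiffSection.ext fun q =>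
    congrArg (fun s : Cₛ^∞⟮𝓡 n; F, V⟯ => s q.2) (D.map_smul a (cylRestrict q.1 σ))

end CylinderSections

section FibreIntegral

/-- Differentiation under the integral sign, for smooth integrands. -/
theorem contDiffOn_integral_unit {P : Type*} [NormedAddCommGroup P] [NormedSpace ℝ P] {s : Set P}
    (hs : IsOpen s) {G : ℝ × P → ℝ} (hG : ContDiffOn ℝ ∞ G (Set.univ ×ˢ s)) :
    ContDiffOn ℝ ∞ (fun p => ∫ t in (0 : ℝ)..1, G (t, p)) s := by
  let ψ : ContDiffBump (0 : ℝ) := ⟨2, 3, by norm_num, by norm_num⟩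
  let g : P → ℝ → ℝ := fun p r => ψ r * G (-r, p)
  let f : ℝ → ℝ := Set.indicator (Set.Ioc 0 1) 1
  have hf : MeasureTheory.LocallyIntegrable f MeasureTheory.volume := by
    refine MeasureTheory.Integrable.locallyIntegrable ?_
    exact (MeasureTheory.integrable_indicator_iff measurableSet_Ioc).2
      (MeasureTheory.integrableOn_const (by simp))
  have hg : ContDiffOn ℝ ∞ (Function.uncurry g) (s ×ˢ Set.univ) := by
    refine ContDiffOn.mul (ψ.contDiff.comp contDiff_snd).contDiffOn ?_
    refine hG.comp (t := Set.univ ×ˢ s) (f := fun q : P × ℝ => (-q.2, q.1))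
      (contDiff_snd.neg.prodMk contDiff_fst).contDiffOn ?_
    intro q hq
    exact ⟨trivial, hq.1⟩
  have key := MeasureTheory.contDiffOn_convolution_right_with_param_comp (μ := MeasureTheory.volume) (n := ⊤)
    (ContinuousLinearMap.mul ℝ ℝ)
    (v := fun _ : P => (0 : ℝ)) contDiffOn_const (f := f) (g := g) (k := Metric.closedBall 0 3) hs
    (isCompact_closedBall _ _) (fun p x _ hx => by
      have h0 : ψ x = 0 := ψ.zero_of_le_dist (by
        rw [Metric.mem_closedBall, not_le] at hx
        exact hx.le)
      simp [g, h0]) hf hg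
  refine key.congr fun p _ => ?_
  change _ = ∫ t, f t * g p (0 - t)
  rw [intervalIntegral.integral_of_le zero_le_one,
    ← MeasureTheory.integral_indicator measurableSet_Ioc]
  refine MeasureTheory.integral_congr_ae (Filter.Eventually.of_forall fun t => ?_)
  by_cases ht : t ∈ Set.Ioc (0 : ℝ) 1
  · have h1 : ψ (-t) = 1 := ψ.one_of_mem_closedBall (by
      rw [Metric.mem_closedBall, dist_zero_right, norm_neg, Real.norm_eq_abs, abs_of_pos ht.1]
      exact ht.2.trans (by norm_num [ψ]))
    simp [f, g, ht, h1]
  · simp [f, ht]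

variable {n : ℕ} {M : Type*} [TopologicalSpace M]
  [ChartedSpace (EuclideanSpace ℝ (Fin n)) M] [IsManifold (𝓡 n) ∞ M]

theorem cylSlice_intervalIntegrable (f : C^∞⟮cylModel n, ℝ × M; 𝓘(ℝ, ℝ), ℝ⟯) (x : M) :
    IntervalIntegrable (fun t => f (t, x)) MeasureTheory.volume 0 1 :=
  (f.contMDiff.continuous.comp (Continuous.prodMk_left x)).intervalIntegrable 0 1

/-- The map `C^∞(ℝ × M) → C^∞(M)`, `f ↦ (x ↦ ∫_0^1 f(t, x) dt)`. -/
def cylIntegral : C^∞⟮cylModel n, ℝ × M; 𝓘(ℝ, ℝ), ℝ⟯ →ₗ[ℝ] C^∞⟮𝓡 n, M; 𝓘(ℝ, ℝ), ℝ⟯ where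
  toFun f := ⟨fun x => ∫ t in (0 : ℝ)..1, f (t, x), by
    intro x
    let φ := extChartAt (𝓡 n) x
    have h1 : ContMDiffOn 𝓘(ℝ, EuclideanSpace ℝ (Fin n)) (𝓡 n) ∞ φ.symm φ.target :=
      contMDiffOn_extChartAt_symm x
    have ho : IsOpen φ.target := isOpen_extChartAt_target x
    let G : ℝ × EuclideanSpace ℝ (Fin n) → ℝ := fun q => f (q.1, φ.symm q.2)
    have hG : ContDiffOn ℝ ∞ G (Set.univ ×ˢ φ.target) := by
      rintro ⟨s, y⟩ ⟨-, hy⟩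
      have h2 : ContMDiffAt 𝓘(ℝ, EuclideanSpace ℝ (Fin n)) (𝓡 n) ∞ φ.symm y :=
        h1.contMDiffAt (ho.mem_nhds hy)
      have h3 : ContMDiffAt (𝓘(ℝ, ℝ).prod 𝓘(ℝ, EuclideanSpace ℝ (Fin n))) (cylModel n) ∞
          (fun q : ℝ × EuclideanSpace ℝ (Fin n) => (q.1, φ.symm q.2)) (s, y) :=
        contMDiffAt_fst.prodMk (ContMDiffAt.comp (s, y) h2 contMDiffAt_snd)
      have h4 : ContMDiffAt (𝓘(ℝ, ℝ).prod 𝓘(ℝ, EuclideanSpace ℝ (Fin n))) 𝓘(ℝ, ℝ) ∞ G (s, y) :=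
        f.contMDiff.contMDiffAt.comp (s, y) h3
      rw [← modelWithCornersSelf_prod, chartedSpaceSelf_prod] at h4
      exact h4.contDiffAt.contDiffWithinAt
    have h5 := (contDiffOn_integral_unit ho hG).contDiffAt (ho.mem_nhds (mem_extChartAt_target x))
    have h6 : ContMDiffAt (𝓡 n) 𝓘(ℝ, EuclideanSpace ℝ (Fin n)) ∞ φ x := contMDiffAt_extChartAt
    have h7 := h5.contMDiffAt.comp x h6
    refine h7.congr_of_eventuallyEq ?_
    filter_upwards [extChartAt_source_mem_nhds (I := 𝓡 n) x] with y hy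
    have h8 : φ.symm (φ y) = y := φ.left_inv hy
    change _ = ∫ t in (0 : ℝ)..1, f (t, φ.symm (φ y))
    rw [h8]⟩
  map_add' f g := ContMDiffMap.ext fun x => intervalIntegral.integral_add
    (cylSlice_intervalIntegrable f x) (cylSlice_intervalIntegrable g x)
  map_smul' c f := ContMDiffMap.ext fun x => intervalIntegral.integral_smul c _

@[simp] theorem cylIntegral_apply (f : C^∞⟮cylModel n, ℝ × M; 𝓘(ℝ, ℝ), ℝ⟯) (x : M) :
    cylIntegral f x = ∫ t in (0 : ℝ)..1, f (t, x) := rfl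

end FibreIntegral

section ChernForms

/-- The Chern character form `ch_p = Tr((R^∇)^p)` of an `ℝ`-linear connection on the sections of
a vector bundle `V → N`. -/
def RLinearConnection.chernForm {L : Type*} [LieRing L] [LieAlgebra ℝ L]
    {E : Type*} [NormedAddCommGroup E] [NormedSpace ℝ E] [FiniteDimensional ℝ E]
    {H : Type*} [TopologicalSpace H] {I : ModelWithCorners ℝ E H}
    {N : Type*} [TopologicalSpace N] [ChartedSpace H N] [IsManifold I ∞ N] [T2Space N]
    {F : Type*} [NormedAddCommGroup F] [NormedSpace ℝ F] [FiniteDimensional ℝ F]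
    {V : N → Type*} [TopologicalSpace (TotalSpace F V)] [∀ x, AddCommGroup (V x)]
    [∀ x, Module ℝ (V x)] [∀ x, TopologicalSpace (V x)] [FiberBundle F V] [VectorBundle ℝ F V]
    [ContMDiffVectorBundle ∞ F V I]
    {δ : L →ₗ⁅ℝ⁆ Derivation ℝ C^∞⟮I, N; 𝓘(ℝ, ℝ), ℝ⟯ C^∞⟮I, N; 𝓘(ℝ, ℝ), ℝ⟯}
    (D : RLinearConnection δ Cₛ^∞⟮I; F, V⟯) (p : ℕ) :
    AltForm L C^∞⟮I, N; 𝓘(ℝ, ℝ), ℝ⟯ (2 * p) :=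
  (smoothTrace.restrictScalars ℝ).compAlternatingMap (alternatingPower D.curvature p)

variable {n : ℕ} {M : Type*} [TopologicalSpace M]
  [ChartedSpace (EuclideanSpace ℝ (Fin n)) M] [IsManifold (𝓡 n) ∞ M] [T2Space M]
  {FA : Type*} [NormedAddCommGroup FA] [NormedSpace ℝ FA] [FiniteDimensional ℝ FA]
  {A : M → Type*} [TopologicalSpace (TotalSpace FA A)] [∀ x, AddCommGroup (A x)]
  [∀ x, Module ℝ (A x)] [∀ x, TopologicalSpace (A x)] [FiberBundle FA A]
  [VectorBundle ℝ FA A] [ContMDiffVectorBundle ∞ FA A (𝓡 n)]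
  {F : Type*} [NormedAddCommGroup F] [NormedSpace ℝ F] [FiniteDimensional ℝ F]
  {V : M → Type*} [TopologicalSpace (TotalSpace F V)] [∀ x, AddCommGroup (V x)]
  [∀ x, Module ℝ (V x)] [∀ x, TopologicalSpace (V x)] [FiberBundle F V] [VectorBundle ℝ F V]
  [ContMDiffVectorBundle ∞ F V (𝓡 n)]

/-- The one-dimensional abelian Lie algebra `ℝ`. -/
instance realLieRing : LieRing ℝ where
  bracket _ _ := 0
  add_lie _ _ _ := (add_zero 0).symm
  lie_add _ _ _ := (add_zero 0).symm
  lie_self _ := rfl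
  leibniz_lie _ _ _ := (add_zero 0).symm

instance realLieAlgebra : LieAlgebra ℝ ℝ where
  lie_smul c _ _ := (smul_zero c).symm

namespace LieAlgebroid

/-- The Lie algebra `ℝ ∂/∂t ⊕ Γ(A)` of sections of `Tℝ × A → ℝ × M` (with its componentwise
bracket) acts on `C^∞(ℝ × M)` by `(r, a) ↦ r ∂/∂t + ρ_A ∘ a`. -/
def cylDerivation (𝒜 : LieAlgebroid n FA A) : (ℝ × 𝒜.Sec) →ₗ⁅ℝ⁆
    Derivation ℝ C^∞⟮cylModel n, ℝ × M; 𝓘(ℝ, ℝ), ℝ⟯ C^∞⟮cylModel n, ℝ × M; 𝓘(ℝ, ℝ), ℝ⟯ where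
  toFun u := vectorFieldDerivation (cylField (u.1, 𝒜.anchorField u.2))
  map_add' u v := by
    rw [← vectorFieldDerivation_add, ← map_add, Prod.fst_add, Prod.snd_add, 𝒜.anchorField.map_add]
    rfl
  map_smul' c u := by
    rw [RingHom.id_apply, ← vectorFieldDerivation_smul, ← map_smul, Prod.smul_fst, Prod.smul_snd,
      𝒜.anchorField.map_smul]
    rfl
  map_lie' {u v} := by
    let T : C^∞⟮cylModel n, ℝ × M; 𝓘(ℝ, ℝ), ℝ⟯ → C^∞⟮cylModel n, ℝ × M; 𝓘(ℝ, ℝ), ℝ⟯ :=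
      fun f => vectorFieldDerivation (cylField (1, 0)) f
    let X : 𝒜.Sec → C^∞⟮cylModel n, ℝ × M; 𝓘(ℝ, ℝ), ℝ⟯ → C^∞⟮cylModel n, ℝ × M; 𝓘(ℝ, ℝ), ℝ⟯ :=
      fun a f => vectorFieldDerivation (cylField (0, 𝒜.anchorField a)) f
    have hX : ∀ a f t x, X a f (t, x) = 𝒜.anchorDerivation a (cylSlice t f) x := by
      intro a f t x
      change vectorFieldDerivation (cylField (0, 𝒜.anchorField a)) f (t, x) = _
      rw [cylField_derivation_apply, zero_mul, zero_add]
      rfl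
    have hsl : ∀ a f t, cylSlice t (X a f) = 𝒜.anchorDerivation a (cylSlice t f) := by
      intro a f t
      ext x
      exact hX a f t x
    have hTX : ∀ a f, T (X a f) = X a (T f) := fun a f => cyl_mixed_partials _ f
    have hdec : ∀ (u : ℝ × 𝒜.Sec) f,
        vectorFieldDerivation (cylField (u.1, 𝒜.anchorField u.2)) f = u.1 • T f + X u.2 f := by
      intro u f
      have h1 : (u.1, 𝒜.anchorField u.2) = u.1 • (1, 0) + (0, 𝒜.anchorField u.2) := by
        ext <;> simp
      rw [h1, map_add, map_smul, vectorFieldDerivation_add, vectorFieldDerivation_smul]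
      rfl
    have hlie : ∀ a b f, X ⁅a, b⁆ f = X a (X b f) - X b (X a f) := by
      intro a b f
      ext ⟨t, x⟩
      change X ⁅a, b⁆ f (t, x) = X a (X b f) (t, x) - X b (X a f) (t, x)
      rw [hX, hX, hX, hsl, hsl, LieHom.map_lie]
      rfl
    have hT : ∀ f g (r : ℝ), T (r • f + g) = r • T f + T g := fun f g r => by
      simp only [T, map_add, Derivation.map_smul]
    have hX' : ∀ a f g (r : ℝ), X a (r • f + g) = r • X a f + X a g := fun a f g r => by
      simp only [X, map_add, Derivation.map_smul]
    refine Derivation.ext fun f => ?_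
    change vectorFieldDerivation (cylField (⁅u, v⁆.1, 𝒜.anchorField ⁅u, v⁆.2)) f =
      vectorFieldDerivation (cylField (u.1, 𝒜.anchorField u.2))
        (vectorFieldDerivation (cylField (v.1, 𝒜.anchorField v.2)) f) -
      vectorFieldDerivation (cylField (v.1, 𝒜.anchorField v.2))
        (vectorFieldDerivation (cylField (u.1, 𝒜.anchorField u.2)) f)
    rw [hdec, hdec, hdec, hdec, hdec, hT, hT, hX', hX', hTX, hTX]
    have h0 : ⁅u, v⁆.1 = (0 : ℝ) := rfl
    have h1 : ⁅u, v⁆.2 = ⁅u.2, v.2⁆ := rfl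
    rw [h0, h1, hlie, zero_smul, zero_add, smul_add, smul_add, smul_smul, smul_smul,
      mul_comm v.1 u.1]
    abel

theorem cylDerivation_apply (𝒜 : LieAlgebroid n FA A) (u : ℝ × 𝒜.Sec)
    (f : C^∞⟮cylModel n, ℝ × M; 𝓘(ℝ, ℝ), ℝ⟯) (t : ℝ) (x : M) :
    𝒜.cylDerivation u f (t, x) =
      u.1 * deriv (fun s => f (s, x)) t + 𝒜.anchorDerivation u.2 (cylSlice t f) x :=
  cylField_derivation_apply _ _ f t x

/-- `ℝ`-linear `A`-connections `∇ : Γ(A) → CDO(V)` on a vector bundle `V`: `∇_a` is a covariant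
differential operator with symbol `ρ_A ∘ a`, and `∇` is `ℝ`-linear in `a`. -/
abbrev Connection (𝒜 : LieAlgebroid n FA A) (F : Type*) [NormedAddCommGroup F] [NormedSpace ℝ F]
    (V : M → Type*) [TopologicalSpace (TotalSpace F V)] [∀ x, AddCommGroup (V x)]
    [∀ x, Module ℝ (V x)] [∀ x, TopologicalSpace (V x)] [FiberBundle F V] [VectorBundle ℝ F V] :
    Type _ := RLinearConnection 𝒜.anchorDerivation Cₛ^∞⟮𝓡 n; F, V⟯

variable {𝒜 : LieAlgebroid n FA A}

/-- The operator `∇̃_a` on sections of `pr₂^* V` defined by `(∇̃_a σ)(t, ·) = ∇_a(σ(t, ·))`. -/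
def Connection.lift (D : 𝒜.Connection F V) : 𝒜.Sec →ₗ[ℝ] Module.End ℝ (CylSection n F V) where
  toFun a := cylLift (𝒜.anchorField a) (D a) (D.leibniz a)
  map_add' a b := LinearMap.ext fun σ => ContMDiffSection.ext fun q =>
    congrArg (fun T : Module.End ℝ Cₛ^∞⟮𝓡 n; F, V⟯ => T (cylRestrict q.1 σ) q.2)
      (D.toLinearMap.map_add a b)
  map_smul' c a := LinearMap.ext fun σ => ContMDiffSection.ext fun q =>
    congrArg (fun T : Module.End ℝ Cₛ^∞⟮𝓡 n; F, V⟯ => T (cylRestrict q.1 σ) q.2)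
      (D.toLinearMap.map_smul c a)

theorem Connection.lift_apply (D : 𝒜.Connection F V) (a : 𝒜.Sec) (σ : CylSection n F V)
    (q : ℝ × M) : D.lift a σ q = D a (cylRestrict q.1 σ) q.2 := rfl

theorem Connection.lift_smul (D : 𝒜.Connection F V) (a : 𝒜.Sec)
    (f : C^∞⟮cylModel n, ℝ × M; 𝓘(ℝ, ℝ), ℝ⟯) (σ : CylSection n F V) :
    D.lift a (f • σ) = f • D.lift a σ + 𝒜.cylDerivation (0, a) f • σ :=
  ContMDiffSection.ext fun q => by
    obtain ⟨t, x⟩ := q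
    have h := congrArg (fun s : Cₛ^∞⟮𝓡 n; F, V⟯ => s x)
      (D.leibniz a (cylSlice t f) (cylRestrict t σ))
    refine Eq.trans h ?_
    refine congrArg (fun z : ℝ => f (t, x) • D a (cylRestrict t σ) x + z • cylRestrict t σ x) ?_
    rw [cylDerivation_apply, zero_mul, zero_add]

/-- The affine combination `∇^aff = (1 - t) ∇⁰ + t ∇¹` of two `ℝ`-linear `A`-connections on `V`,
a connection on `pr₂^* V` along `ℝ ∂/∂t ⊕ Γ(A)`:
`∇^aff_{∂/∂t} = ∂/∂t` and `∇^aff_a = (1 - t) ∇̃⁰_a + t ∇̃¹_a`. -/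
def affineConnection (D₀ D₁ : 𝒜.Connection F V) :
    RLinearConnection 𝒜.cylDerivation (CylSection n F V) where
  toLinearMap := (LinearMap.fst ℝ ℝ 𝒜.Sec).smulRight cylTimeDeriv +
    ((1 - cylTime (n := n) (M := M)) • D₀.lift + cylTime (n := n) (M := M) • D₁.lift) ∘ₗ
      LinearMap.snd ℝ ℝ 𝒜.Sec
  leibniz u f σ := by
    have h : 𝒜.cylDerivation u f =
        u.1 • vectorFieldDerivation (cylField (1, 0)) f + 𝒜.cylDerivation (0, u.2) f := by
      ext ⟨t, x⟩
      change _ = u.1 * vectorFieldDerivation (cylField (1, 0)) f (t, x) +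
        𝒜.cylDerivation (0, u.2) f (t, x)
      rw [cylDerivation_apply, cylDerivation_apply, cylField_derivation_time, zero_mul, zero_add]
    change u.1 • cylTimeDeriv (f • σ) + ((1 - cylTime (n := n) (M := M)) • D₀.lift u.2 (f • σ) +
        cylTime (n := n) (M := M) • D₁.lift u.2 (f • σ)) =
      f • (u.1 • cylTimeDeriv σ + ((1 - cylTime (n := n) (M := M)) • D₀.lift u.2 σ +
        cylTime (n := n) (M := M) • D₁.lift u.2 σ)) + _
    rw [h, cylTimeDeriv_smul, Connection.lift_smul, Connection.lift_smul]
    generalize cylTimeDeriv σ = w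
    generalize D₀.lift u.2 σ = w₀
    generalize D₁.lift u.2 σ = w₁
    generalize 𝒜.cylDerivation (0, u.2) f = b
    generalize vectorFieldDerivation (cylField (1, 0)) f = b'
    refine ContMDiffSection.ext fun q => ?_
    change u.1 • (f q • w q + b' q • σ q) + ((1 - q.1) • (f q • w₀ q + b q • σ q) +
      q.1 • (f q • w₁ q + b q • σ q)) = f q • (u.1 • w q + ((1 - q.1) • w₀ q + q.1 • w₁ q)) +
      (u.1 * b' q + b q) • σ q
    module

theorem affineConnection_apply (D₀ D₁ : 𝒜.Connection F V) (u : ℝ × 𝒜.Sec) (σ : CylSection n F V) :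
    affineConnection D₀ D₁ u σ = u.1 • cylTimeDeriv σ +
      ((1 - cylTime (n := n) (M := M)) • D₀.lift u.2 σ +
        cylTime (n := n) (M := M) • D₁.lift u.2 σ) := rfl

/-- The Chern–Simons form `cs_{p+1}(∇⁰, ∇¹)`, the integral over the unit interval of the Chern
character form of `∇^aff`:
`cs_{p+1}(a_1, …, a_{2p+1}) = ∫_0^1 ch_{p+1}(∇^aff)(∂/∂t, a_1, …, a_{2p+1}) dt`. -/
def chernSimons (D₀ D₁ : 𝒜.Connection F V) (p : ℕ) : 𝒜.Form (2 * p + 1) :=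
  cylIntegral.compAlternatingMap
    ((AlternatingMap.curryLeft (n := 2 * p + 1)
      ((affineConnection D₀ D₁).chernForm (p + 1)) (1, 0)).compLinearMap
        (LinearMap.inr ℝ ℝ 𝒜.Sec))

end LieAlgebroid
end ChernForms

end

/-! This is Chern–Weil theory with the $C^\infty(M)$-linearity in the Lie algebra slots removed. The
forms are cochains of the real Lie algebra $\Gamma(A)$, so everything about $d$ is an identity for a
Lie algebra $L$ acting by derivations, and smooth geometry enters only through the trace, the
integral over $[0,1]$, and the existence of a tensorial connection.

Closedness. Write $R$ for the curvature and $\mathrm{ad}\,\nabla$ for the induced action on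
endomorphisms. The Bianchi identity, a consequence of Jacobi, says that $R$ is closed for the Koszul
differential of $\mathrm{ad}\,\nabla$. Up to a factor, $R^{p+1}$ is $R\wedge R^p$, so $d(R^p)=0$ by
induction (`koszulDifferential_bilinWedge`, `alternatingPower_succ`). Flatness of
$\mathrm{ad}\,\nabla$ is not needed, only the Leibniz rule. The trace intertwines
$\mathrm{ad}\,\nabla$ with the action on functions (`RLinearConnection.smoothTrace_adjoint`), hence
$d\,\mathrm{ch}_p=0$.

Transgression. The same result applies to $\nabla^{\mathrm{aff}}$ along $\mathbb
R\,\partial_t\oplus\Gamma(A)$. As $\partial_t$ is central, Cartan's formula gives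
$d(\iota_{\partial_t}\mathrm{ch})=\partial_t\mathrm{ch}$
(`koszulDifferential_curryLeft_of_central`). Integration over $[0,1]$ commutes with the action of
$\Gamma(A)$, and the fundamental theorem of calculus leaves the values at the endpoints, where
$\nabla^{\mathrm{aff}}$ restricts to $\nabla^1$ and $\nabla^0$. Independence of the class follows.

The total class. An element of a direct sum has finitely many nonzero components, and for an
arbitrary $\mathbb R$-linear connection nothing in the definition bounds the degree of its Chern
forms. A partition of unity gives a $C^\infty(M)$-linear connection; its Chern forms are tensorial,
hence zero above the rank of $A$. By independence of the connection, the classes in those degrees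
vanish for every connection. -/

noncomputable section

set_option maxSynthPendingDepth 3

/-! ### Calculus of alternation in one, two and three arguments -/

section Alternation

variable {L : Type*} [AddCommGroup L] [Module ℝ L] {W : Type*} [AddCommGroup W] [Module ℝ W]
  {n : ℕ}

/-- Alternation of a map that is linear in one argument and alternating in the others. -/
abbrev alternate₁ : (L →ₗ[ℝ] L [⋀^Fin n]→ₗ[ℝ] W) →ₗ[ℝ] L [⋀^Fin (n + 1)]→ₗ[ℝ] W :=
  AlternatingMap.alternatizeUncurryFinLM

/-- Alternation of a map that is bilinear in two arguments and alternating in the others. -/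
def alternate₂ : (L →ₗ[ℝ] L →ₗ[ℝ] L [⋀^Fin n]→ₗ[ℝ] W) →ₗ[ℝ] L [⋀^Fin (n + 2)]→ₗ[ℝ] W :=
  alternate₁ ∘ₗ LinearMap.compRight ℝ alternate₁

/-- Alternation of a map that is trilinear in three arguments and alternating in the others. -/
def alternate₃ : (L →ₗ[ℝ] L →ₗ[ℝ] L →ₗ[ℝ] L [⋀^Fin n]→ₗ[ℝ] W) →ₗ[ℝ]
    L [⋀^Fin (n + 3)]→ₗ[ℝ] W :=
  alternate₁ ∘ₗ LinearMap.compRight ℝ alternate₂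

theorem alternate₂_eq (f : L →ₗ[ℝ] L →ₗ[ℝ] L [⋀^Fin n]→ₗ[ℝ] W) :
    alternate₂ f = alternate₁ (alternate₁ ∘ₗ f) := rfl

theorem alternate₃_eq (f : L →ₗ[ℝ] L →ₗ[ℝ] L →ₗ[ℝ] L [⋀^Fin n]→ₗ[ℝ] W) :
    alternate₃ f = alternate₁ (alternate₂ ∘ₗ f) := rfl

theorem alternate₃_eq' (f : L →ₗ[ℝ] L →ₗ[ℝ] L →ₗ[ℝ] L [⋀^Fin n]→ₗ[ℝ] W) :
    alternate₃ f = alternate₂ (LinearMap.compRight ℝ alternate₁ ∘ₗ f) := rfl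

/-- The sum of `f` and its flip is symmetric in the first two arguments, and symmetric maps
alternate to zero. -/
theorem alternate₂_flip (f : L →ₗ[ℝ] L →ₗ[ℝ] L [⋀^Fin n]→ₗ[ℝ] W) :
    alternate₂ f.flip = - alternate₂ f := by
  have h : alternate₂ (f + f.flip) = 0 :=
    AlternatingMap.alternatizeUncurryFin_alternatizeUncurryFinLM_comp_of_symmetric
      fun x y => by simp [add_comm]
  rw [map_add] at h
  exact eq_neg_of_add_eq_zero_right h

/-- A cyclic rotation of three arguments is a product of two transpositions, each contributing one
sign through `alternate₂_flip`. -/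
theorem alternate₃_cyclic {f g : L →ₗ[ℝ] L →ₗ[ℝ] L →ₗ[ℝ] L [⋀^Fin n]→ₗ[ℝ] W}
    (h : ∀ a b c, g a b c = f b c a) : alternate₃ g = alternate₃ f := by
  have h1 : g = ((LinearMap.lflip (R₀ := ℝ)).toLinearMap ∘ₗ f).flip := by
    ext a b c v; simp [h]
  have h2 : alternate₃ g = - alternate₃ ((LinearMap.lflip (R₀ := ℝ)).toLinearMap ∘ₗ f) := by
    rw [h1, alternate₃_eq', alternate₃_eq', ← alternate₂_flip]
    rfl
  rw [h2, alternate₃_eq, alternate₃_eq, ← map_neg]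
  congr 1
  ext a v
  exact congrArg (fun z => (-z) v) (alternate₂_flip (f a)) |>.trans (neg_neg _)

/-- The three rotations of `f` have the same alternation, so the alternation of their sum is three
times that of `f`. This turns identities stated as cyclic sums, such as Jacobi or Bianchi, into
identities of forms. -/
theorem alternate₃_eq_zero_of_cyclic_sum {f : L →ₗ[ℝ] L →ₗ[ℝ] L →ₗ[ℝ] L [⋀^Fin n]→ₗ[ℝ] W}
    (h : ∀ a b c, f a b c + f b c a + f c a b = 0) : alternate₃ f = 0 := by
  let g : L →ₗ[ℝ] L →ₗ[ℝ] L →ₗ[ℝ] L [⋀^Fin n]→ₗ[ℝ] W := ((LinearMap.lflip (R₀ := ℝ)).toLinearMap ∘ₗ f).flip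
  let k : L →ₗ[ℝ] L →ₗ[ℝ] L →ₗ[ℝ] L [⋀^Fin n]→ₗ[ℝ] W := ((LinearMap.lflip (R₀ := ℝ)).toLinearMap ∘ₗ g).flip
  have hg : alternate₃ g = alternate₃ f := alternate₃_cyclic fun a b c => rfl
  have hk : alternate₃ k = alternate₃ g := alternate₃_cyclic fun a b c => rfl
  have hs : f + g + k = 0 := by
    ext a b c v
    exact congrArg (fun z => z v) (h a b c)
  have h0 : alternate₃ (f + g + k) = 0 := by rw [hs, map_zero]
  rw [map_add, map_add, hk, hg] at h0
  have h3 : (3 : ℝ) • alternate₃ f = 0 := by rw [← h0]; module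
  exact (smul_eq_zero.1 h3).resolve_left (by norm_num)

/-- Contraction is an antiderivation: `c` either lands in the distinguished slot (the summand of
index `0`) or inside the form `θ a`, where passing the distinguished slot costs a sign. -/
theorem alternate₁_curryLeft (θ : L →ₗ[ℝ] L [⋀^Fin (n + 1)]→ₗ[ℝ] W) (c : L) :
    (alternate₁ θ).curryLeft c = θ c -
      alternate₁ ((LinearMap.applyₗ c ∘ₗ AlternatingMap.curryLeftLinearMap) ∘ₗ θ) := by
  ext v
  simp only [AlternatingMap.curryLeft_apply_apply, AlternatingMap.alternatizeUncurryFinLM_apply,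
    AlternatingMap.alternatizeUncurryFin_apply, AlternatingMap.sub_apply]
  rw [Fin.sum_univ_succ, sub_eq_add_neg, ← Finset.sum_neg_distrib]
  congr 1
  · simp [Matrix.vecCons]
  · refine Finset.sum_congr rfl fun i _ => ?_
    simp [pow_succ, Matrix.vecCons]
    congr 2
    funext j
    refine Fin.cases ?_ (fun j => ?_) j <;> simp [Fin.removeNth]

/-- In lowest degree `θ a` has no argument to receive `c`, so the second term is absent. -/
theorem alternate₁_curryLeft_zero (θ : L →ₗ[ℝ] L [⋀^Fin 0]→ₗ[ℝ] W) (c : L) :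
    (alternate₁ θ).curryLeft c = θ c := by
  ext v
  simp only [AlternatingMap.curryLeft_apply_apply, AlternatingMap.alternatizeUncurryFinLM_apply,
    AlternatingMap.alternatizeUncurryFin_apply]
  simp [Matrix.vecCons]

end Alternation

/-! ### The Koszul differential and alternation -/

section Differential

variable {L : Type*} [LieRing L] [LieAlgebra ℝ L] {W : Type*} [AddCommGroup W] [Module ℝ W]
  {n : ℕ}

/-- Splits off the bracket part, expressed as the differential for the zero action, so that the two
parts can be treated separately. -/
theorem koszulDifferential_eq (D : L →ₗ[ℝ] Module.End ℝ W) (η : L [⋀^Fin n]→ₗ[ℝ] W) :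
    koszulDifferential D n η = alternate₁ (koszulAction D η) + koszulDifferential 0 n η := by
  have : koszulAction (0 : L →ₗ[ℝ] Module.End ℝ W) η = 0 := by ext; simp [koszulAction]
  change _ = _ + (alternate₁ (koszulAction 0 η) + koszulBracketTerm η)
  rw [this, map_zero, zero_add]
  rfl

/-- The bracket of a Lie algebra as a bilinear map. -/
abbrev lieBilin (L : Type*) [LieRing L] [LieAlgebra ℝ L] : L →ₗ[ℝ] L →ₗ[ℝ] L :=
  LieModule.toEnd ℝ L L

theorem koszulDifferential_bracket_succ (η : L [⋀^Fin (n + 1)]→ₗ[ℝ] W) :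
    koszulDifferential 0 (n + 1) η =
      (-(1 / 2) : ℝ) • alternate₂ ((lieBilin L).compr₂ η.curryLeft) := by
  have : koszulAction (0 : L →ₗ[ℝ] Module.End ℝ W) η = 0 := by ext; simp [koszulAction]
  change alternate₁ (koszulAction 0 η) + koszulBracketTerm η = _
  rw [this, map_zero, zero_add]
  rfl

theorem koszulDifferential_bracket_zero (η : L [⋀^Fin 0]→ₗ[ℝ] W) :
    koszulDifferential 0 0 η = 0 := by
  have : koszulAction (0 : L →ₗ[ℝ] Module.End ℝ W) η = 0 := by ext; simp [koszulAction]
  change alternate₁ (koszulAction 0 η) + 0 = _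
  rw [this, map_zero, add_zero]

/-- Thinking of the alternation of `θ` as a sum of products $e\wedge\theta_e$ with one-forms $e$,
this is $d(e\wedge\theta_e)=de\wedge\theta_e-e\wedge d\theta_e$, where $de$ is minus the evaluation
on brackets. The factor `1 / 2` arises because `alternate₂` runs over ordered pairs. -/
theorem koszulDifferential_bracket_alternate₁ (θ : L →ₗ[ℝ] L [⋀^Fin n]→ₗ[ℝ] W) :
    koszulDifferential 0 (n + 1) (alternate₁ θ) =
      - alternate₁ (koszulDifferential 0 n ∘ₗ θ) -
        (1 / 2 : ℝ) • alternate₂ ((lieBilin L).compr₂ θ) := by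
  rw [koszulDifferential_bracket_succ]
  cases n with
  | zero =>
    have h1 : koszulDifferential 0 0 ∘ₗ θ = 0 := by
      ext a : 1; exact koszulDifferential_bracket_zero (θ a)
    have h2 : (alternate₁ θ).curryLeft = θ := LinearMap.ext (alternate₁_curryLeft_zero θ)
    rw [h1, map_zero, h2]
    module
  | succ n =>
    let ι : L →ₗ[ℝ] L →ₗ[ℝ] L [⋀^Fin n]→ₗ[ℝ] W := AlternatingMap.curryLeftLinearMap ∘ₗ θ
    let f : L →ₗ[ℝ] L →ₗ[ℝ] L →ₗ[ℝ] L [⋀^Fin n]→ₗ[ℝ] W := (lieBilin L).compr₂ ι.flip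
    have h2 : (alternate₁ θ).curryLeft = θ - alternate₁ ∘ₗ ι.flip :=
      LinearMap.ext (alternate₁_curryLeft θ)
    let g : L →ₗ[ℝ] L →ₗ[ℝ] L →ₗ[ℝ] L [⋀^Fin n]→ₗ[ℝ] W :=
      ((LinearMap.lflip (R₀ := ℝ)).toLinearMap ∘ₗ f).flip
    -- `f` sends `a, b, c` to the contraction of `θ c` with `⁅a, b⁆`, while differentiating each `θ
    -- a` produces the contraction of `θ a` with `⁅b, c⁆`, which is `g`. The two differ by a
    -- rotation.
    have hg : alternate₃ g = alternate₃ f := alternate₃_cyclic fun a b c => rfl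
    have h3 : koszulDifferential 0 (n + 1) ∘ₗ θ = (-(1 / 2) : ℝ) • (alternate₂ ∘ₗ g) := by
      ext a : 1
      exact koszulDifferential_bracket_succ (θ a)
    have h4 : (lieBilin L).compr₂ (alternate₁ θ).curryLeft =
        (lieBilin L).compr₂ θ - LinearMap.compRight ℝ alternate₁ ∘ₗ f := by
      rw [h2]
      rfl
    rw [h4, h3, map_sub, ← alternate₃_eq', map_smul, ← alternate₃_eq, hg]
    module

/-- The Koszul differential is an antiderivation with respect to alternation. -/
theorem koszulDifferential_alternate₁ (D : L →ₗ[ℝ] Module.End ℝ W)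
    (θ : L →ₗ[ℝ] L [⋀^Fin n]→ₗ[ℝ] W) :
    koszulDifferential D (n + 1) (alternate₁ θ) =
      - alternate₁ (koszulDifferential D n ∘ₗ θ) -
        (1 / 2 : ℝ) • alternate₂ ((lieBilin L).compr₂ θ) := by
  -- `h b a` is `D a` applied to `θ b`, with the slot of `θ` first. The action part of the left side
  -- has the two slots in the opposite order; exchanging them gives the sign of the antiderivation
  -- rule.
  let h : L →ₗ[ℝ] L →ₗ[ℝ] L [⋀^Fin n]→ₗ[ℝ] W :=
    LinearMap.mk₂ ℝ (fun b a => koszulAction D (θ b) a)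
      (fun b b' a => by ext v; simp [koszulAction]) (fun c b a => by ext v; simp [koszulAction])
      (fun b a a' => map_add _ _ _) (fun c b a => map_smul _ _ _)
  have h1 : koszulAction D (alternate₁ θ) = alternate₁ ∘ₗ h.flip := by
    ext a v
    simp [koszulAction, AlternatingMap.alternatizeUncurryFin_apply, h]
  have h2 : koszulDifferential D n ∘ₗ θ = alternate₁ ∘ₗ h + koszulDifferential 0 n ∘ₗ θ := by
    ext a : 1
    exact koszulDifferential_eq D (θ a)
  rw [koszulDifferential_eq, koszulDifferential_bracket_alternate₁, h1, ← alternate₂_eq,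
    alternate₂_flip, h2, map_add, ← alternate₂_eq]
  abel

/-- An equivariant map of coefficients is a cochain map, since it passes through every term of the
Koszul formula. It serves for left multiplication (with zero actions), for the trace and for the
integral over the unit interval. -/
theorem koszulDifferential_compAlternatingMap {W' : Type*} [AddCommGroup W'] [Module ℝ W']
    {D : L →ₗ[ℝ] Module.End ℝ W} {D' : L →ₗ[ℝ] Module.End ℝ W'} (T : W →ₗ[ℝ] W')
    (hT : ∀ a w, T (D a w) = D' a (T w)) (η : L [⋀^Fin n]→ₗ[ℝ] W) :
    koszulDifferential D' n (T.compAlternatingMap η) =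
      T.compAlternatingMap (koszulDifferential D n η) := by
  ext a
  cases n with
  | zero => simp only [koszulDifferential_zero_apply, LinearMap.compAlternatingMap_apply, hT]
  | succ n =>
    simp only [koszulDifferential_apply, LinearMap.compAlternatingMap_apply, map_add, map_sum,
      map_smul, hT]

end Differential

/-! ### Products with an algebra-valued two-form -/

section Wedge

variable {L : Type*} [LieRing L] [LieAlgebra ℝ L] {B : Type*} [Ring B] [Algebra ℝ B] {n : ℕ}

/-- Left multiplication of forms by elements of the algebra of coefficients. -/
def formSMul (B : Type*) [Ring B] [Algebra ℝ B] (n : ℕ) :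
    B →ₗ[ℝ] (L [⋀^Fin n]→ₗ[ℝ] B) →ₗ[ℝ] L [⋀^Fin n]→ₗ[ℝ] B :=
  LinearMap.mk₂ ℝ (fun b η => (LinearMap.mulLeft ℝ b).compAlternatingMap η)
    (fun b b' η => by ext v; simp [add_mul]) (fun c b η => by ext v; simp)
    (fun b η η' => by ext v; simp) (fun c b η => by ext v; simp)

@[simp] theorem formSMul_apply (b : B) (η : L [⋀^Fin n]→ₗ[ℝ] B) (v : Fin n → L) :
    formSMul B n b η v = b * η v := rfl

/-- The product of a bilinear map `K`, alternated, with a form, up to normalization. -/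
def bilinWedge (K : L →ₗ[ℝ] L →ₗ[ℝ] B) (η : L [⋀^Fin n]→ₗ[ℝ] B) : L [⋀^Fin (n + 2)]→ₗ[ℝ] B :=
  alternate₂ (K.compr₂ ((formSMul B n).flip η))

variable {D : L →ₗ[ℝ] Module.End ℝ B} {K : L →ₗ[ℝ] L →ₗ[ℝ] B}

/-- The Leibniz rule for the differential of the product of an element of the algebra of
coefficients with a form. -/
theorem koszulDifferential_formSMul (hD : ∀ a x y, D a (x * y) = D a x * y + x * D a y) (b : B)
    (η : L [⋀^Fin n]→ₗ[ℝ] B) :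
    koszulDifferential D n (formSMul B n b η) =
      alternate₁ ((formSMul B n).flip η ∘ₗ D.flip b) +
        formSMul B (n + 1) b (koszulDifferential D n η) := by
  have h1 : koszulAction D (formSMul B n b η) =
      (formSMul B n).flip η ∘ₗ D.flip b + formSMul B n b ∘ₗ koszulAction D η := by
    ext a v
    simp [koszulAction, hD]
  have h2 : koszulDifferential 0 n (formSMul B n b η) =
      formSMul B (n + 1) b (koszulDifferential 0 n η) :=
    koszulDifferential_compAlternatingMap (LinearMap.mulLeft ℝ b) (by simp) η
  have h3 : alternate₁ (formSMul B n b ∘ₗ koszulAction D η) =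
      formSMul B (n + 1) b (alternate₁ (koszulAction D η)) := by
    ext v
    simp only [AlternatingMap.alternatizeUncurryFinLM_apply,
      AlternatingMap.alternatizeUncurryFin_apply, LinearMap.comp_apply, formSMul_apply,
      Finset.mul_sum, mul_smul_comm]
  rw [koszulDifferential_eq, koszulDifferential_eq D η, h1, h2, map_add, h3, map_add]
  abel

/-- Multiplication by a bilinear map satisfying the Bianchi identity commutes with the
differential. -/
theorem koszulDifferential_bilinWedge (hD : ∀ a x y, D a (x * y) = D a x * y + x * D a y)
    (hK : ∀ a b, K b a = - K a b)
    (bianchi : ∀ a b c, D a (K b c) + D b (K c a) + D c (K a b) =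
      K ⁅a, b⁆ c + K ⁅b, c⁆ a + K ⁅c, a⁆ b) (η : L [⋀^Fin n]→ₗ[ℝ] B) :
    koszulDifferential D (n + 2) (bilinWedge K η) = bilinWedge K (koszulDifferential D n η) := by
  let m : B →ₗ[ℝ] L [⋀^Fin n]→ₗ[ℝ] B := (formSMul B n).flip η
  let f₁ : L →ₗ[ℝ] L →ₗ[ℝ] L →ₗ[ℝ] B := K.compr₂ D.flip
  let f₂ : L →ₗ[ℝ] L →ₗ[ℝ] L →ₗ[ℝ] B :=
    -- This is the map `a, b, c ↦ K a ⁅b, c⁆`. Up to factors, `f₁`, `f₂` and `f₃` are the three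
    -- kinds of terms in the differential of `K`.
    LinearMap.lcomp ℝ (L →ₗ[ℝ] B) (lieBilin L) ∘ₗ LinearMap.llcomp ℝ L L B ∘ₗ K
  let f₃ : L →ₗ[ℝ] L →ₗ[ℝ] L →ₗ[ℝ] B := (lieBilin L).compr₂ K
  let T : (L →ₗ[ℝ] L →ₗ[ℝ] L →ₗ[ℝ] B) →ₗ[ℝ] L →ₗ[ℝ] L →ₗ[ℝ] L →ₗ[ℝ] L [⋀^Fin n]→ₗ[ℝ] B :=
    LinearMap.compRight ℝ (LinearMap.compRight ℝ (LinearMap.compRight ℝ m))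
  -- The cyclic sum of this combination is the difference of the two sides of `bianchi`:
  -- skew-symmetry turns `K a ⁅b, c⁆` into `-K ⁅b, c⁆ a`, so the halves from `f₂` and `f₃` add up to
  -- the whole bracket terms.
  have h0 : alternate₃ (T (f₁ + (1 / 2 : ℝ) • f₂ - (1 / 2 : ℝ) • f₃)) = 0 := by
    refine alternate₃_eq_zero_of_cyclic_sum fun a b c => ?_
    have h : ∀ a b c, T (f₁ + (1 / 2 : ℝ) • f₂ - (1 / 2 : ℝ) • f₃) a b c =
        m (D c (K a b) + (1 / 2 : ℝ) • K a ⁅b, c⁆ - (1 / 2 : ℝ) • K ⁅a, b⁆ c) := fun _ _ _ => rfl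
    have h' := bianchi a b c
    rw [h, h, h, ← map_add, ← map_add, hK ⁅b, c⁆ a, hK ⁅c, a⁆ b, hK ⁅a, b⁆ c]
    have : ∀ x y z u v w : B, x + y + z = u + v + w →
        (z + (1 / 2 : ℝ) • -v - (1 / 2 : ℝ) • u) + (x + (1 / 2 : ℝ) • -w - (1 / 2 : ℝ) • v) +
          (y + (1 / 2 : ℝ) • -u - (1 / 2 : ℝ) • w) = 0 := by
      intro x y z u v w h
      rw [← sub_eq_zero] at h
      rw [← h]
      module
    rw [this _ _ _ _ _ _ h', map_zero]
  -- The antiderivation rule is applied twice, once for each slot of `K`. Here the first slot is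
  -- frozen at `a` and the second is treated; the Leibniz rule separates the derivative of `K a b`
  -- from that of `η`.
  have h1 : koszulDifferential D (n + 1) ∘ₗ alternate₁ ∘ₗ K.compr₂ m =
      - (alternate₂ ∘ₗ T f₁) - alternate₁ ∘ₗ
        K.compr₂ ((formSMul B (n + 1)).flip (koszulDifferential D n η)) -
        (1 / 2 : ℝ) • (alternate₂ ∘ₗ T f₂) := by
    ext a : 1
    have h2 : koszulDifferential D n ∘ₗ K.compr₂ m a = alternate₁ ∘ₗ T f₁ a +
        K.compr₂ ((formSMul B (n + 1)).flip (koszulDifferential D n η)) a := by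
      ext b : 1
      exact koszulDifferential_formSMul hD (K a b) η
    refine (koszulDifferential_alternate₁ D (K.compr₂ m a)).trans ?_
    rw [h2, map_add, neg_add, ← sub_eq_add_neg]
    rfl
  rw [bilinWedge, alternate₂_eq, koszulDifferential_alternate₁, h1]
  have h3 : alternate₂ ((lieBilin L).compr₂ (alternate₁ ∘ₗ K.compr₂ m)) = alternate₃ (T f₃) := rfl
  rw [h3, map_sub, map_sub, map_neg, map_smul, ← alternate₃_eq, ← alternate₃_eq, ← alternate₂_eq]
  simp only [map_add, map_sub, map_smul] at h0
  rw [bilinWedge, ← sub_eq_zero, ← h0]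
  abel

end Wedge

/-! ### Powers of a two-form and their closedness -/

section Power

/-- Laplace expansion of the alternatization of a multilinear map along its first argument. -/
theorem MultilinearMap.alternatization_apply_succ {R L W : Type*} [CommRing R] [AddCommGroup L]
    [Module R L] [AddCommGroup W] [Module R W] {n : ℕ}
    (m : MultilinearMap R (fun _ : Fin (n + 1) => L) W) (v : Fin (n + 1) → L) :
    MultilinearMap.alternatization m v = ∑ i : Fin (n + 1), (-1 : ℤ) ^ (i : ℕ) •
      MultilinearMap.alternatization (m.curryLeft (v i)) (i.removeNth v) := by
  -- The permutation attached to `(i, σ)` sends `0` to `i` and `j + 1` to `i.succAbove (σ j)`. Its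
  -- sign is $(-1)^i\,\mathrm{sgn}\,\sigma$, the cycle `i.cycleRange` having sign $(-1)^i$.
  let e : Fin (n + 1) × Equiv.Perm (Fin n) → Equiv.Perm (Fin (n + 1)) := fun q =>
    q.1.cycleRange⁻¹ * Equiv.Perm.decomposeFin.symm (0, q.2)
  have h0 : ∀ q, e q 0 = q.1 := fun q => by
    simp [e, Equiv.Perm.inv_def, Fin.cycleRange_symm_zero]
  have hs : ∀ q j, e q (Fin.succ j) = q.1.succAbove (q.2 j) := fun q j => by
    simp [e, Equiv.Perm.inv_def]
  have hsign : ∀ q, (Equiv.Perm.sign (e q) : ℤ) = (-1) ^ (q.1 : ℕ) * Equiv.Perm.sign q.2 := by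
    intro q
    simp [e]
  have he : Function.Bijective e := by
    rw [Fintype.bijective_iff_injective_and_card]
    refine ⟨fun q r h => ?_, by simp [Fintype.card_perm, Nat.factorial_succ]⟩
    have h1 : q.1 = r.1 := by rw [← h0 q, ← h0 r, h]
    refine Prod.ext h1 (Equiv.ext fun j => ?_)
    have h2 := hs q j
    rw [h, hs r j, h1] at h2
    exact (Fin.succAbove_right_injective h2).symm
  rw [MultilinearMap.alternatization_apply, ← he.sum_comp, Fintype.sum_prod_type]
  refine Finset.sum_congr rfl fun i _ => ?_
  rw [MultilinearMap.alternatization_apply, Finset.smul_sum]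
  refine Finset.sum_congr rfl fun σ _ => ?_
  rw [Units.smul_def, Units.smul_def, hsign, mul_smul]
  congr 2
  simp only [MultilinearMap.domDomCongr_apply, MultilinearMap.curryLeft_apply]
  congr 1
  funext j
  refine Fin.cases ?_ (fun j => ?_) j
  · simp [h0]
  · simp [hs, Fin.removeNth]

variable {L : Type*} [LieRing L] [LieAlgebra ℝ L] {B : Type*} [Ring B] [Algebra ℝ B]

theorem pairProduct_succ (K : L →ₗ[ℝ] L →ₗ[ℝ] B) (p : ℕ) (x y : L) (a : Fin (2 * p) → L) :
    pairProduct K (p + 1) (Fin.cons x (Fin.cons y a) : Fin (2 * p + 1 + 1) → L) =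
      K x y * pairProduct K p a := by
  change (List.ofFn _).prod = _ * (List.ofFn _).prod
  rw [List.ofFn_succ, List.prod_cons]
  rfl

theorem alternatingPower_zero (K : L →ₗ[ℝ] L →ₗ[ℝ] B) (a : Fin (2 * 0) → L) :
    alternatingPower K 0 a = 1 := by
  rw [alternatingPower_apply]
  simp

/-- Expanding the alternatization along its first two arguments peels off the first factor `K x y`
and leaves the alternatization of the remaining `p` factors; the `1 / 2` is the ratio of the
normalizations $2^{-(p+1)}$ and $2^{-p}$. This makes induction on `p` possible. -/
theorem alternatingPower_succ (K : L →ₗ[ℝ] L →ₗ[ℝ] B) (p : ℕ) :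
    alternatingPower K (p + 1) = (1 / 2 : ℝ) • bilinWedge K (alternatingPower K p) := by
  have h : MultilinearMap.alternatization
      (show MultilinearMap ℝ (fun _ : Fin (2 * p + 1 + 1) => L) B from pairProduct K (p + 1)) =
      alternate₂ (K.compr₂ ((formSMul B (2 * p)).flip
        (MultilinearMap.alternatization (pairProduct K p)))) := by
    ext a
    rw [MultilinearMap.alternatization_apply_succ, alternate₂_eq,
      AlternatingMap.alternatizeUncurryFinLM_apply, AlternatingMap.alternatizeUncurryFin_apply]
    refine Finset.sum_congr rfl fun i _ => congrArg _ ?_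
    rw [MultilinearMap.alternatization_apply_succ, LinearMap.comp_apply,
      AlternatingMap.alternatizeUncurryFinLM_apply, AlternatingMap.alternatizeUncurryFin_apply]
    refine Finset.sum_congr rfl fun j _ => congrArg _ ?_
    rw [LinearMap.compr₂_apply, LinearMap.flip_apply, formSMul_apply,
      MultilinearMap.alternatization_apply, MultilinearMap.alternatization_apply, Finset.mul_sum]
    refine Finset.sum_congr rfl fun σ _ => ?_
    rw [mul_smul_comm]
    exact congrArg _ (pairProduct_succ K p _ _ _)
  have h' : (formSMul B (2 * p)).flip (alternatingPower K p) = (1 / 2 ^ p : ℝ) •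
      (formSMul B (2 * p)).flip (MultilinearMap.alternatization (pairProduct K p)) :=
    map_smul (formSMul B (2 * p)).flip _ _
  have h'' : K.compr₂ ((formSMul B (2 * p)).flip (alternatingPower K p)) = (1 / 2 ^ p : ℝ) •
      K.compr₂ ((formSMul B (2 * p)).flip (MultilinearMap.alternatization (pairProduct K p))) := by
    rw [h']
    rfl
  rw [bilinWedge, h'', map_smul, ← h, smul_smul,
    show (1 / 2 * (1 / 2 ^ p) : ℝ) = 1 / 2 ^ (p + 1) by rw [pow_succ']; ring]
  rfl

/-- Since multiplication by `K` commutes with the differential, closedness passes from $K^p$ to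
$K^{p+1}$. The induction starts at the constant form `1`. -/
theorem koszulDifferential_alternatingPower {D : L →ₗ[ℝ] Module.End ℝ B} {K : L →ₗ[ℝ] L →ₗ[ℝ] B}
    (hD : ∀ a x y, D a (x * y) = D a x * y + x * D a y)
    (hK : ∀ a b, K b a = - K a b)
    (bianchi : ∀ a b c, D a (K b c) + D b (K c a) + D c (K a b) =
      K ⁅a, b⁆ c + K ⁅b, c⁆ a + K ⁅c, a⁆ b) (p : ℕ) :
    koszulDifferential D (2 * p) (alternatingPower K p) = 0 := by
  induction p with
  | zero =>
    ext a
    refine (koszulDifferential_zero_apply D _ a).trans ?_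
    -- A derivation kills the unit: this reads $D(1)=D(1)+D(1)$.
    have h := hD (a 0) 1 1
    rw [alternatingPower_zero]
    simpa using h
  | succ p ih =>
    rw [alternatingPower_succ]
    refine ((koszulDifferential D (2 * p + 2)).map_smul _ _).trans ?_
    rw [koszulDifferential_bilinWedge hD hK bianchi, ih]
    have h : K.compr₂ ((formSMul B (2 * p + 1)).flip (0 : L [⋀^Fin (2 * p + 1)]→ₗ[ℝ] B)) = 0 := by
      ext; simp
    rw [bilinWedge, h, map_zero, smul_zero]

end Power

/-! ### The induced connection on endomorphisms and the Bianchi identity -/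

namespace RLinearConnection

variable {L : Type*} [LieRing L] [LieAlgebra ℝ L] {R : Type*} [CommRing R] [Algebra ℝ R]
  {δ : L →ₗ⁅ℝ⁆ Derivation ℝ R R} {W : Type*} [AddCommGroup W]
  [Module ℝ W] [Module R W] [IsScalarTower ℝ R W]

/-- The connection induced on endomorphisms, `φ ↦ ∇_a ∘ φ - φ ∘ ∇_a`. -/
def adjoint (D : RLinearConnection δ W) : L →ₗ[ℝ] Module.End ℝ (Module.End R W) :=
  LinearMap.mk₂ ℝ
    (fun a φ =>
      { toFun := fun w => D a (φ w) - φ (D a w)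
        map_add' := fun v w => by simp only [map_add]; abel
        map_smul' := fun f w => by
          simp only [D.leibniz, map_add, map_smul, RingHom.id_apply, smul_sub]
          abel })
    (fun a a' φ => by ext w; simp; abel)
    (fun c a φ => by ext w; simp [smul_sub, LinearMap.map_smul_of_tower])
    (fun a φ ψ => by ext w; simp; abel)
    (fun c a φ => by ext w; simp [smul_sub])

@[simp] theorem adjoint_apply (D : RLinearConnection δ W) (a : L) (φ : Module.End R W) (w : W) :
    D.adjoint a φ w = D a (φ w) - φ (D a w) := rfl

theorem adjoint_mul (D : RLinearConnection δ W) (a : L) (φ ψ : Module.End R W) :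
    D.adjoint a (φ * ψ) = D.adjoint a φ * ψ + φ * D.adjoint a ψ := by
  ext w
  simp

theorem curvature_skew (D : RLinearConnection δ W) (a b : L) :
    D.curvature b a = - D.curvature a b := by
  ext w
  simp only [curvature_apply, LinearMap.neg_apply]
  rw [← lie_skew a b, map_neg, LinearMap.neg_apply]
  abel

/-- The Bianchi identity. -/
theorem bianchi (D : RLinearConnection δ W) (a b c : L) :
    D.adjoint a (D.curvature b c) + D.adjoint b (D.curvature c a) + D.adjoint c (D.curvature a b) =
      D.curvature ⁅a, b⁆ c + D.curvature ⁅b, c⁆ a + D.curvature ⁅c, a⁆ b := by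
  ext w
  -- Only the operators attached to double brackets need the Jacobi identity of `L`. The triple
  -- compositions of operators cancel as in the Jacobi identity for commutators, and the remaining
  -- terms agree on both sides.
  have h : D ⁅⁅a, b⁆, c⁆ w + D ⁅⁅b, c⁆, a⁆ w + D ⁅⁅c, a⁆, b⁆ w = 0 := by
    have h1 : ⁅⁅a, b⁆, c⁆ + ⁅⁅b, c⁆, a⁆ + ⁅⁅c, a⁆, b⁆ = 0 := by
      have := lie_jacobi a b c
      rw [← lie_skew ⁅a, b⁆ c, ← lie_skew ⁅b, c⁆ a, ← lie_skew ⁅c, a⁆ b, ← neg_eq_zero, ← this]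
      abel
    rw [← LinearMap.add_apply, ← LinearMap.add_apply, ← map_add, ← map_add, h1, map_zero,
      LinearMap.zero_apply]
  simp only [LinearMap.add_apply, adjoint_apply, curvature_apply, map_sub]
  rw [← sub_eq_zero, ← h]
  abel

theorem koszulDifferential_alternatingPower_curvature (D : RLinearConnection δ W) (p : ℕ) :
    koszulDifferential D.adjoint (2 * p) (alternatingPower D.curvature p) = 0 :=
  koszulDifferential_alternatingPower D.adjoint_mul D.curvature_skew D.bianchi p

end RLinearConnection

/-! ### Compatibility of the trace with connections; closedness of the Chern forms -/

section Trace

variable {E : Type*} [NormedAddCommGroup E] [NormedSpace ℝ E] [FiniteDimensional ℝ E]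
  {H : Type*} [TopologicalSpace H] {I : ModelWithCorners ℝ E H}
  {N : Type*} [TopologicalSpace N] [ChartedSpace H N] [IsManifold I ∞ N] [T2Space N]
  {F : Type*} [NormedAddCommGroup F] [NormedSpace ℝ F] [FiniteDimensional ℝ F]
  {V : N → Type*} [TopologicalSpace (TotalSpace F V)] [∀ x, AddCommGroup (V x)]
  [∀ x, Module ℝ (V x)] [∀ x, TopologicalSpace (V x)] [FiberBundle F V] [VectorBundle ℝ F V]
  [ContMDiffVectorBundle ∞ F V I]

/-- The value at `x` of a `C^∞`-linear map from sections to smooth functions. -/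
theorem exists_fibre_functional (c : Cₛ^∞⟮I; F, V⟯ →ₗ[C^∞⟮I, N; 𝓘(ℝ, ℝ), ℝ⟯] C^∞⟮I, N; 𝓘(ℝ, ℝ), ℝ⟯)
    (x : N) : ∃ ℓ : V x →ₗ[ℝ] ℝ, ∀ σ, c σ x = ℓ (σ x) := by
  obtain ⟨r, χ, s, k, hχ, hk, h⟩ := exists_cutoff_frame (F := F) (V := V) I x
  refine ⟨∑ i, c (s i) x • k i x, fun σ => ?_⟩
  have h1 := congrArg (fun τ => c τ x) (cutoff_frame_sections hk h σ)
  simp only [map_smul, map_sum] at h1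
  have h2 : ∀ (g : Fin r → C^∞⟮I, N; 𝓘(ℝ, ℝ), ℝ⟯), (∑ i, g i) x = ∑ i, g i x := fun g =>
    map_sum (ContMDiffMap.evalRingHom x) _ _
  rw [h2] at h1
  have h3 : χ x * c σ x = ∑ i, k i x (σ x) * c (s i) x := h1
  rw [hχ.self_of_nhds, one_mul] at h3
  rw [h3, LinearMap.sum_apply]
  exact Finset.sum_congr rfl fun i _ => mul_comm _ _

/-- The functional `c` acts pointwise, so in each fibre this is the trace of a rank-one
endomorphism. -/
theorem smoothTrace_smulRight
    (c : Cₛ^∞⟮I; F, V⟯ →ₗ[C^∞⟮I, N; 𝓘(ℝ, ℝ), ℝ⟯] C^∞⟮I, N; 𝓘(ℝ, ℝ), ℝ⟯) (s : Cₛ^∞⟮I; F, V⟯) :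
    smoothTrace (c.smulRight s) = c s := by
  ext x
  obtain ⟨ℓ, hℓ⟩ := exists_fibre_functional c x
  have : FiniteDimensional ℝ (V x) := VectorBundle.finiteDimensional ℝ F V x
  have h : fibreEnd (c.smulRight s) x = ℓ.smulRight (s x) := by
    ext v
    obtain ⟨ε, hε⟩ := exists_section_extension (F := F) (V := V) I x
    rw [← hε v, fibreEnd_apply, LinearMap.smulRight_apply, LinearMap.smulRight_apply,
      ContMDiffSection.smooth_smul_apply, hℓ]
  rw [smoothTrace_apply, h, LinearMap.trace_smulRight, hℓ]

/-- After multiplication with a function that is `1` at a given point, endomorphisms of the module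
of sections are sums of endomorphisms of rank one. -/
theorem exists_smul_eq_sum_smulRight (x : N) :
    ∃ (r : ℕ) (χ : C^∞⟮I, N; 𝓘(ℝ, ℝ), ℝ⟯) (s : Fin r → Cₛ^∞⟮I; F, V⟯)
      (c : Fin r → Cₛ^∞⟮I; F, V⟯ →ₗ[C^∞⟮I, N; 𝓘(ℝ, ℝ), ℝ⟯] C^∞⟮I, N; 𝓘(ℝ, ℝ), ℝ⟯),
      χ x = 1 ∧ ∀ φ : Module.End C^∞⟮I, N; 𝓘(ℝ, ℝ), ℝ⟯ Cₛ^∞⟮I; F, V⟯,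
        χ • φ = ∑ i, (c i).smulRight (φ (s i)) := by
  obtain ⟨r, χ, s, k, hχ, hk, h⟩ := exists_cutoff_frame (F := F) (V := V) I x
  refine ⟨r, χ, s, fun i =>
    { toFun := fun σ => smoothFun (fun x => k i x (σ x)) ((hk i).comp σ.contMDiff)
      map_add' := fun σ τ => ContMDiffMap.ext fun x => (k i x).map_add _ _
      map_smul' := fun f σ => ContMDiffMap.ext fun x => (k i x).map_smul _ _ },
    hχ.self_of_nhds, fun φ => LinearMap.ext fun σ => ?_⟩
  have h1 := congrArg φ (cutoff_frame_sections hk h σ)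
  simp only [map_smul, map_sum] at h1
  rw [LinearMap.smul_apply, LinearMap.sum_apply, h1]
  rfl

variable {L : Type*} [LieRing L] [LieAlgebra ℝ L]
  {δ : L →ₗ⁅ℝ⁆ Derivation ℝ C^∞⟮I, N; 𝓘(ℝ, ℝ), ℝ⟯ C^∞⟮I, N; 𝓘(ℝ, ℝ), ℝ⟯}

/-- The defect $\varphi\mapsto\mathrm{Tr}(\nabla_a\varphi)-\delta_a\mathrm{Tr}\,\varphi$ is
$C^\infty$-linear, because both terms produce the same $\delta_a(f)\,\mathrm{Tr}\,\varphi$. It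
therefore suffices to see that it vanishes on rank-one endomorphisms, of which every endomorphism is
a sum after multiplication by a cut-off function. -/
theorem RLinearConnection.smoothTrace_adjoint (D : RLinearConnection δ Cₛ^∞⟮I; F, V⟯) (a : L)
    (φ : Module.End C^∞⟮I, N; 𝓘(ℝ, ℝ), ℝ⟯ Cₛ^∞⟮I; F, V⟯) :
    smoothTrace (D.adjoint a φ) = δ a (smoothTrace φ) := by
  have hsmul : ∀ (f : C^∞⟮I, N; 𝓘(ℝ, ℝ), ℝ⟯)
      (φ : Module.End C^∞⟮I, N; 𝓘(ℝ, ℝ), ℝ⟯ Cₛ^∞⟮I; F, V⟯),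
      smoothTrace (D.adjoint a (f • φ)) - δ a (smoothTrace (f • φ)) =
        f • (smoothTrace (D.adjoint a φ) - δ a (smoothTrace φ)) := by
    intro f φ
    have h1 : D.adjoint a (f • φ) = f • D.adjoint a φ + δ a f • φ := by
      ext1 σ
      simp only [adjoint_apply, LinearMap.smul_apply, LinearMap.add_apply, D.leibniz, smul_sub]
      abel
    rw [h1, map_add, map_smul, map_smul, map_smul, smul_eq_mul f (smoothTrace φ),
      Derivation.leibniz, smul_sub, smul_eq_mul (smoothTrace φ), smul_eq_mul (δ a f),
      mul_comm (smoothTrace φ)]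
    abel
  have hrank : ∀ (c : Cₛ^∞⟮I; F, V⟯ →ₗ[C^∞⟮I, N; 𝓘(ℝ, ℝ), ℝ⟯] C^∞⟮I, N; 𝓘(ℝ, ℝ), ℝ⟯)
      (s : Cₛ^∞⟮I; F, V⟯),
      smoothTrace (D.adjoint a (c.smulRight s)) = δ a (smoothTrace (c.smulRight s)) := by
    intro c s
    -- The dual connection applied to `c`. The derivative of $c\otimes s$ is then $c\otimes\nabla_a
    -- s+\nabla_a^*c\otimes s$, whose trace is $\delta_a(c(s))$.
    let c' : Cₛ^∞⟮I; F, V⟯ →ₗ[C^∞⟮I, N; 𝓘(ℝ, ℝ), ℝ⟯] C^∞⟮I, N; 𝓘(ℝ, ℝ), ℝ⟯ :=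
      { toFun := fun σ => δ a (c σ) - c (D a σ)
        map_add' := fun σ τ => by simp only [map_add]; abel
        map_smul' := fun f σ => by
          simp only [D.leibniz, map_add, map_smul, RingHom.id_apply, smul_eq_mul,
            Derivation.leibniz]
          ring }
    have h1 : D.adjoint a (c.smulRight s) = c.smulRight (D a s) + c'.smulRight s := by
      ext1 σ
      simp only [adjoint_apply, LinearMap.smulRight_apply, LinearMap.add_apply, D.leibniz]
      change _ = _ + (δ a (c σ) - c (D a σ)) • s
      rw [sub_smul]
      abel
    rw [h1, map_add, smoothTrace_smulRight, smoothTrace_smulRight, smoothTrace_smulRight]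
    change c (D a s) + (δ a (c s) - c (D a s)) = _
    abel
  ext x
  obtain ⟨r, χ, s, c, hχ, h⟩ := exists_smul_eq_sum_smulRight (I := I) (F := F) (V := V) x
  have h1 := hsmul χ φ
  rw [h φ, map_sum, map_sum, map_sum, map_sum, ← Finset.sum_sub_distrib,
    Finset.sum_eq_zero fun i _ => sub_eq_zero.2 (hrank (c i) (φ (s i)))] at h1
  have h2 : 0 = χ x * (smoothTrace (D.adjoint a φ) x - δ a (smoothTrace φ) x) :=
    congrArg (fun f : C^∞⟮I, N; 𝓘(ℝ, ℝ), ℝ⟯ => f x) h1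
  rw [hχ, one_mul] at h2
  exact sub_eq_zero.1 h2.symm

/-- The Chern character forms are closed. -/
theorem RLinearConnection.koszulDifferential_chernForm (D : RLinearConnection δ Cₛ^∞⟮I; F, V⟯)
    {δ' : L →ₗ[ℝ] Module.End ℝ C^∞⟮I, N; 𝓘(ℝ, ℝ), ℝ⟯} (hδ : ∀ a f, δ' a f = δ a f) (p : ℕ) :
    koszulDifferential δ' (2 * p) (D.chernForm p) = 0 := by
  refine (koszulDifferential_compAlternatingMap (smoothTrace.restrictScalars ℝ)
    (D := D.adjoint) (fun a φ => ?_) _).trans ?_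
  · rw [hδ]
    exact D.smoothTrace_adjoint a φ
  · rw [D.koszulDifferential_alternatingPower_curvature p]
    ext
    simp

end Trace

/-! ### Contraction with a central element and pullback of forms -/

section Cartan

variable {L : Type*} [LieRing L] [LieAlgebra ℝ L] {W : Type*} [AddCommGroup W] [Module ℝ W]
  {n : ℕ}

theorem AlternatingMap.curryLeft_swap {L W : Type*} [AddCommGroup L] [Module ℝ L] [AddCommGroup W]
    [Module ℝ W] {n : ℕ} (η : L [⋀^Fin (n + 2)]→ₗ[ℝ] W) (a b : L) :
    (η.curryLeft a).curryLeft b = - (η.curryLeft b).curryLeft a := by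
  have h : (η.curryLeft (a + b)).curryLeft (a + b) = 0 := AlternatingMap.curryLeft_same η _
  simp only [map_add, AlternatingMap.curryLeft_add, LinearMap.add_apply,
    AlternatingMap.curryLeft_same, zero_add, add_zero] at h
  exact eq_neg_of_add_eq_zero_right h

/-- Cartan's formula for the contraction of a differential with a central element. -/
theorem koszulDifferential_curryLeft_of_central (D : L →ₗ[ℝ] Module.End ℝ W)
    (η : L [⋀^Fin (n + 2)]→ₗ[ℝ] W) {c : L} (hc : ∀ a : L, ⁅c, a⁆ = 0) :
    (koszulDifferential D (n + 2) η).curryLeft c =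
      (D c).compAlternatingMap η - koszulDifferential D (n + 1) (η.curryLeft c) := by
  have hc' : ∀ a : L, ⁅a, c⁆ = 0 := fun a => by rw [← lie_skew, hc, neg_zero]
  let f : L →ₗ[ℝ] L →ₗ[ℝ] L [⋀^Fin (n + 1)]→ₗ[ℝ] W := (lieBilin L).compr₂ η.curryLeft
  let ι : (L [⋀^Fin (n + 1)]→ₗ[ℝ] W) →ₗ[ℝ] L [⋀^Fin n]→ₗ[ℝ] W :=
    LinearMap.applyₗ c ∘ₗ AlternatingMap.curryLeftLinearMap
  -- The terms in which `c` enters the bracket vanish by centrality. In the others the contraction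
  -- passes two alternated slots, and the two signs cancel.
  have h1 : (alternate₂ f).curryLeft c = alternate₂ (f.compr₂ ι) := by
    have hf : ∀ b, (alternate₁ (f b)).curryLeft c = - alternate₁ (ι ∘ₗ f b) := fun b => by
      refine (alternate₁_curryLeft (f b) c).trans ?_
      have : f b c = 0 := by
        change η.curryLeft ⁅b, c⁆ = 0
        rw [hc', map_zero]
      rw [this, zero_sub]
    have hfc : f c = 0 := by
      ext1 b
      change η.curryLeft ⁅c, b⁆ = 0
      rw [hc, map_zero]
    rw [alternate₂_eq, alternate₁_curryLeft, LinearMap.comp_apply, hfc, map_zero, zero_sub,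
      alternate₂_eq, ← map_neg]
    congr 1
    ext1 b
    exact (congrArg Neg.neg (hf b)).trans (neg_neg _)
  -- The sign comes from exchanging `c` and the bracket as the first two arguments of `η`.
  have h2 : (koszulDifferential 0 (n + 2) η).curryLeft c =
      - koszulDifferential 0 (n + 1) (η.curryLeft c) := by
    have hf : f.compr₂ ι = - (lieBilin L).compr₂ (η.curryLeft c).curryLeft := by
      ext1 a; ext1 b
      exact AlternatingMap.curryLeft_swap η _ _
    rw [koszulDifferential_bracket_succ, koszulDifferential_bracket_succ,
      AlternatingMap.curryLeft_smul, LinearMap.smul_apply, h1, hf, map_neg, smul_neg]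
  have h3 : (LinearMap.applyₗ c ∘ₗ AlternatingMap.curryLeftLinearMap) ∘ₗ koszulAction D η =
      koszulAction D (η.curryLeft c) := by
    ext a v
    rfl
  rw [koszulDifferential_eq, koszulDifferential_eq D (η.curryLeft c), AlternatingMap.curryLeft_add,
    LinearMap.add_apply, h2, alternate₁_curryLeft, h3]
  change (D c).compAlternatingMap η - _ + _ = _
  abel

/-- Cochains pull back along homomorphisms of Lie algebras compatible with the actions. It is used
for the inclusion of $\Gamma(A)$ into $\mathbb R\,\partial_t\oplus\Gamma(A)$. -/
theorem koszulDifferential_compLinearMap {L' : Type*} [LieRing L'] [LieAlgebra ℝ L']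
    (D : L →ₗ[ℝ] Module.End ℝ W) {D' : L' →ₗ[ℝ] Module.End ℝ W} (φ : L' →ₗ[ℝ] L)
    (hφ : ∀ a b, φ ⁅a, b⁆ = ⁅φ a, φ b⁆) (hD : ∀ a, D' a = D (φ a))
    (η : L [⋀^Fin (n + 1)]→ₗ[ℝ] W) :
    koszulDifferential D' (n + 1) (η.compLinearMap φ) =
      (koszulDifferential D (n + 1) η).compLinearMap φ := by
  ext a
  simp only [AlternatingMap.compLinearMap_apply, koszulDifferential_apply, hD]
  congr 1
  refine Finset.sum_congr rfl fun i _ => Finset.sum_congr rfl fun j _ => ?_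
  congr 2
  funext k
  refine Fin.cases ?_ (fun k => ?_) k
  · exact hφ _ _
  · rfl

end Cartan

/-! ### Integration over the unit interval and differentiation -/

section Integral

/-- Dominated differentiation: on the product of $[0,1]$ with a small closed ball, compact because
`P` is proper, the continuous partial derivative is bounded, and a constant is integrable over
$[0,1]$. -/
theorem fderiv_integral_unit {P : Type*} [NormedAddCommGroup P] [NormedSpace ℝ P] [ProperSpace P]
    {s : Set P} (hs : IsOpen s) {G : ℝ × P → ℝ} (hG : ContDiffOn ℝ ∞ G (Set.univ ×ˢ s)) {y : P}
    (hy : y ∈ s) (v : P) :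
    fderiv ℝ (fun p => ∫ t in (0 : ℝ)..1, G (t, p)) y v =
      ∫ t in (0 : ℝ)..1, fderiv ℝ (fun p => G (t, p)) y v := by
  have ho : IsOpen (Set.univ ×ˢ s : Set (ℝ × P)) := isOpen_univ.prod hs
  obtain ⟨ε, hε, hball⟩ := Metric.nhds_basis_closedBall.mem_iff.1 (hs.mem_nhds hy)
  let F' : P → ℝ → P →L[ℝ] ℝ := fun p t => (fderiv ℝ G (t, p)).comp (ContinuousLinearMap.inr ℝ ℝ P)
  have hd : ∀ t, ∀ p ∈ s, HasFDerivAt (fun p => G (t, p)) (F' p t) p := fun t p hp =>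
    (((hG.contDiffAt (ho.mem_nhds ⟨trivial, hp⟩)).differentiableAt (by simp)).hasFDerivAt).comp p
      (hasFDerivAt_prodMk_right t p)
  have hc : ContinuousOn (fun q : ℝ × P => F' q.2 q.1) (Set.univ ×ˢ s) :=
    (hG.continuousOn_fderiv_of_isOpen ho (by simp)).clm_comp continuousOn_const
  have hslice : ∀ p ∈ s, Continuous fun t => G (t, p) := fun p hp => by
    rw [← continuousOn_univ]
    exact hG.continuousOn.comp (Continuous.prodMk_left p).continuousOn fun t _ => ⟨trivial, hp⟩
  have hslice' : Continuous (F' y) := by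
    rw [← continuousOn_univ]
    exact hc.comp (Continuous.prodMk_left y).continuousOn fun t _ => ⟨trivial, hy⟩
  obtain ⟨C, hC⟩ := ((isCompact_Icc (a := (0 : ℝ)) (b := 1)).prod
    (isCompact_closedBall y ε)).exists_bound_of_continuousOn
    (hc.mono (Set.prod_mono (Set.subset_univ _) hball))
  have key := intervalIntegral.hasFDerivAt_integral_of_dominated_of_fderiv_le (𝕜 := ℝ)
    (μ := MeasureTheory.volume) (a := 0) (b := 1) (F := fun p t => G (t, p)) (F' := F')
    (bound := fun _ => C) (Metric.closedBall_mem_nhds y hε)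
    (Filter.eventually_of_mem (hs.mem_nhds hy) fun p hp => (hslice p hp).aestronglyMeasurable)
    ((hslice y hy).intervalIntegrable 0 1) hslice'.aestronglyMeasurable
    (Filter.Eventually.of_forall fun t ht p hp => hC (t, p) ⟨by
      rw [Set.uIoc_of_le zero_le_one] at ht
      exact ⟨ht.1.le, ht.2⟩, hp⟩)
    (by simp) (Filter.Eventually.of_forall fun t _ p hp => hd t p (hball hp))
  rw [key.fderiv, ContinuousLinearMap.intervalIntegral_apply (hslice'.intervalIntegrable 0 1)]
  exact intervalIntegral.integral_congr fun t _ => by rw [(hd t y hy).fderiv]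

variable {n : ℕ} {M : Type*} [TopologicalSpace M]
  [ChartedSpace (EuclideanSpace ℝ (Fin n)) M] [IsManifold (𝓡 n) ∞ M]

theorem vectorFieldDerivation_eq_fderiv
    (X : Cₛ^∞⟮𝓡 n; EuclideanSpace ℝ (Fin n), (TangentSpace (𝓡 n) : M → Type _)⟯)
    (g : C^∞⟮𝓡 n, M; 𝓘(ℝ, ℝ), ℝ⟯) (x : M) :
    vectorFieldDerivation X g x = fderiv ℝ (fun y => g ((extChartAt (𝓡 n) x).symm y))
      (extChartAt (𝓡 n) x x) (X x : EuclideanSpace ℝ (Fin n)) := by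
  have h := (g.mdifferentiableAt (x := x)).mfderiv
  refine (congrArg (fun L => L (X x)) h).trans ?_
  change fderivWithin ℝ (fun y => g ((extChartAt (𝓡 n) x).symm y)) (Set.range (𝓡 n)) _ _ = _
  rw [ModelWithCorners.range_eq_univ, fderivWithin_univ]

/-- Integration over the unit interval commutes with vector fields on `M`. -/
theorem cylIntegral_vectorFieldDerivation
    (X : Cₛ^∞⟮𝓡 n; EuclideanSpace ℝ (Fin n), (TangentSpace (𝓡 n) : M → Type _)⟯)
    (f : C^∞⟮cylModel n, ℝ × M; 𝓘(ℝ, ℝ), ℝ⟯) :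
    cylIntegral (vectorFieldDerivation (cylField (0, X)) f) =
      vectorFieldDerivation X (cylIntegral f) := by
  ext x
  let φ := extChartAt (𝓡 n) x
  have h1 : ContMDiffOn 𝓘(ℝ, EuclideanSpace ℝ (Fin n)) (𝓡 n) ∞ φ.symm φ.target :=
    contMDiffOn_extChartAt_symm x
  have ho : IsOpen φ.target := isOpen_extChartAt_target x
  let G : ℝ × EuclideanSpace ℝ (Fin n) → ℝ := fun q => f (q.1, φ.symm q.2)
  have hG : ContDiffOn ℝ ∞ G (Set.univ ×ˢ φ.target) := by
    rintro ⟨s, y⟩ ⟨-, hy⟩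
    have h2 : ContMDiffAt 𝓘(ℝ, EuclideanSpace ℝ (Fin n)) (𝓡 n) ∞ φ.symm y :=
      h1.contMDiffAt (ho.mem_nhds hy)
    have h3 : ContMDiffAt (𝓘(ℝ, ℝ).prod 𝓘(ℝ, EuclideanSpace ℝ (Fin n))) (cylModel n) ∞
        (fun q : ℝ × EuclideanSpace ℝ (Fin n) => (q.1, φ.symm q.2)) (s, y) :=
      contMDiffAt_fst.prodMk (ContMDiffAt.comp (s, y) h2 contMDiffAt_snd)
    have h4 : ContMDiffAt (𝓘(ℝ, ℝ).prod 𝓘(ℝ, EuclideanSpace ℝ (Fin n))) 𝓘(ℝ, ℝ) ∞ G (s, y) :=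
      f.contMDiff.contMDiffAt.comp (s, y) h3
    rw [← modelWithCornersSelf_prod, chartedSpaceSelf_prod] at h4
    exact h4.contDiffAt.contDiffWithinAt
  rw [vectorFieldDerivation_eq_fderiv]
  refine Eq.trans ?_ (fderiv_integral_unit ho hG (mem_extChartAt_target x) _).symm
  rw [cylIntegral_apply]
  refine intervalIntegral.integral_congr fun t _ => ?_
  rw [cylField_derivation_apply, zero_mul, zero_add, vectorFieldDerivation_eq_fderiv]
  rfl

/-- The fundamental theorem of calculus in the time direction. -/
theorem cylIntegral_time_derivation (f : C^∞⟮cylModel n, ℝ × M; 𝓘(ℝ, ℝ), ℝ⟯) :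
    cylIntegral (vectorFieldDerivation (cylField (1, 0)) f) = cylSlice 1 f - cylSlice 0 f := by
  ext x
  have h : ContDiff ℝ ∞ fun s : ℝ => f (s, x) := by
    have h2 : ContMDiff 𝓘(ℝ, ℝ) 𝓘(ℝ, ℝ) ∞ (fun s : ℝ => f (s, x)) :=
      f.contMDiff.comp (contMDiff_id.prodMk contMDiff_const)
    exact h2.contDiff
  rw [cylIntegral_apply]
  simp only [cylField_derivation_time]
  exact intervalIntegral.integral_deriv_eq_sub (fun t _ => (h.differentiable (by simp)).differentiableAt)
    ((h.continuous_deriv (by simp)).intervalIntegrable 0 1)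

end Integral

/-! ### Restriction to time slices and the Chern–Simons transgression -/

section Transgression

variable {n : ℕ} {M : Type*} [TopologicalSpace M]
  [ChartedSpace (EuclideanSpace ℝ (Fin n)) M] [IsManifold (𝓡 n) ∞ M] [T2Space M]
  {FA : Type*} [NormedAddCommGroup FA] [NormedSpace ℝ FA] [FiniteDimensional ℝ FA]
  {A : M → Type*} [TopologicalSpace (TotalSpace FA A)] [∀ x, AddCommGroup (A x)]
  [∀ x, Module ℝ (A x)] [∀ x, TopologicalSpace (A x)] [FiberBundle FA A]
  [VectorBundle ℝ FA A] [ContMDiffVectorBundle ∞ FA A (𝓡 n)]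
  {F : Type*} [NormedAddCommGroup F] [NormedSpace ℝ F] [FiniteDimensional ℝ F]
  {V : M → Type*} [TopologicalSpace (TotalSpace F V)] [∀ x, AddCommGroup (V x)]
  [∀ x, Module ℝ (V x)] [∀ x, TopologicalSpace (V x)] [FiberBundle F V] [VectorBundle ℝ F V]
  [ContMDiffVectorBundle ∞ F V (𝓡 n)]

/-- An endomorphism `Φ` of the module of sections of `pr₂^* V` restricts to `φ` at time `t`. -/
def RestrictsTo (t : ℝ) (Φ : Module.End C^∞⟮cylModel n, ℝ × M; 𝓘(ℝ, ℝ), ℝ⟯ (CylSection n F V))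
    (φ : Module.End C^∞⟮𝓡 n, M; 𝓘(ℝ, ℝ), ℝ⟯ Cₛ^∞⟮𝓡 n; F, V⟯) : Prop :=
  ∀ σ, cylRestrict t (Φ σ) = φ (cylRestrict t σ)

namespace RestrictsTo

variable {t : ℝ} {Φ Ψ : Module.End C^∞⟮cylModel n, ℝ × M; 𝓘(ℝ, ℝ), ℝ⟯ (CylSection n F V)}
  {φ ψ : Module.End C^∞⟮𝓡 n, M; 𝓘(ℝ, ℝ), ℝ⟯ Cₛ^∞⟮𝓡 n; F, V⟯}

theorem mul (h : RestrictsTo t Φ φ) (h' : RestrictsTo t Ψ ψ) : RestrictsTo t (Φ * Ψ) (φ * ψ) :=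
  fun σ => (h (Ψ σ)).trans (congrArg φ (h' σ))

theorem add (h : RestrictsTo t Φ φ) (h' : RestrictsTo t Ψ ψ) : RestrictsTo t (Φ + Ψ) (φ + ψ) :=
  fun σ => congrArg₂ (fun a b : Cₛ^∞⟮𝓡 n; F, V⟯ => a + b) (h σ) (h' σ)

theorem zero : RestrictsTo t (0 : Module.End C^∞⟮cylModel n, ℝ × M; 𝓘(ℝ, ℝ), ℝ⟯ (CylSection n F V))
    0 := fun _ => rfl

theorem one : RestrictsTo t (1 : Module.End C^∞⟮cylModel n, ℝ × M; 𝓘(ℝ, ℝ), ℝ⟯ (CylSection n F V))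
    1 := fun _ => rfl

theorem smul (c : ℝ) (h : RestrictsTo t Φ φ) : RestrictsTo t (c • Φ) (c • φ) :=
  fun σ => congrArg (fun a : Cₛ^∞⟮𝓡 n; F, V⟯ => c • a) (h σ)

theorem sum {ι : Type*} {s : Finset ι}
    {Φ : ι → Module.End C^∞⟮cylModel n, ℝ × M; 𝓘(ℝ, ℝ), ℝ⟯ (CylSection n F V)}
    {φ : ι → Module.End C^∞⟮𝓡 n, M; 𝓘(ℝ, ℝ), ℝ⟯ Cₛ^∞⟮𝓡 n; F, V⟯}
    (h : ∀ i, RestrictsTo t (Φ i) (φ i)) : RestrictsTo t (∑ i ∈ s, Φ i) (∑ i ∈ s, φ i) := by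
  classical
  induction s using Finset.induction_on with
  | empty => exact zero
  | insert i s hi ih => rw [Finset.sum_insert hi, Finset.sum_insert hi]; exact (h i).add ih

theorem prod_ofFn : ∀ {p : ℕ}
    {Φ : Fin p → Module.End C^∞⟮cylModel n, ℝ × M; 𝓘(ℝ, ℝ), ℝ⟯ (CylSection n F V)}
    {φ : Fin p → Module.End C^∞⟮𝓡 n, M; 𝓘(ℝ, ℝ), ℝ⟯ Cₛ^∞⟮𝓡 n; F, V⟯}
    (_ : ∀ i, RestrictsTo t (Φ i) (φ i)), RestrictsTo t (List.ofFn Φ).prod (List.ofFn φ).prod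
  | 0, _, _, _ => by simpa using one
  | p + 1, _, _, h => by
    rw [List.ofFn_succ, List.ofFn_succ, List.prod_cons, List.prod_cons]
    exact (h 0).mul (prod_ofFn fun i => h i.succ)

/-- The fibre of the pullback bundle at $(t,x)$ is `V x` itself, and the two fibre endomorphisms
coincide there, so their traces do too. -/
theorem cylSlice_smoothTrace (h : RestrictsTo t Φ φ) :
    cylSlice t (smoothTrace Φ) = smoothTrace φ := by
  ext x
  rw [cylSlice_apply, smoothTrace_apply, smoothTrace_apply]
  have h1 : fibreEnd Φ (t, x) = (fibreEnd φ x : V x →ₗ[ℝ] V x) := by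
    refine LinearMap.ext fun v => ?_
    obtain ⟨ε, hε⟩ := exists_section_extension (F := F) (V := V) (𝓡 n) x
    -- A vector in the fibre is extended to a section independent of time; its restriction to the
    -- slice is the extension `ε v` on which `φ` is evaluated.
    have h2 : cylPull (ε v) (t, x) = v := hε v
    have h3 := fibreEnd_apply Φ (t, x) (cylPull (ε v))
    rw [h2] at h3
    refine h3.trans ?_
    have h4 : Φ (cylPull (ε v)) (t, x) = φ (ε v) x :=
      congrArg (fun s : Cₛ^∞⟮𝓡 n; F, V⟯ => s x) (h (cylPull (ε v)))
    exact h4.trans ((fibreEnd_apply φ x (ε v)).symm.trans (congrArg (fibreEnd φ x) (hε v)))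
  rw [h1]
  rfl

end RestrictsTo

namespace LieAlgebroid

variable {𝒜 : LieAlgebroid n FA A}

theorem cylRestrict_affineConnection {D₀ D₁ D : 𝒜.Connection F V} {t : ℝ}
    (hD : ∀ a s, D a s = (1 - t) • D₀ a s + t • D₁ a s) (a : 𝒜.Sec) (σ : CylSection n F V) :
    cylRestrict t (affineConnection D₀ D₁ (0, a) σ) = D a (cylRestrict t σ) := by
  rw [hD, affineConnection_apply, zero_smul, zero_add]
  rfl

theorem restrictsTo_curvature_affineConnection {D₀ D₁ D : 𝒜.Connection F V} {t : ℝ}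
    (hD : ∀ a s, D a s = (1 - t) • D₀ a s + t • D₁ a s) (a b : 𝒜.Sec) :
    RestrictsTo t ((affineConnection D₀ D₁).curvature (0, a) (0, b)) (D.curvature a b) := by
  intro σ
  rw [RLinearConnection.curvature_apply, RLinearConnection.curvature_apply]
  have h : ∀ σ τ : CylSection n F V, cylRestrict t (σ - τ) = cylRestrict t σ - cylRestrict t τ :=
    fun _ _ => rfl
  have h' : ⁅((0 : ℝ), a), ((0 : ℝ), b)⁆ = ((0 : ℝ), ⁅a, b⁆) := rfl
  rw [h, h, h', cylRestrict_affineConnection hD, cylRestrict_affineConnection hD,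
    cylRestrict_affineConnection hD, cylRestrict_affineConnection hD,
    cylRestrict_affineConnection hD]

/-- On arguments without $\partial_t$ component, the affine connection and its curvature involve no
time derivative, so they restrict to each slice. Restriction respects the products, sums and traces
defining the Chern form. -/
theorem cylSlice_chernForm_affineConnection {D₀ D₁ D : 𝒜.Connection F V} {t : ℝ}
    (hD : ∀ a s, D a s = (1 - t) • D₀ a s + t • D₁ a s) (p : ℕ) (a : Fin (2 * p) → 𝒜.Sec) :
    cylSlice t ((affineConnection D₀ D₁).chernForm p fun i => (0, a i)) = D.chernForm p a := by
  refine RestrictsTo.cylSlice_smoothTrace ?_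
  change RestrictsTo t (alternatingPower _ p fun i => (0, a i)) (alternatingPower D.curvature p a)
  rw [alternatingPower_apply, alternatingPower_apply]
  refine RestrictsTo.smul _ (RestrictsTo.sum fun τ => ?_)
  rw [← Int.cast_smul_eq_zsmul ℝ, ← Int.cast_smul_eq_zsmul ℝ]
  exact RestrictsTo.smul _ (RestrictsTo.prod_ofFn fun i =>
    restrictsTo_curvature_affineConnection hD _ _)

theorem d_chernForm (D : 𝒜.Connection F V) (p : ℕ) : 𝒜.d (2 * p) (D.chernForm p) = 0 :=
  D.koszulDifferential_chernForm (fun _ _ => rfl) p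

/-- The action of `ℝ ∂/∂t ⊕ Γ(A)` on `C^∞(ℝ × M)` by linear operators. -/
def cylAction (𝒜 : LieAlgebroid n FA A) :
    (ℝ × 𝒜.Sec) →ₗ[ℝ] Module.End ℝ C^∞⟮cylModel n, ℝ × M; 𝓘(ℝ, ℝ), ℝ⟯ where
  toFun u := (𝒜.cylDerivation u : C^∞⟮cylModel n, ℝ × M; 𝓘(ℝ, ℝ), ℝ⟯ →ₗ[ℝ]
    C^∞⟮cylModel n, ℝ × M; 𝓘(ℝ, ℝ), ℝ⟯)
  map_add' u v := by rw [map_add]; rfl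
  map_smul' c u := by rw [map_smul]; rfl

/-- The Chern form of $\nabla^{\mathrm{aff}}$ is closed, so by Cartan's formula the differential of
its contraction with $\partial_t$ is its time derivative. Integrating this over $[0,1]$ yields the
difference of the two end slices. -/
theorem d_chernSimons (D₀ D₁ : 𝒜.Connection F V) (p : ℕ) :
    𝒜.d (2 * p + 1) (chernSimons D₀ D₁ p) = D₁.chernForm (p + 1) - D₀.chernForm (p + 1) := by
  let ch : AltForm (ℝ × 𝒜.Sec) C^∞⟮cylModel n, ℝ × M; 𝓘(ℝ, ℝ), ℝ⟯ (2 * p + 2) :=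
    (affineConnection D₀ D₁).chernForm (p + 1)
  let ζ : AltForm (ℝ × 𝒜.Sec) C^∞⟮cylModel n, ℝ × M; 𝓘(ℝ, ℝ), ℝ⟯ (2 * p + 1) :=
    ch.curryLeft (1, 0)
  have h_ch : koszulDifferential 𝒜.cylAction (2 * p + 2) ch = 0 :=
    (affineConnection D₀ D₁).koszulDifferential_chernForm (fun _ _ => rfl) (p + 1)
  -- The bracket is componentwise and the first factor is abelian.
  have hcentral : ∀ u : ℝ × 𝒜.Sec, ⁅((1 : ℝ), (0 : 𝒜.Sec)), u⁆ = 0 := fun u =>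
    Prod.ext rfl (zero_lie u.2)
  have h1 := koszulDifferential_curryLeft_of_central 𝒜.cylAction ch hcentral
  rw [h_ch, AlternatingMap.curryLeft_zero, LinearMap.zero_apply] at h1
  -- Restriction of the arguments to $\Gamma(A)$ and integration over the interval both commute with
  -- the differential.
  have h2 : 𝒜.d (2 * p + 1) (chernSimons D₀ D₁ p) = cylIntegral.compAlternatingMap
      ((koszulDifferential 𝒜.cylAction (2 * p + 1) ζ).compLinearMap
        (LinearMap.inr ℝ ℝ 𝒜.Sec)) := by
    rw [← koszulDifferential_compLinearMap 𝒜.cylAction (D' := 𝒜.cylAction ∘ₗ LinearMap.inr ℝ ℝ 𝒜.Sec)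
      (LinearMap.inr ℝ ℝ 𝒜.Sec) (fun a b => rfl) (fun a => rfl)]
    exact koszulDifferential_compAlternatingMap cylIntegral
      (fun a f => cylIntegral_vectorFieldDerivation (𝒜.anchorField a) f) _
  rw [h2, ← sub_eq_zero.1 h1.symm]
  ext1 a
  change cylIntegral (vectorFieldDerivation (cylField (1, 𝒜.anchorField 0)) (ch fun i => (0, a i))) =
    D₁.chernForm (p + 1) a - D₀.chernForm (p + 1) a
  rw [map_zero, cylIntegral_time_derivation]
  refine congrArg₂ (fun f g : C^∞⟮𝓡 n, M; 𝓘(ℝ, ℝ), ℝ⟯ => f - g) ?_ ?_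
  -- At `t = 1` and, in the next case, at `t = 0`, the combination $(1-t)\nabla^0+t\nabla^1$ reduces
  -- to one of the given connections.
  · exact cylSlice_chernForm_affineConnection (fun a s => by module) (p + 1) a
  · exact cylSlice_chernForm_affineConnection (fun a s => by module) (p + 1) a

theorem cohomologyClass_eq_of_d_eq_sub {k : ℕ} {η θ : 𝒜.Form (k + 1)}
    (hη : 𝒜.d (k + 1) η = 0) (hθ : 𝒜.d (k + 1) θ = 0) (ζ : 𝒜.Form k) (h : 𝒜.d k ζ = θ - η) :
    𝒜.cohomologyClass η hη = 𝒜.cohomologyClass θ hθ := by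
  refine ((Submodule.Quotient.eq _).2 ?_).symm
  exact ⟨ζ, h⟩

theorem cohomologyClass_chernForm_eq (D₀ D₁ : 𝒜.Connection F V) (p : ℕ)
    (h₀ : 𝒜.d (2 * (p + 1)) (D₀.chernForm (p + 1)) = 0)
    (h₁ : 𝒜.d (2 * (p + 1)) (D₁.chernForm (p + 1)) = 0) :
    𝒜.cohomologyClass (D₀.chernForm (p + 1)) h₀ = 𝒜.cohomologyClass (D₁.chernForm (p + 1)) h₁ :=
  cohomologyClass_eq_of_d_eq_sub h₀ h₁ (chernSimons D₀ D₁ p) (d_chernSimons D₀ D₁ p)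

end LieAlgebroid
end Transgression

/-! ### Existence of a tensorial connection by partition of unity -/

section Existence

variable {n : ℕ} {M : Type*} [TopologicalSpace M]
  [ChartedSpace (EuclideanSpace ℝ (Fin n)) M] [IsManifold (𝓡 n) ∞ M] [T2Space M]
  {FA : Type*} [NormedAddCommGroup FA] [NormedSpace ℝ FA] [FiniteDimensional ℝ FA]
  {A : M → Type*} [TopologicalSpace (TotalSpace FA A)] [∀ x, AddCommGroup (A x)]
  [∀ x, Module ℝ (A x)] [∀ x, TopologicalSpace (A x)] [FiberBundle FA A]
  [VectorBundle ℝ FA A] [ContMDiffVectorBundle ∞ FA A (𝓡 n)]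
  {F : Type*} [NormedAddCommGroup F] [NormedSpace ℝ F] [FiniteDimensional ℝ F]
  {V : M → Type*} [TopologicalSpace (TotalSpace F V)] [∀ x, AddCommGroup (V x)]
  [∀ x, Module ℝ (V x)] [∀ x, TopologicalSpace (V x)] [FiberBundle F V] [VectorBundle ℝ F V]
  [ContMDiffVectorBundle ∞ F V (𝓡 n)]

/-- The smooth section obtained by gluing sections with a partition of unity. -/
def SmoothPartitionOfUnity.glue {ι : Type*} (ρ : SmoothPartitionOfUnity ι (𝓡 n) M)
    (s : ι → Cₛ^∞⟮𝓡 n; F, V⟯) : Cₛ^∞⟮𝓡 n; F, V⟯ where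
  toFun x := ∑ᶠ i, ρ i x • s i x
  contMDiff_toFun := by
    refine ContMDiff.finsum_section_of_locallyFinite (ρ.locallyFinite.subset fun i x hx => ?_)
      fun i => (ρ i).contMDiff.smul_section (s i).contMDiff
    exact left_ne_zero_of_smul hx

theorem SmoothPartitionOfUnity.glue_apply {ι : Type*} (ρ : SmoothPartitionOfUnity ι (𝓡 n) M)
    (s : ι → Cₛ^∞⟮𝓡 n; F, V⟯) (x : M) :
    ρ.glue s x = ∑ i ∈ ρ.finsupport x, ρ i x • s i x :=
  (ρ.sum_finsupport_smul_eq_finsum x fun i _ => (s i x : V x)).symm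

theorem LieAlgebroid.anchorDerivation_smul (𝒜 : LieAlgebroid n FA A)
    (g f : C^∞⟮𝓡 n, M; 𝓘(ℝ, ℝ), ℝ⟯) (a : 𝒜.Sec) :
    𝒜.anchorDerivation (g • a) f = g * 𝒜.anchorDerivation a f := by
  ext x
  change mfderiv (𝓡 n) 𝓘(ℝ, ℝ) f x (𝒜.anchor x (g x • (show Cₛ^∞⟮𝓡 n; FA, A⟯ from a) x)) =
    g x • mfderiv (𝓡 n) 𝓘(ℝ, ℝ) f x (𝒜.anchor x ((show Cₛ^∞⟮𝓡 n; FA, A⟯ from a) x))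
  rw [map_smul, map_smul]

/-- Every vector bundle admits a `C^∞(M)`-linear `A`-connection. -/
theorem LieAlgebroid.exists_linear_connection [SigmaCompactSpace M] (𝒜 : LieAlgebroid n FA A) :
    ∃ D : 𝒜.Connection F V, ∀ (g : C^∞⟮𝓡 n, M; 𝓘(ℝ, ℝ), ℝ⟯) (a : 𝒜.Sec) (σ : Cₛ^∞⟮𝓡 n; F, V⟯),
      D (g • a) σ = g • D a σ := by
  choose r χ s c hχ hc h using exists_cutoff_frame (F := F) (V := V) (𝓡 n) (N := M)
  -- On `U x` the cut-off `χ x` equals `1`, so the cut-off frame at `x` reproduces sections exactly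
  -- there.
  let U : M → Set M := fun x => interior {y | χ x y = 1}
  obtain ⟨ρ, hρ⟩ : ∃ ρ : SmoothPartitionOfUnity M (𝓡 n) M Set.univ, ρ.IsSubordinate U :=
    SmoothPartitionOfUnity.exists_isSubordinate (𝓡 n) isClosed_univ U (fun x => isOpen_interior)
      fun x _ => Set.mem_iUnion.2 ⟨x, mem_interior_iff_mem_nhds.2 (hχ x)⟩
  have hρχ : ∀ x y, ρ x y * χ x y = ρ x y := by
    intro x y
    by_cases hy : ρ x y = 0
    · rw [hy, zero_mul]
    · have : y ∈ U x := hρ x (subset_tsupport _ hy)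
      have h1 : y ∈ {y | χ x y = 1} := interior_subset this
      have h2 : χ x y = 1 := h1
      rw [h2, mul_one]
  have hρ1 : ∀ y, ∑ x ∈ ρ.finsupport y, ρ x y = 1 := fun y => ρ.sum_finsupport y (Set.mem_univ y)
  let k : ∀ x, Fin (r x) → Cₛ^∞⟮𝓡 n; F, V⟯ → C^∞⟮𝓡 n, M; 𝓘(ℝ, ℝ), ℝ⟯ := fun x i σ =>
    smoothFun (fun y => c x i y (σ y)) ((hc x i).comp σ.contMDiff)
  have k_add : ∀ x i σ τ, k x i (σ + τ) = k x i σ + k x i τ := fun x i σ τ =>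
    ContMDiffMap.ext fun y => (c x i y).map_add _ _
  have k_smul : ∀ x i (b : ℝ) σ, k x i (b • σ) = b • k x i σ := fun x i b σ =>
    ContMDiffMap.ext fun y => (c x i y).map_smul _ _
  have k_smul' : ∀ x i (f : C^∞⟮𝓡 n, M; 𝓘(ℝ, ℝ), ℝ⟯) σ, k x i (f • σ) = f * k x i σ :=
    fun x i f σ => ContMDiffMap.ext fun y => (c x i y).map_smul _ _
  -- The locally flat connection of the frame at `x`: the coefficients of the section are
  -- differentiated and the frame is held constant. It satisfies the Leibniz rule only up to the
  -- factor `χ x`.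
  let P : 𝒜.Sec → Cₛ^∞⟮𝓡 n; F, V⟯ → M → Cₛ^∞⟮𝓡 n; F, V⟯ := fun a σ x =>
    ∑ i, 𝒜.anchorDerivation a (k x i σ) • s x i
  have P_leibniz : ∀ a f σ x, P a (f • σ) x =
      f • P a σ x + (𝒜.anchorDerivation a f * χ x) • σ := by
    intro a f σ x
    have h1 : χ x • σ = ∑ i, k x i σ • s x i := cutoff_frame_sections (hc x) (h x) σ
    simp only [P, k_smul', Derivation.leibniz, mul_smul, h1, Finset.smul_sum, smul_eq_mul, add_smul]
    rw [← Finset.sum_add_distrib]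
    refine Finset.sum_congr rfl fun i _ => ?_
    rw [smul_comm (k x i σ)]
  have glue_ext : ∀ (t : M → Cₛ^∞⟮𝓡 n; F, V⟯) (τ : Cₛ^∞⟮𝓡 n; F, V⟯),
      (∀ y, ∑ x ∈ ρ.finsupport y, ρ x y • t x y = τ y) → ρ.glue t = τ := fun t τ ht =>
    ContMDiffSection.ext fun y => (ρ.glue_apply t y).trans (ht y)
  have glue_add : ∀ t u : M → Cₛ^∞⟮𝓡 n; F, V⟯, ρ.glue (fun x => t x + u x) = ρ.glue t + ρ.glue u :=
    fun t u => glue_ext _ _ fun y => by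
      rw [ContMDiffSection.coe_add, Pi.add_apply, ρ.glue_apply, ρ.glue_apply,
        ← Finset.sum_add_distrib]
      exact Finset.sum_congr rfl fun x _ => smul_add _ _ _
  have glue_smul' : ∀ (f : C^∞⟮𝓡 n, M; 𝓘(ℝ, ℝ), ℝ⟯) (t : M → Cₛ^∞⟮𝓡 n; F, V⟯),
      ρ.glue (fun x => f • t x) = f • ρ.glue t :=
    fun f t => glue_ext _ _ fun y => by
      rw [ContMDiffSection.smooth_smul_apply, ρ.glue_apply, Finset.smul_sum]
      exact Finset.sum_congr rfl fun x _ => smul_comm _ _ _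
  have glue_smul : ∀ (b : ℝ) (t : M → Cₛ^∞⟮𝓡 n; F, V⟯),
      ρ.glue (fun x => b • t x) = b • ρ.glue t :=
    fun b t => glue_ext _ _ fun y => by
      rw [ContMDiffSection.coe_smul, Pi.smul_apply, ρ.glue_apply, Finset.smul_sum]
      exact Finset.sum_congr rfl fun x _ => smul_comm _ _ _
  let D : 𝒜.Connection F V :=
    { toLinearMap := LinearMap.mk₂ ℝ (fun a σ => ρ.glue (P a σ))
        (fun a b σ => by
          rw [← glue_add]
          congr 1
          funext x
          simp only [P, map_add, Derivation.add_apply, add_smul, Finset.sum_add_distrib])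
        (fun b a σ => by
          rw [← glue_smul]
          congr 1
          funext x
          simp only [P, map_smul, Derivation.smul_apply, smul_assoc, Finset.smul_sum])
        (fun a σ τ => by
          rw [← glue_add]
          congr 1
          funext x
          simp only [P, k_add, map_add, add_smul, Finset.sum_add_distrib])
        (fun b a σ => by
          rw [← glue_smul]
          congr 1
          funext x
          simp only [P, k_smul, Derivation.map_smul, smul_assoc, Finset.smul_sum])
      leibniz := fun a f σ => by
        change ρ.glue (P a (f • σ)) = f • ρ.glue (P a σ) + 𝒜.anchorDerivation a f • σ
        have h1 : P a (f • σ) = fun x => f • P a σ x + (𝒜.anchorDerivation a f * χ x) • σ :=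
          funext fun x => P_leibniz a f σ x
        rw [h1, glue_add, glue_smul']
        congr 1
        -- The factor `χ x` in the Leibniz rule of `P` is absorbed by the partition of unity through
        -- `hρχ`; since its functions sum to `1`, the exact Leibniz rule results.
        refine glue_ext _ _ fun y => ?_
        have h2 : ∀ x, ρ x y • ((𝒜.anchorDerivation a f * χ x) • σ) y =
            ρ x y • 𝒜.anchorDerivation a f y • σ y := by
          intro x
          change ρ x y • (𝒜.anchorDerivation a f y * χ x y) • σ y = _
          rw [smul_smul, mul_left_comm, hρχ, smul_smul, mul_comm]
        simp only [h2]
        rw [← Finset.sum_smul, hρ1, one_smul]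
        rfl }
  refine ⟨D, fun g a σ => ?_⟩
  change ρ.glue (P (g • a) σ) = g • ρ.glue (P a σ)
  rw [← glue_smul']
  congr 1
  funext x
  simp only [P, 𝒜.anchorDerivation_smul, mul_smul, Finset.smul_sum]

end Existence

/-! ### Vanishing of the Chern forms of a tensorial connection above the rank -/

section Vanishing

variable {n : ℕ} {M : Type*} [TopologicalSpace M]
  [ChartedSpace (EuclideanSpace ℝ (Fin n)) M] [IsManifold (𝓡 n) ∞ M] [T2Space M]
  {FA : Type*} [NormedAddCommGroup FA] [NormedSpace ℝ FA] [FiniteDimensional ℝ FA]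
  {A : M → Type*} [TopologicalSpace (TotalSpace FA A)] [∀ x, AddCommGroup (A x)]
  [∀ x, Module ℝ (A x)] [∀ x, TopologicalSpace (A x)] [FiberBundle FA A]
  [VectorBundle ℝ FA A] [ContMDiffVectorBundle ∞ FA A (𝓡 n)]
  {F : Type*} [NormedAddCommGroup F] [NormedSpace ℝ F] [FiniteDimensional ℝ F]
  {V : M → Type*} [TopologicalSpace (TotalSpace F V)] [∀ x, AddCommGroup (V x)]
  [∀ x, Module ℝ (V x)] [∀ x, TopologicalSpace (V x)] [FiberBundle F V] [VectorBundle ℝ F V]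
  [ContMDiffVectorBundle ∞ F V (𝓡 n)] {𝒜 : LieAlgebroid n FA A}

/-- The value of an endomorphism of the module of sections at a point, as a homomorphism of
rings. -/
def fibreEndHom (x : M) : Module.End C^∞⟮𝓡 n, M; 𝓘(ℝ, ℝ), ℝ⟯ Cₛ^∞⟮𝓡 n; F, V⟯ →+*
    Module.End ℝ (V x) where
  toFun φ := fibreEnd φ x
  map_one' := LinearMap.ext fun v => by
    obtain ⟨ε, hε⟩ := exists_section_extension (F := F) (V := V) (𝓡 n) x
    rw [← hε v, fibreEnd_apply]
    rfl
  map_mul' φ ψ := LinearMap.ext fun v => by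
    obtain ⟨ε, hε⟩ := exists_section_extension (F := F) (V := V) (𝓡 n) x
    rw [← hε v, fibreEnd_apply, Module.End.mul_apply, Module.End.mul_apply, fibreEnd_apply,
      fibreEnd_apply]
  map_zero' := LinearMap.ext fun v => rfl
  map_add' φ ψ := LinearMap.ext fun v => rfl

namespace LieAlgebroid

/-- The term $(\rho_A\circ b)(g)\nabla_a$ arising when $\nabla_b$ differentiates $g\nabla_a$ cancels
the one coming from the Leibniz rule for $[ga,b]$. -/
theorem curvature_smul_left {D : 𝒜.Connection F V}
    (hD : ∀ (g : C^∞⟮𝓡 n, M; 𝓘(ℝ, ℝ), ℝ⟯) (a : 𝒜.Sec) σ, D (g • a) σ = g • D a σ)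
    (g : C^∞⟮𝓡 n, M; 𝓘(ℝ, ℝ), ℝ⟯) (a b : 𝒜.Sec) :
    D.curvature (g • a) b = g • D.curvature a b := by
  have hb : ⁅g • a, b⁆ = g • ⁅a, b⁆ - 𝒜.anchorDerivation b g • a := by
    have h : ⁅b, g • a⁆ = g • ⁅b, a⁆ + 𝒜.anchorDerivation b g • a := 𝒜.leibniz b a g
    rw [← lie_skew, h, ← lie_skew a b, smul_neg]
    abel
  ext1 σ
  rw [LinearMap.smul_apply, RLinearConnection.curvature_apply, RLinearConnection.curvature_apply,
    hb, map_sub, LinearMap.sub_apply, hD, hD, hD, hD, D.leibniz, smul_sub, smul_sub]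
  abel

/-- The curvature of a `C^∞(M)`-linear connection at `x` vanishes if one of its arguments does. -/
theorem fibreEnd_curvature_eq_zero {D : 𝒜.Connection F V}
    (hD : ∀ (g : C^∞⟮𝓡 n, M; 𝓘(ℝ, ℝ), ℝ⟯) (a : 𝒜.Sec) σ, D (g • a) σ = g • D a σ)
    {x : M} {a : 𝒜.Sec} (ha : (show Cₛ^∞⟮𝓡 n; FA, A⟯ from a) x = 0) (b : 𝒜.Sec) :
    fibreEnd (D.curvature a b) x = 0 := by
  obtain ⟨r, χ, s, c, hχ, hc, h⟩ := exists_cutoff_frame (F := FA) (V := A) (𝓡 n) x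
  let f : Fin r → C^∞⟮𝓡 n, M; 𝓘(ℝ, ℝ), ℝ⟯ := fun i =>
    smoothFun (fun y => c i y ((show Cₛ^∞⟮𝓡 n; FA, A⟯ from a) y))
      ((hc i).comp (show Cₛ^∞⟮𝓡 n; FA, A⟯ from a).contMDiff)
  -- Near `x` the section `a` is a combination of frame sections whose coefficients `f i` vanish at
  -- `x`; tensoriality carries these coefficients out of the curvature.
  have h1 : χ • a = ∑ i, f i • (show 𝒜.Sec from s i) := cutoff_frame_sections hc h _
  have h2 : χ • D.curvature a b = ∑ i, f i • D.curvature (show 𝒜.Sec from s i) b := by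
    rw [← curvature_smul_left hD, h1, map_sum, LinearMap.sum_apply]
    exact Finset.sum_congr rfl fun i _ => curvature_smul_left hD _ _ _
  have hsmul : ∀ (g : C^∞⟮𝓡 n, M; 𝓘(ℝ, ℝ), ℝ⟯)
      (φ : Module.End C^∞⟮𝓡 n, M; 𝓘(ℝ, ℝ), ℝ⟯ Cₛ^∞⟮𝓡 n; F, V⟯),
      fibreEndHom x (g • φ) = g x • fibreEndHom x φ := fun g φ => rfl
  have h3 := congrArg (fibreEndHom x) h2
  rw [map_sum, hsmul, hχ.self_of_nhds, one_smul] at h3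
  refine h3.trans (Finset.sum_eq_zero fun i _ => ?_)
  have h4 : f i x = 0 := by
    change c i x ((show Cₛ^∞⟮𝓡 n; FA, A⟯ from a) x) = 0
    rw [ha, map_zero]
  rw [hsmul, h4, zero_smul]

/-- In every summand the argument `a j` sits in one curvature factor, which vanishes at `x`.
Evaluation at `x` is a ring homomorphism, so the whole product vanishes there. -/
theorem chernForm_apply_eq_zero {D : 𝒜.Connection F V}
    (hD : ∀ (g : C^∞⟮𝓡 n, M; 𝓘(ℝ, ℝ), ℝ⟯) (a : 𝒜.Sec) σ, D (g • a) σ = g • D a σ)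
    {x : M} {p : ℕ} {a : Fin (2 * p) → 𝒜.Sec} {j : Fin (2 * p)}
    (ha : (show Cₛ^∞⟮𝓡 n; FA, A⟯ from a j) x = 0) : D.chernForm p a x = 0 := by
  have h1 : ∀ τ : Equiv.Perm (Fin (2 * p)), fibreEndHom x (List.ofFn fun i : Fin p =>
      D.curvature (a (τ ⟨2 * i, by omega⟩)) (a (τ ⟨2 * i + 1, by omega⟩))).prod = 0 := by
    intro τ
    rw [map_list_prod]
    refine List.prod_eq_zero (List.mem_map.2 ?_)
    -- The position that `τ` assigns to `a j`. It belongs to the factor of index `m / 2`, as first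
    -- argument if `m` is even and as second if `m` is odd; skew-symmetry of the curvature reduces
    -- the odd case to the even one.
    let m : Fin (2 * p) := τ.symm j
    have hm : (m : ℕ) < 2 * p := m.2
    have hτ : τ m = j := τ.apply_symm_apply j
    refine ⟨_, List.mem_ofFn.2 ⟨⟨m / 2, by omega⟩, rfl⟩, ?_⟩
    by_cases h : (m : ℕ) % 2 = 0
    · have h2 : (⟨2 * ((m : ℕ) / 2), by omega⟩ : Fin (2 * p)) = m := Fin.ext (by simp; omega)
      simp only [h2, hτ]
      exact fibreEnd_curvature_eq_zero hD ha _
    · have h2 : (⟨2 * ((m : ℕ) / 2) + 1, by omega⟩ : Fin (2 * p)) = m := Fin.ext (by simp; omega)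
      simp only [h2, hτ]
      rw [D.curvature_skew, map_neg, neg_eq_zero]
      exact fibreEnd_curvature_eq_zero hD ha _
  have h2 : fibreEndHom x (alternatingPower D.curvature p a) = 0 := by
    rw [alternatingPower_apply]
    have hsmul : ∀ (b : ℝ) (φ : Module.End C^∞⟮𝓡 n, M; 𝓘(ℝ, ℝ), ℝ⟯ Cₛ^∞⟮𝓡 n; F, V⟯),
      fibreEndHom x (b • φ) = b • fibreEndHom x φ := fun b φ => rfl
    rw [hsmul, map_sum, Finset.sum_eq_zero fun τ _ => ?_, smul_zero]
    rw [map_zsmul, h1, smul_zero]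
  change LinearMap.trace ℝ (V x) (fibreEndHom x (alternatingPower D.curvature p a)) = 0
  rw [h2, map_zero]

/-- A form vanishes if its degree exceeds the rank of `A` and its value at each point vanishes
whenever one of its arguments vanishes there. -/
theorem form_eq_zero_of_rank_lt {k : ℕ} (η : 𝒜.Form k) (hk : Module.finrank ℝ FA < k)
    (hη : ∀ (x : M) (a : Fin k → 𝒜.Sec) (j : Fin k),
      (show Cₛ^∞⟮𝓡 n; FA, A⟯ from a j) x = 0 → η a x = 0) : η = 0 := by
  ext a x
  have : FiniteDimensional ℝ (A x) := VectorBundle.finiteDimensional ℝ FA A x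
  have hrank : Module.finrank ℝ (A x) < Fintype.card (Fin k) := by
    rw [Fintype.card_fin, VectorBundle.finrank_eq ℝ FA A x]
    exact hk
  have hdep : ¬ LinearIndependent ℝ (fun i => (show Cₛ^∞⟮𝓡 n; FA, A⟯ from a i) x) := fun hli =>
    absurd hli.fintype_card_le_finrank (not_le.2 hrank)
  -- More vectors than the dimension of the fibre: a nontrivial relation with real coefficients
  -- holds at `x`, though not between the sections themselves.
  obtain ⟨l, hl, j, hj⟩ := Fintype.not_linearIndependent_iff.1 hdep
  let ℓ : 𝒜.Sec →ₗ[ℝ] C^∞⟮𝓡 n, M; 𝓘(ℝ, ℝ), ℝ⟯ := η.toMultilinearMap.toLinearMap a j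
  -- With the `j`-th argument replaced by the whole combination, alternation leaves only the
  -- multiple `l j` of the original value; yet the new argument vanishes at `x`, and `l j` is
  -- nonzero.
  have h1 : ℓ (∑ i, l i • a i) = l j • η a := by
    rw [map_sum, Finset.sum_eq_single j]
    · rw [map_smul]
      refine congrArg (fun v => l j • η v) (Function.update_eq_self j a)
    · intro i _ hij
      rw [map_smul]
      have : ℓ (a i) = 0 := η.map_update_self a hij.symm
      rw [this, smul_zero]
    · simp
  have h2 : ℓ (∑ i, l i • a i) x = 0 := by
    refine hη x (Function.update a j (∑ i, l i • a i)) j ?_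
    rw [Function.update_self]
    refine Eq.trans ?_ hl
    exact ContMDiffSection.sum_apply' Finset.univ (fun i => l i • (show Cₛ^∞⟮𝓡 n; FA, A⟯ from a i)) x
  rw [h1] at h2
  exact (mul_eq_zero.1 h2).resolve_left hj

theorem chernForm_eq_zero_of_rank_lt {D : 𝒜.Connection F V}
    (hD : ∀ (g : C^∞⟮𝓡 n, M; 𝓘(ℝ, ℝ), ℝ⟯) (a : 𝒜.Sec) σ, D (g • a) σ = g • D a σ) {p : ℕ}
    (hp : Module.finrank ℝ FA < 2 * p) : D.chernForm p = 0 :=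
  form_eq_zero_of_rank_lt _ hp fun _ _ _ ha => chernForm_apply_eq_zero hD ha

end LieAlgebroid
end Vanishing

end

/-! ### The Chern character theorem -/

theorem mainTheorem2 {n : ℕ} {M : Type*} [TopologicalSpace M]
    [ChartedSpace (EuclideanSpace ℝ (Fin n)) M] [IsManifold (𝓡 n) ∞ M] [T2Space M]
    [SigmaCompactSpace M]
    {FA : Type*} [NormedAddCommGroup FA] [NormedSpace ℝ FA] [FiniteDimensional ℝ FA]
    {A : M → Type*} [TopologicalSpace (TotalSpace FA A)] [∀ x, AddCommGroup (A x)]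
    [∀ x, Module ℝ (A x)] [∀ x, TopologicalSpace (A x)] [FiberBundle FA A]
    [VectorBundle ℝ FA A] [ContMDiffVectorBundle ∞ FA A (𝓡 n)]
    {F : Type*} [NormedAddCommGroup F] [NormedSpace ℝ F] [FiniteDimensional ℝ F]
    {E : M → Type*} [TopologicalSpace (TotalSpace F E)] [∀ x, AddCommGroup (E x)]
    [∀ x, Module ℝ (E x)] [∀ x, TopologicalSpace (E x)] [FiberBundle F E] [VectorBundle ℝ F E]
    [ContMDiffVectorBundle ∞ F E (𝓡 n)]
    (𝒜 : LieAlgebroid n FA A) :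
    (∀ (D : 𝒜.Connection F E) (p : ℕ), 𝒜.d (2 * (p + 1)) (D.chernForm (p + 1)) = 0) ∧
    (∀ (D₀ D₁ : 𝒜.Connection F E) (p : ℕ),
      𝒜.d (2 * p + 1) (LieAlgebroid.chernSimons D₀ D₁ p) =
        D₁.chernForm (p + 1) - D₀.chernForm (p + 1)) ∧
    (∀ (D₀ D₁ : 𝒜.Connection F E) (p : ℕ) (h₀ : 𝒜.d (2 * (p + 1)) (D₀.chernForm (p + 1)) = 0)
      (h₁ : 𝒜.d (2 * (p + 1)) (D₁.chernForm (p + 1)) = 0),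
      𝒜.cohomologyClass (D₀.chernForm (p + 1)) h₀ =
        𝒜.cohomologyClass (D₁.chernForm (p + 1)) h₁) ∧
    (∃! c : DirectSum ℕ (fun k => 𝒜.Cohomology k),
      (∀ (D : 𝒜.Connection F E) (p : ℕ),
        ∃ h : 𝒜.d (2 * (p + 1)) (D.chernForm (p + 1)) = 0,
          c (2 * (p + 1)) = 𝒜.cohomologyClass (D.chernForm (p + 1)) h) ∧
      ∀ k : ℕ, (¬ ∃ p : ℕ, k = 2 * (p + 1)) → c k = 0) := by
  refine ⟨fun D p => LieAlgebroid.d_chernForm D (p + 1), LieAlgebroid.d_chernSimons,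
    LieAlgebroid.cohomologyClass_chernForm_eq, ?_⟩
  -- One tensorial connection serves three purposes: it represents all the classes, it shows that
  -- almost all of them vanish, and it makes the condition on even degrees nonempty, which
  -- uniqueness requires.
  obtain ⟨D₀, hD₀⟩ := 𝒜.exists_linear_connection (F := F) (V := E)
  let κ : ∀ p : ℕ, 𝒜.Cohomology (2 * (p + 1)) := fun p =>
    𝒜.cohomologyClass (D₀.chernForm (p + 1)) (LieAlgebroid.d_chernForm D₀ (p + 1))
  -- The crude bound suffices: if `p` is at least the rank of `A`, then the degree `2 * (p + 1)`
  -- exceeds it, so the representing form is zero.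
  have hκ : ∀ p, Module.finrank ℝ FA ≤ p → κ p = 0 := by
    intro p hp
    have h : (⟨D₀.chernForm (p + 1), LieAlgebroid.d_chernForm D₀ (p + 1)⟩ :
        koszulCocycles 𝒜.anchorAction (2 * (p + 1))) = 0 :=
      Subtype.ext (LieAlgebroid.chernForm_eq_zero_of_rank_lt hD₀ (by omega))
    exact (congrArg Submodule.Quotient.mk h).trans (Submodule.Quotient.mk_zero _)
  let c : DirectSum ℕ (fun k => 𝒜.Cohomology k) :=
    ∑ p ∈ Finset.range (Module.finrank ℝ FA), DirectSum.of (fun k => 𝒜.Cohomology k) (2 * (p + 1)) (κ p)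
  have hc : ∀ k, c k = ∑ p ∈ Finset.range (Module.finrank ℝ FA),
      DirectSum.of (fun k => 𝒜.Cohomology k) (2 * (p + 1)) (κ p) k := fun k =>
    DFinsupp.finsetSum_apply _ _ _
  have hc_even : ∀ p, c (2 * (p + 1)) = κ p := by
    intro p
    rw [hc, Finset.sum_eq_single p]
    · exact DirectSum.of_eq_same _ _
    · intro q _ hq
      exact DirectSum.of_eq_of_ne _ _ _ (by omega)
    -- Outside the finite range of summation the component of `c` is zero, and so is the class, by
    -- `hκ`.
    · intro hp
      rw [Finset.mem_range, not_lt] at hp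
      rw [DirectSum.of_eq_same, hκ p hp]
  have hc_odd : ∀ k, (¬ ∃ p : ℕ, k = 2 * (p + 1)) → c k = 0 := by
    intro k hk
    rw [hc]
    exact Finset.sum_eq_zero fun q _ => DirectSum.of_eq_of_ne _ _ _ fun h => hk ⟨q, h⟩
  refine ⟨c, ⟨fun D p => ⟨LieAlgebroid.d_chernForm D (p + 1), ?_⟩, hc_odd⟩, ?_⟩
  · rw [hc_even]
    exact LieAlgebroid.cohomologyClass_chernForm_eq D₀ D p _ _
  · rintro c' ⟨h_even, h_odd⟩
    refine DFinsupp.ext fun k => ?_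
    by_cases hk : ∃ p : ℕ, k = 2 * (p + 1)
    · obtain ⟨p, rfl⟩ := hk
      obtain ⟨_, h⟩ := h_even D₀ p
      exact h.trans (hc_even p).symm
    · exact (h_odd k hk).trans (hc_odd k hk).symm
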